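/- For $n \ge 1$ let $G_n = \{1,\dots,n\}\times[0,\infty)$ be the disjoint union of $n$ rays, with a vertex at each integer. The Houghton group $H_n$ is the group of all bijections $h$ of the vertex set of $G_n$ that (1) preserve adjacency with at most finitely many exceptions, and (2) preserve ends: for each $i$ there are $i_1,i_2\in\mathbb N$ such that $h(\{i\}\times[i_1,\infty)) = \{i\}\times[i_2,\infty)$ (as sets of vertices). For $n\ge 2$ let $\mathcal P_n = \langle a, r, x_1,\dots,x_n \mid (r, x_1x_2\cdots x_n), (x_1, ax_1),\dots,(x_n,ax_n)\rangle$, and let $\mathcal P_1 = \langle a, r\mid (r, ar)\rangle$. For a semigroup presentation $\mathcal P$ and a non-empty word $w$, $D_b(\mathcal P,w)$ denotes the braided diagram group over $\mathcal P$ based at $w$, i.e. the group of braided $(w,w)$-diagrams over $\mathcal P$ modulo equivalence and insertion and reduction of dipoles, under concatenation. A semigroup presentation is tree-like if every relation $(w_1,w_2)$ satisfies $|w_1|=1$ and $|w_2|>1$, and every letter is the left side of at most one relation. Then for every $n\ge1$: (a) $\mathcal P_n$ is tree-like and $H_n \cong D_b(\mathcal P_n, r)$; (b) $H_n$ is an FSS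 group: there are a compact ultrametric space $X$ and a finite similarity structure $\mathrm{Sim}_X$ on $X$ such that $H_n\cong\Gamma(\mathrm{Sim}_X)$, the group of all homeomorphisms $h$ of $X$ that are locally determined by $\mathrm{Sim}_X$ (every point of $X$ lies in a ball $B$ such that $h(B)$ is a ball and $h|_B\in\mathrm{Sim}_X(B,h(B))$). Moreover $\mathrm{Sim}_X$ can be chosen small, i.e. $|\mathrm{Sim}_X(B_1,B_2)|\le 1$ for all balls $B_1,B_2$ of $X$. -/

import Mathlib

/-! ## Semigroup presentations -/

/-- A semigroup presentation `⟨A ∣ rels⟩`: the alphabet is the type `A`, words are lists, and the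
relations are ordered pairs of non-empty words. -/
structure SemigroupPresentation (A : Type) where
  rels : Set (List A × List A)
  left_ne_nil : ∀ p ∈ rels, p.1 ≠ []
  right_ne_nil : ∀ p ∈ rels, p.2 ≠ []

/-- Tree-like presentations: every left side is a single letter, every right side has length
at least two, and every letter is the left side of at most one relation. -/
def SemigroupPresentation.IsTreeLike {A : Type} (P : SemigroupPresentation A) : Prop :=
  (∀ p ∈ P.rels, p.1.length = 1 ∧ 1 < p.2.length) ∧
    ∀ (a : A) (w₁ w₂ : List A), ([a], w₁) ∈ P.rels → ([a], w₂) ∈ P.rels → w₁ = w₂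

/-! ## Braided diagrams -/

/-- The points at which the top end of a wire can be attached in a diagram with frame top label `w`
and transistors `T` with bottom labels `bot`: position `i` on the top of the frame, or position `i`
on the bottom of a transistor (positions are counted from left to right). -/
abbrev UpperContact {A T : Type} (w : List A) (bot : T → List A) : Type :=
  Fin w.length ⊕ (Σ t : T, Fin (bot t).length)

/-- The points at which the bottom end of a wire can be attached: position `i` on the bottom of the
frame (with label `w`), or position `i` on the top of a transistor. -/
abbrev LowerContact {A T : Type} (w : List A) (top : T → List A) : Type :=
  Fin w.length ⊕ (Σ t : T, Fin (top t).length)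

/-- The letter at a contact. -/
def contactLabel {A T : Type} (w : List A) (u : T → List A) :
    Fin w.length ⊕ (Σ t : T, Fin (u t).length) → A
  | .inl i => w.get i
  | .inr c => (u c.1).get c.2

/-- A braided `(w, w')`-diagram over `P`, recorded by its combinatorial data: a finite set of
transistors with their top and bottom labels, and the set of wires.  Every contact on the frame or
on a transistor belongs to exactly one wire, every wire has one upper and one lower contact, and
the label of the wire is the letter read at both of its contacts; so the wires are a
label-preserving bijection `wire` from the upper contacts to the lower contacts. -/
structure BraidedDiagram {A : Type} (P : SemigroupPresentation A) (w w' : List A) where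
  Transistor : Type
  finite : Finite Transistor
  top : Transistor → List A
  bot : Transistor → List A
  rel : ∀ t, (top t, bot t) ∈ P.rels ∨ (bot t, top t) ∈ P.rels
  wire : UpperContact w bot ≃ LowerContact w' top
  label_wire : ∀ c, contactLabel w' top (wire c) = contactLabel w bot c
  /-- Write `t₁ ≼ t₂` if some wire runs from the bottom of `t₂` to the top of `t₁`.  The transitive
  closure of this relation is a strict partial order. -/
  strictOrder : IsStrictOrder Transistor
    (Relation.TransGen fun t₁ t₂ => ∃ i j, wire (.inr ⟨t₂, i⟩) = .inr ⟨t₁, j⟩)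

namespace BraidedDiagram

variable {A : Type} {P : SemigroupPresentation A} {w w' w₁ w₂ w₃ : List A}

/-- `Δ.Prec t₁ t₂`: a wire runs from the bottom of `t₂` to the top of `t₁`. -/
def Prec (Δ : BraidedDiagram P w w') (t₁ t₂ : Δ.Transistor) : Prop :=
  ∃ i j, Δ.wire (.inr ⟨t₂, i⟩) = .inr ⟨t₁, j⟩

/-- The map on contacts induced by a map `e` of transistors that preserves the labels; it fixes the
contacts on the frame and keeps the left to right position on every transistor. -/
def contactMap {T T' : Type} (w : List A) {u : T → List A} {u' : T' → List A} (e : T → T')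
    (h : ∀ t, u' (e t) = u t) :
    Fin w.length ⊕ (Σ t : T, Fin (u t).length) → Fin w.length ⊕ (Σ t : T', Fin (u' t).length) :=
  Sum.map id (Sigma.map e fun t => Fin.cast (congrArg List.length (h t).symm))

/-- Equivalence of diagrams (existence of a marked homeomorphism): a bijection of the transistors
that preserves top and bottom labels and carries wires to wires, respecting the left to right
positions of the contacts. -/
def Equivalent (Δ Δ' : BraidedDiagram P w w') : Prop :=
  ∃ (e : Δ.Transistor ≃ Δ'.Transistor) (ht : ∀ t, Δ'.top (e t) = Δ.top t)
    (hb : ∀ t, Δ'.bot (e t) = Δ.bot t),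
    ∀ c, Δ'.wire (contactMap w e hb c) = contactMap w' e ht (Δ.wire c)

/-- The transistors `t₁` (below) and `t₂` (above) form a dipole: the bottom label of `t₁` is the top
label of `t₂`, and the wires leaving the bottom of `t₂` are, in order, exactly the wires arriving at
the top of `t₁`. -/
structure IsDipole (Δ : BraidedDiagram P w w') (t₁ t₂ : Δ.Transistor) : Prop where
  prec : Δ.Prec t₁ t₂
  label : Δ.bot t₁ = Δ.top t₂
  length : (Δ.bot t₂).length = (Δ.top t₁).length
  wires : ∀ i : Fin (Δ.bot t₂).length,
    Δ.wire (.inr ⟨t₂, i⟩) = .inr ⟨t₁, Fin.cast length i⟩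

/-- `Δ'` is obtained from `Δ` by reducing a dipole `(t₁, t₂)`: the transistors of `Δ'` are those of
`Δ` other than `t₁` and `t₂`, with the same labels, and a wire of `Δ'` is either a wire of `Δ` or
arises by gluing the bottom of the wire at position `j` on the top of `t₂` to the top of the wire
at position `j` on the bottom of `t₁`. -/
def ReducesTo (Δ Δ' : BraidedDiagram P w w') : Prop :=
  ∃ (t₁ t₂ : Δ.Transistor) (d : Δ.IsDipole t₁ t₂) (e : Δ'.Transistor → Δ.Transistor)
    (ht : ∀ t, Δ.top (e t) = Δ'.top t) (hb : ∀ t, Δ.bot (e t) = Δ'.bot t),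
    Function.Injective e ∧ Set.range e = {t | t ≠ t₁ ∧ t ≠ t₂} ∧
    ∀ c, Δ.wire (contactMap w e hb c) = contactMap w' e ht (Δ'.wire c) ∨
      ∃ j : Fin (Δ.top t₂).length, Δ.wire (contactMap w e hb c) = .inr ⟨t₂, j⟩ ∧
        Δ.wire (.inr ⟨t₁, Fin.cast (congrArg List.length d.label.symm) j⟩) =
          contactMap w' e ht (Δ'.wire c)

/-- The elementary moves whose generated equivalence relation is equivalence modulo dipoles. -/
def Step (Δ Δ' : BraidedDiagram P w w') : Prop :=
  Δ.Equivalent Δ' ∨ Δ.ReducesTo Δ'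

/-- The wires of a concatenation, for arbitrary index types of frame contacts (`I₁` top, `I₂`
middle, `I₃` bottom) and of contacts on the transistors of the upper (`U₁`, `L₁`) and lower
(`U₂`, `L₂`) diagram: follow a wire of the upper diagram and, if it ends at its frame bottom,
continue along the wire of the lower diagram that starts there. -/
def glueWires {I₁ I₂ I₃ U₁ L₁ U₂ L₂ : Type} (f : I₁ ⊕ U₁ ≃ I₂ ⊕ L₁) (g : I₂ ⊕ U₂ ≃ I₃ ⊕ L₂) :
    I₁ ⊕ (U₁ ⊕ U₂) ≃ I₃ ⊕ (L₁ ⊕ L₂) where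
  toFun
    | .inl i => (f (.inl i)).elim (fun k => (g (.inl k)).map id .inr) fun l => .inr (.inl l)
    | .inr (.inl u) => (f (.inr u)).elim (fun k => (g (.inl k)).map id .inr) fun l => .inr (.inl l)
    | .inr (.inr u) => (g (.inr u)).map id .inr
  invFun
    | .inl i => (g.symm (.inl i)).elim (fun k => (f.symm (.inl k)).map id .inl)
        fun u => .inr (.inr u)
    | .inr (.inr l) => (g.symm (.inr l)).elim (fun k => (f.symm (.inl k)).map id .inl)
        fun u => .inr (.inr u)
    | .inr (.inl l) => (f.symm (.inr l)).map id .inl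
  left_inv := by
    rintro (i | u | u)
    · rcases h : f (.inl i) with k | l
      · rcases h' : g (.inl k) with m | m <;>
          simp [h, h', g.symm_apply_eq.2 h'.symm, f.symm_apply_eq.2 h.symm]
      · simp [h, f.symm_apply_eq.2 h.symm]
    · rcases h : f (.inr u) with k | l
      · rcases h' : g (.inl k) with m | m <;>
          simp [h, h', g.symm_apply_eq.2 h'.symm, f.symm_apply_eq.2 h.symm]
      · simp [h, f.symm_apply_eq.2 h.symm]
    · rcases h' : g (.inr u) with m | m <;> simp [h', g.symm_apply_eq.2 h'.symm]
  right_inv := by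
    rintro (i | l | l)
    · rcases h : g.symm (.inl i) with k | u
      · rcases h' : f.symm (.inl k) with m | m <;>
          simp [h, h', ← f.symm_apply_eq.1 h', ← g.symm_apply_eq.1 h]
      · simp [h, ← g.symm_apply_eq.1 h]
    · rcases h' : f.symm (.inr l) with m | m <;> simp [h', ← f.symm_apply_eq.1 h']
    · rcases h : g.symm (.inr l) with k | u
      · rcases h' : f.symm (.inl k) with m | m <;>
          simp [h, h', ← f.symm_apply_eq.1 h', ← g.symm_apply_eq.1 h]
      · simp [h, ← g.symm_apply_eq.1 h]

section Contacts

variable {T₁ T₂ : Type} {u₁ : T₁ → List A} {u₂ : T₂ → List A}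

/-- A transistor contact of the upper diagram, as a contact of the concatenation. -/
def contactInl (s : Σ t : T₁, Fin (u₁ t).length) :
    Σ t : T₁ ⊕ T₂, Fin (Sum.elim u₁ u₂ t).length := ⟨.inl s.1, s.2⟩

/-- A transistor contact of the lower diagram, as a contact of the concatenation. -/
def contactInr (s : Σ t : T₂, Fin (u₂ t).length) :
    Σ t : T₁ ⊕ T₂, Fin (Sum.elim u₁ u₂ t).length := ⟨.inr s.1, s.2⟩

/-- The contacts of a concatenation, sorted by the diagram from which they come. -/
def contactSum (w : List A) (u₁ : T₁ → List A) (u₂ : T₂ → List A) :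
    Fin w.length ⊕ (Σ t : T₁ ⊕ T₂, Fin (Sum.elim u₁ u₂ t).length) ≃
      Fin w.length ⊕ ((Σ t, Fin (u₁ t).length) ⊕ (Σ t, Fin (u₂ t).length)) :=
  (Equiv.refl _).sumCongr (Equiv.sumSigmaDistrib _)

end Contacts

/-- The wiring of the concatenation of `Δ₁` (above) and `Δ₂` (below). -/
def concatWire (Δ₁ : BraidedDiagram P w₁ w₂) (Δ₂ : BraidedDiagram P w₂ w₃) :
    UpperContact w₁ (Sum.elim Δ₁.bot Δ₂.bot) ≃ LowerContact w₃ (Sum.elim Δ₁.top Δ₂.top) :=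
  (contactSum w₁ Δ₁.bot Δ₂.bot).trans
    ((glueWires Δ₁.wire Δ₂.wire).trans (contactSum w₃ Δ₁.top Δ₂.top).symm)

section Wiring

variable (Δ₁ : BraidedDiagram P w₁ w₂) (Δ₂ : BraidedDiagram P w₂ w₃)

theorem concatWire_inl_inl {c : UpperContact w₁ Δ₁.bot} {k} (h : Δ₁.wire c = .inl k) :
    concatWire Δ₁ Δ₂ (c.map id contactInl) = (Δ₂.wire (.inl k)).map id contactInr := by
  rcases c with i | c <;> rcases h' : Δ₂.wire (.inl k) with m | m <;>
    simp [concatWire, contactSum, glueWires, contactInl, contactInr, Equiv.sumSigmaDistrib, h, h']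

theorem concatWire_inl_inr {c : UpperContact w₁ Δ₁.bot} {s} (h : Δ₁.wire c = .inr s) :
    concatWire Δ₁ Δ₂ (c.map id contactInl) = .inr (contactInl s) := by
  rcases c with i | c <;>
    simp [concatWire, contactSum, glueWires, contactInl, Equiv.sumSigmaDistrib, h]

theorem concatWire_inr (s : Σ t, Fin (Δ₂.bot t).length) :
    concatWire Δ₁ Δ₂ (.inr (contactInr s)) = (Δ₂.wire (.inr s)).map id contactInr := by
  rcases h' : Δ₂.wire (.inr s) with m | m <;>
    simp [concatWire, contactSum, glueWires, contactInr, Equiv.sumSigmaDistrib, h']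

theorem upperContact_cases (c : UpperContact w₁ (Sum.elim Δ₁.bot Δ₂.bot)) :
    (∃ d : UpperContact w₁ Δ₁.bot, c = d.map id contactInl) ∨
      ∃ s : Σ t, Fin (Δ₂.bot t).length, c = .inr (contactInr s) := by
  rcases c with i | ⟨t | t, i⟩
  · exact .inl ⟨.inl i, rfl⟩
  · exact .inl ⟨.inr ⟨t, i⟩, rfl⟩
  · exact .inr ⟨⟨t, i⟩, rfl⟩

theorem concatWire_label (c : UpperContact w₁ (Sum.elim Δ₁.bot Δ₂.bot)) :
    contactLabel w₃ (Sum.elim Δ₁.top Δ₂.top) (concatWire Δ₁ Δ₂ c) =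
      contactLabel w₁ (Sum.elim Δ₁.bot Δ₂.bot) c := by
  have key : ∀ d : LowerContact w₃ Δ₂.top,
      contactLabel w₃ (Sum.elim Δ₁.top Δ₂.top) (d.map id contactInr) =
        contactLabel w₃ Δ₂.top d := by
    rintro (i | s) <;> rfl
  have key' : ∀ d : UpperContact w₁ Δ₁.bot,
      contactLabel w₁ (Sum.elim Δ₁.bot Δ₂.bot) (d.map id contactInl) =
        contactLabel w₁ Δ₁.bot d := by
    rintro (i | s) <;> rfl
  rcases upperContact_cases Δ₁ Δ₂ c with ⟨d, rfl⟩ | ⟨s, rfl⟩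
  · rw [key', ← Δ₁.label_wire]
    rcases h : Δ₁.wire d with k | s
    · rw [concatWire_inl_inl Δ₁ Δ₂ h, key, Δ₂.label_wire]
      rfl
    · rw [concatWire_inl_inr Δ₁ Δ₂ h]
      rfl
  · rw [concatWire_inr, key, Δ₂.label_wire]
    rfl

theorem concatWire_prec_inl {t₁ : Δ₁.Transistor} {t : Δ₁.Transistor ⊕ Δ₂.Transistor}
    (h : ∃ i j, concatWire Δ₁ Δ₂ (.inr ⟨t, i⟩) = .inr ⟨.inl t₁, j⟩) :
    ∃ t', t = .inl t' ∧ Δ₁.Prec t₁ t' := by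
  obtain ⟨i, j, h⟩ := h
  rcases t with t | t
  · refine ⟨t, rfl, i, ?_⟩
    rcases h' : Δ₁.wire (.inr ⟨t, i⟩) with k | ⟨a, b⟩
    · have := (concatWire_inl_inl Δ₁ Δ₂ h').symm.trans h
      rcases h'' : Δ₂.wire (.inl k) with m | m <;> rw [h''] at this
      · cases this
      · cases congrArg Sigma.fst (Sum.inr.inj this)
    · have := congrArg Sigma.fst (Sum.inr.inj ((concatWire_inl_inr Δ₁ Δ₂ h').symm.trans h))
      obtain rfl : a = t₁ := Sum.inl.inj this
      exact ⟨b, rfl⟩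
  · have := (concatWire_inr Δ₁ Δ₂ ⟨t, i⟩).symm.trans h
    rcases h'' : Δ₂.wire (.inr ⟨t, i⟩) with m | m <;> rw [h''] at this
    · cases this
    · cases congrArg Sigma.fst (Sum.inr.inj this)

theorem concatWire_prec_inr {t₂ t₂' : Δ₂.Transistor}
    (h : ∃ i j, concatWire Δ₁ Δ₂ (.inr ⟨.inr t₂', i⟩) = .inr ⟨.inr t₂, j⟩) :
    Δ₂.Prec t₂ t₂' := by
  obtain ⟨i, j, h⟩ := h
  refine ⟨i, ?_⟩
  have := (concatWire_inr Δ₁ Δ₂ ⟨t₂', i⟩).symm.trans h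
  rcases h'' : Δ₂.wire (.inr ⟨t₂', i⟩) with m | ⟨a, b⟩ <;> rw [h''] at this
  · cases this
  · obtain rfl : a = t₂ := Sum.inr.inj (congrArg Sigma.fst (Sum.inr.inj this))
    exact ⟨b, rfl⟩

theorem concatWire_strictOrder : IsStrictOrder (Δ₁.Transistor ⊕ Δ₂.Transistor)
    (Relation.TransGen fun t₁ t₂ => ∃ i j, concatWire Δ₁ Δ₂ (.inr ⟨t₂, i⟩) = .inr ⟨t₁, j⟩) := by
  have left : ∀ (a : Δ₁.Transistor) (y), Relation.TransGen (fun t₁ t₂ => ∃ i j,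
      concatWire Δ₁ Δ₂ (.inr ⟨t₂, i⟩) = .inr ⟨t₁, j⟩) (.inl a) y →
      ∃ b, y = .inl b ∧ Relation.TransGen Δ₁.Prec a b := by
    intro a y h
    induction h with
    | single h =>
      obtain ⟨b, rfl, hb⟩ := concatWire_prec_inl Δ₁ Δ₂ h
      exact ⟨b, rfl, .single hb⟩
    | tail _ h ih =>
      obtain ⟨b, rfl, hb⟩ := ih
      obtain ⟨c, rfl, hc⟩ := concatWire_prec_inl Δ₁ Δ₂ h
      exact ⟨c, rfl, hb.tail hc⟩
  have right : ∀ (x) (b : Δ₂.Transistor), Relation.TransGen (fun t₁ t₂ => ∃ i j,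
      concatWire Δ₁ Δ₂ (.inr ⟨t₂, i⟩) = .inr ⟨t₁, j⟩) x (.inr b) →
      ∃ a, x = .inr a ∧ Relation.TransGen Δ₂.Prec a b := by
    intro x b h
    induction h using Relation.TransGen.head_induction_on with
    | @single x h =>
      rcases x with a | a
      · obtain ⟨_, h', -⟩ := concatWire_prec_inl Δ₁ Δ₂ h
        simp at h'
      · exact ⟨a, rfl, .single (concatWire_prec_inr Δ₁ Δ₂ h)⟩
    | @head x y h _ ih =>
      obtain ⟨a, rfl, ha⟩ := ih
      rcases x with a' | a'
      · obtain ⟨_, h', -⟩ := concatWire_prec_inl Δ₁ Δ₂ h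
        simp at h'
      · exact ⟨a', rfl, .head (concatWire_prec_inr Δ₁ Δ₂ h) ha⟩
  refine { irrefl := ?_, trans := fun _ _ _ h h' => h.trans h' }
  rintro (a | a) h
  · obtain ⟨b, hb, hab⟩ := left a _ h
    cases hb
    exact Δ₁.strictOrder.irrefl _ hab
  · obtain ⟨b, hb, hab⟩ := right _ a h
    cases hb
    exact Δ₂.strictOrder.irrefl _ hab

end Wiring

/-- Concatenation: stack `Δ₁` on top of `Δ₂` and glue the wires at the frame bottom of `Δ₁` and the
frame top of `Δ₂` in order from left to right. -/
def concat (Δ₁ : BraidedDiagram P w₁ w₂) (Δ₂ : BraidedDiagram P w₂ w₃) :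
    BraidedDiagram P w₁ w₃ where
  Transistor := Δ₁.Transistor ⊕ Δ₂.Transistor
  finite := by
    have := Δ₁.finite
    have := Δ₂.finite
    infer_instance
  top := Sum.elim Δ₁.top Δ₂.top
  bot := Sum.elim Δ₁.bot Δ₂.bot
  rel := by
    rintro (t | t)
    · exact Δ₁.rel t
    · exact Δ₂.rel t
  wire := concatWire Δ₁ Δ₂
  label_wire := concatWire_label Δ₁ Δ₂
  strictOrder := concatWire_strictOrder Δ₁ Δ₂

theorem contactMap_sumMap_id {T₁ T₁' T₂ : Type} {w : List A} {u₁ : T₁ → List A}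
    {u₁' : T₁' → List A} {u₂ : T₂ → List A} (e : T₁ → T₁')
    (h : ∀ t : T₁ ⊕ T₂, Sum.elim u₁' u₂ (Sum.map e id t) = Sum.elim u₁ u₂ t)
    (m : LowerContact w u₂) :
    contactMap w (u := Sum.elim u₁ u₂) (u' := Sum.elim u₁' u₂) (Sum.map e id) h
      (m.map id contactInr) = m.map id contactInr := by
  rcases m with i | ⟨t, i⟩ <;> rfl

theorem contactMap_sumMap_id' {T₁ T₁' T₂ : Type} {w : List A} {u₁ : T₁ → List A}
    {u₁' : T₁' → List A} {u₂ : T₂ → List A} (e : T₁ → T₁') (he : ∀ t, u₁' (e t) = u₁ t)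
    (h : ∀ t : T₁ ⊕ T₂, Sum.elim u₁' u₂ (Sum.map e id t) = Sum.elim u₁ u₂ t)
    (m : LowerContact w u₁) :
    contactMap w (u := Sum.elim u₁ u₂) (u' := Sum.elim u₁' u₂) (Sum.map e id) h
      (m.map id contactInl) = (contactMap w e he m).map id contactInl := by
  rcases m with i | ⟨t, i⟩ <;> rfl

theorem contactMap_sumId_map {T₁ T₂ T₂' : Type} {w : List A} {u₁ : T₁ → List A}
    {u₂ : T₂ → List A} {u₂' : T₂' → List A} (e : T₂ → T₂')
    (h : ∀ t : T₁ ⊕ T₂, Sum.elim u₁ u₂' (Sum.map id e t) = Sum.elim u₁ u₂ t)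
    (m : LowerContact w u₁) :
    contactMap w (u := Sum.elim u₁ u₂) (u' := Sum.elim u₁ u₂') (Sum.map id e) h
      (m.map id contactInl) = m.map id contactInl := by
  rcases m with i | ⟨t, i⟩ <;> rfl

theorem contactMap_sumId_map' {T₁ T₂ T₂' : Type} {w : List A} {u₁ : T₁ → List A}
    {u₂ : T₂ → List A} {u₂' : T₂' → List A} (e : T₂ → T₂') (he : ∀ t, u₂' (e t) = u₂ t)
    (h : ∀ t : T₁ ⊕ T₂, Sum.elim u₁ u₂' (Sum.map id e t) = Sum.elim u₁ u₂ t)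
    (m : LowerContact w u₂) :
    contactMap w (u := Sum.elim u₁ u₂) (u' := Sum.elim u₁ u₂') (Sum.map id e) h
      (m.map id contactInr) = (contactMap w e he m).map id contactInr := by
  rcases m with i | ⟨t, i⟩ <;> rfl

theorem Step.concat_right {Δ₁ Δ₁' : BraidedDiagram P w₁ w₂} (h : Δ₁.Step Δ₁')
    (Δ₂ : BraidedDiagram P w₂ w₃) : (Δ₁.concat Δ₂).Step (Δ₁'.concat Δ₂) := by
  rcases h with ⟨e, ht, hb, hw⟩ | ⟨t₁, t₂, d, e, ht, hb, hinj, hr, hw⟩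
  · left
    have ht' : ∀ t, Sum.elim Δ₁'.top Δ₂.top (Sum.map e id t) = Sum.elim Δ₁.top Δ₂.top t := by
      rintro (t | t); exacts [ht t, rfl]
    have hb' : ∀ t, Sum.elim Δ₁'.bot Δ₂.bot (Sum.map e id t) = Sum.elim Δ₁.bot Δ₂.bot t := by
      rintro (t | t); exacts [hb t, rfl]
    refine ⟨e.sumCongr (Equiv.refl _), ht', hb', fun c => ?_⟩
    change concatWire Δ₁' Δ₂ (contactMap w₁ (Sum.map e id) hb' c) =
      contactMap w₃ (Sum.map e id) ht' (concatWire Δ₁ Δ₂ c)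
    rcases upperContact_cases Δ₁ Δ₂ c with ⟨c, rfl⟩ | ⟨s, rfl⟩
    · have hc := hw c
      rw [contactMap_sumMap_id' e hb]
      rcases h : Δ₁.wire c with k | s <;> rw [h] at hc
      · rw [concatWire_inl_inl Δ₁ Δ₂ h, concatWire_inl_inl Δ₁' Δ₂ hc, contactMap_sumMap_id]
        rfl
      · rw [concatWire_inl_inr Δ₁ Δ₂ h, concatWire_inl_inr Δ₁' Δ₂ hc]
        rfl
    · rw [concatWire_inr, contactMap_sumMap_id]
      exact concatWire_inr Δ₁' Δ₂ s
  · right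
    have hd : (Δ₁.concat Δ₂).IsDipole (.inl t₁) (.inl t₂) := by
      have hwires : ∀ i : Fin (Δ₁.bot t₂).length, concatWire Δ₁ Δ₂ (.inr ⟨.inl t₂, i⟩) =
          .inr ⟨.inl t₁, Fin.cast d.length i⟩ := fun i => concatWire_inl_inr Δ₁ Δ₂ (d.wires i)
      obtain ⟨i, _, _⟩ := d.prec
      exact ⟨⟨i, _, hwires i⟩, d.label, d.length, hwires⟩
    have ht' : ∀ t, Sum.elim Δ₁.top Δ₂.top (Sum.map e id t) = Sum.elim Δ₁'.top Δ₂.top t := by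
      rintro (t | t); exacts [ht t, rfl]
    have hb' : ∀ t, Sum.elim Δ₁.bot Δ₂.bot (Sum.map e id t) = Sum.elim Δ₁'.bot Δ₂.bot t := by
      rintro (t | t); exacts [hb t, rfl]
    have hr' : Set.range (Sum.map e (id : Δ₂.Transistor → Δ₂.Transistor)) =
        {t | t ≠ Sum.inl t₁ ∧ t ≠ Sum.inl t₂} := by
      ext (t | t)
      · have : (∃ y, e y = t) ↔ t ≠ t₁ ∧ t ≠ t₂ := Set.ext_iff.1 hr t
        simpa using this
      · simp
    refine ⟨.inl t₁, .inl t₂, hd, Sum.map e id, ht', hb', hinj.sumMap Function.injective_id, ?_, fun c => ?_⟩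
    · exact hr'
    change concatWire Δ₁ Δ₂ (contactMap w₁ (Sum.map e id) hb' c) =
        contactMap w₃ (Sum.map e id) ht' (concatWire Δ₁' Δ₂ c) ∨
      ∃ j : Fin (Δ₁.top t₂).length, concatWire Δ₁ Δ₂ (contactMap w₁ (Sum.map e id) hb' c) =
          .inr (contactInl ⟨t₂, j⟩) ∧
        concatWire Δ₁ Δ₂ (Sum.map id contactInl (.inr
          ⟨t₁, Fin.cast (congrArg List.length d.label.symm) j⟩)) =
          contactMap w₃ (Sum.map e id) ht' (concatWire Δ₁' Δ₂ c)
    rcases upperContact_cases Δ₁' Δ₂ c with ⟨c, rfl⟩ | ⟨s, rfl⟩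
    · have hc := hw c
      rw [contactMap_sumMap_id' e hb]
      rcases h : Δ₁'.wire c with k | s <;> rw [h] at hc
      · rw [concatWire_inl_inl Δ₁' Δ₂ h, contactMap_sumMap_id]
        rcases hc with hc | ⟨j, hc, hc'⟩
        · exact .inl (concatWire_inl_inl Δ₁ Δ₂ hc)
        · exact .inr ⟨j, concatWire_inl_inr Δ₁ Δ₂ hc, concatWire_inl_inl Δ₁ Δ₂ hc'⟩
      · rw [concatWire_inl_inr Δ₁' Δ₂ h]
        rcases hc with hc | ⟨j, hc, hc'⟩
        · exact .inl (concatWire_inl_inr Δ₁ Δ₂ hc)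
        · exact .inr ⟨j, concatWire_inl_inr Δ₁ Δ₂ hc, concatWire_inl_inr Δ₁ Δ₂ hc'⟩
    · left
      rw [concatWire_inr, contactMap_sumMap_id]
      exact concatWire_inr Δ₁ Δ₂ s

theorem Step.concat_left (Δ₁ : BraidedDiagram P w₁ w₂) {Δ₂ Δ₂' : BraidedDiagram P w₂ w₃}
    (h : Δ₂.Step Δ₂') : (Δ₁.concat Δ₂).Step (Δ₁.concat Δ₂') := by
  rcases h with ⟨e, ht, hb, hw⟩ | ⟨t₁, t₂, d, e, ht, hb, hinj, hr, hw⟩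
  · left
    have ht' : ∀ t, Sum.elim Δ₁.top Δ₂'.top (Sum.map id e t) = Sum.elim Δ₁.top Δ₂.top t := by
      rintro (t | t); exacts [rfl, ht t]
    have hb' : ∀ t, Sum.elim Δ₁.bot Δ₂'.bot (Sum.map id e t) = Sum.elim Δ₁.bot Δ₂.bot t := by
      rintro (t | t); exacts [rfl, hb t]
    refine ⟨(Equiv.refl _).sumCongr e, ht', hb', fun c => ?_⟩
    change concatWire Δ₁ Δ₂' (contactMap w₁ (Sum.map id e) hb' c) =
      contactMap w₃ (Sum.map id e) ht' (concatWire Δ₁ Δ₂ c)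
    rcases upperContact_cases Δ₁ Δ₂ c with ⟨c, rfl⟩ | ⟨s, rfl⟩
    · rw [contactMap_sumId_map]
      rcases h : Δ₁.wire c with k | s
      · rw [concatWire_inl_inl Δ₁ Δ₂ h, concatWire_inl_inl Δ₁ Δ₂' h,
          contactMap_sumId_map' e ht]
        exact congrArg _ (hw (.inl k))
      · rw [concatWire_inl_inr Δ₁ Δ₂ h, concatWire_inl_inr Δ₁ Δ₂' h]
        rfl
    · rw [concatWire_inr, contactMap_sumId_map' e ht]
      exact (concatWire_inr Δ₁ Δ₂' _).trans (congrArg _ (hw (.inr s)))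
  · right
    have hd : (Δ₁.concat Δ₂).IsDipole (.inr t₁) (.inr t₂) := by
      have hwires : ∀ i : Fin (Δ₂.bot t₂).length, concatWire Δ₁ Δ₂ (.inr ⟨.inr t₂, i⟩) =
          .inr ⟨.inr t₁, Fin.cast d.length i⟩ := fun i =>
        (concatWire_inr Δ₁ Δ₂ ⟨t₂, i⟩).trans (congrArg _ (d.wires i))
      obtain ⟨i, _, _⟩ := d.prec
      exact ⟨⟨i, _, hwires i⟩, d.label, d.length, hwires⟩
    have ht' : ∀ t, Sum.elim Δ₁.top Δ₂.top (Sum.map id e t) = Sum.elim Δ₁.top Δ₂'.top t := by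
      rintro (t | t); exacts [rfl, ht t]
    have hb' : ∀ t, Sum.elim Δ₁.bot Δ₂.bot (Sum.map id e t) = Sum.elim Δ₁.bot Δ₂'.bot t := by
      rintro (t | t); exacts [rfl, hb t]
    have hr' : Set.range (Sum.map (id : Δ₁.Transistor → Δ₁.Transistor) e) =
        {t | t ≠ Sum.inr t₁ ∧ t ≠ Sum.inr t₂} := by
      ext (t | t)
      · simp
      · have : (∃ y, e y = t) ↔ t ≠ t₁ ∧ t ≠ t₂ := Set.ext_iff.1 hr t
        simpa using this
    refine ⟨.inr t₁, .inr t₂, hd, Sum.map id e, ht', hb', Function.injective_id.sumMap hinj, ?_, fun c => ?_⟩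
    · exact hr'
    change concatWire Δ₁ Δ₂ (contactMap w₁ (Sum.map id e) hb' c) =
        contactMap w₃ (Sum.map id e) ht' (concatWire Δ₁ Δ₂' c) ∨
      ∃ j : Fin (Δ₂.top t₂).length, concatWire Δ₁ Δ₂ (contactMap w₁ (Sum.map id e) hb' c) =
          .inr (contactInr ⟨t₂, j⟩) ∧
        concatWire Δ₁ Δ₂ (.inr (contactInr
          ⟨t₁, Fin.cast (congrArg List.length d.label.symm) j⟩)) =
          contactMap w₃ (Sum.map id e) ht' (concatWire Δ₁ Δ₂' c)
    rcases upperContact_cases Δ₁ Δ₂' c with ⟨c, rfl⟩ | ⟨s, rfl⟩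
    · rw [contactMap_sumId_map]
      rcases h : Δ₁.wire c with k | s
      · rw [concatWire_inl_inl Δ₁ Δ₂ h, concatWire_inl_inl Δ₁ Δ₂' h,
          contactMap_sumId_map' e ht]
        rcases hw (.inl k) with hc | ⟨j, hc, hc'⟩
        · exact .inl (congrArg _ hc)
        · exact .inr ⟨j, congrArg _ hc, (concatWire_inr Δ₁ Δ₂ _).trans (congrArg _ hc')⟩
      · left
        rw [concatWire_inl_inr Δ₁ Δ₂ h, concatWire_inl_inr Δ₁ Δ₂' h]
        rfl
    · rw [concatWire_inr Δ₁ Δ₂', contactMap_sumId_map' e ht]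
      rcases hw (.inr s) with hc | ⟨j, hc, hc'⟩
      · exact .inl ((concatWire_inr Δ₁ Δ₂ _).trans (congrArg _ hc))
      · exact .inr ⟨j, (concatWire_inr Δ₁ Δ₂ _).trans (congrArg _ hc),
          (concatWire_inr Δ₁ Δ₂ _).trans (congrArg _ hc')⟩

end BraidedDiagram

/-- `D_b(P, w)`: the braided `(w, w)`-diagrams over `P` modulo dipoles.  (`Quot` divides by the
equivalence relation generated by `Step`, i.e. by equivalence of diagrams together with
reductions and insertions of dipoles.) -/
def BraidedDiagramGroup {A : Type} (P : SemigroupPresentation A) (w : List A) : Type 1 :=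
  Quot (BraidedDiagram.Step (P := P) (w := w) (w' := w))

/-- The operation on `D_b(P, w)` induced by concatenation. -/
instance {A : Type} (P : SemigroupPresentation A) (w : List A) : Mul (BraidedDiagramGroup P w) where
  mul := Quot.map₂ BraidedDiagram.concat (fun Δ _ _ h => BraidedDiagram.Step.concat_left Δ h)
    (fun _ _ Δ h => BraidedDiagram.Step.concat_right h Δ)

/-! ## The Houghton groups -/

/-- The graph `G_n`: the disjoint union of `n` rays, with vertices `(i, k)`. -/
def rayGraph (n : ℕ) : SimpleGraph (Fin n × ℕ) where
  Adj p q := p.1 = q.1 ∧ (p.2 + 1 = q.2 ∨ q.2 + 1 = p.2)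
  symm := ⟨fun _ _ h => ⟨h.1.symm, h.2.symm⟩⟩
  loopless := ⟨fun p h => by have := h.2; omega⟩

/-- `h` preserves adjacency with at most finitely many exceptions. -/
def AlmostPreservesAdj {n : ℕ} (h : Equiv.Perm (Fin n × ℕ)) : Prop :=
  {p : (Fin n × ℕ) × (Fin n × ℕ) |
    (rayGraph n).Adj p.1 p.2 ∧ ¬ (rayGraph n).Adj (h p.1) (h p.2)}.Finite

/-- `h` preserves ends. -/
def PreservesEnds {n : ℕ} (h : Equiv.Perm (Fin n × ℕ)) : Prop :=
  ∀ i : Fin n, ∃ i₁ i₂ : ℕ, h '' ({i} ×ˢ Set.Ici i₁) = {i} ×ˢ Set.Ici i₂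

theorem eventual_translation {n : ℕ} {h : Equiv.Perm (Fin n × ℕ)} (ha : AlmostPreservesAdj h)
    (he : PreservesEnds h) (i : Fin n) : ∃ a b : ℕ, ∀ k, h (i, a + k) = (i, b + k) := by
  obtain ⟨i₁, i₂, hi⟩ := he i
  have hray : ∀ k, i₁ ≤ k → (h (i, k)).1 = i := by
    intro k hk
    have : h (i, k) ∈ ({i} ×ˢ Set.Ici i₂ : Set (Fin n × ℕ)) := by
      rw [← hi]
      exact ⟨(i, k), ⟨rfl, hk⟩, rfl⟩
    exact this.1
  obtain ⟨N, hN⟩ := (ha.image fun p => p.1.2).bddAbove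
  have hadj : ∀ k, N < k → (rayGraph n).Adj (h (i, k)) (h (i, k + 1)) := by
    intro k hk
    by_contra hc
    have := hN ⟨((i, k), (i, k + 1)), ⟨⟨rfl, .inl rfl⟩, hc⟩, rfl⟩
    simp only at this
    omega
  set K := max i₁ (N + 1) with hK
  have hK₁ : i₁ ≤ K := le_max_left _ _
  have hK₂ : N < K := le_max_right i₁ (N + 1)
  set f : ℕ → ℕ := fun k => (h (i, K + k)).2 with hf
  have hval : ∀ k, h (i, K + k) = (i, f k) := fun k =>
    Prod.ext (hray _ (by omega)) rfl
  have hinj : Function.Injective f := by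
    intro x y hxy
    have := h.injective ((hval x).trans ((congrArg _ hxy).trans (hval y).symm))
    simpa using this
  have hstep : ∀ k, f k + 1 = f (k + 1) ∨ f (k + 1) + 1 = f k := by
    intro k
    have := (hadj (K + k) (by omega)).2
    rwa [add_assoc, hval, hval] at this
  have hdown : ∀ k m, f (k + 1) + 1 = f k → f (k + m + 1) + 1 = f (k + m) := by
    intro k m h0
    induction m with
    | zero => exact h0
    | succ m ih =>
      rcases hstep (k + m + 1) with h1 | h1
      · have : f (k + m) = f (k + m + 1 + 1) := by omega
        have := hinj this
        omega
      · exact h1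
  have hup : ∀ k, f k + 1 = f (k + 1) := by
    intro k
    refine (hstep k).resolve_right fun h0 => ?_
    have : ∀ m, f (k + m) + m = f k := by
      intro m
      induction m with
      | zero => rfl
      | succ m ih =>
        have := hdown k m h0
        rw [show k + (m + 1) = k + m + 1 from rfl]
        omega
    have := this (f k + 1)
    omega
  refine ⟨K, f 0, fun k => (hval k).trans ?_⟩
  congr 1
  induction k with
  | zero => rfl
  | succ k ih =>
    have := hup k
    omega

theorem preserves_of_eventual_translation {n : ℕ} {h : Equiv.Perm (Fin n × ℕ)}
    (H : ∀ i, ∃ a b : ℕ, ∀ k, h (i, a + k) = (i, b + k)) :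
    AlmostPreservesAdj h ∧ PreservesEnds h := by
  choose a b H using H
  constructor
  · obtain ⟨N, hN⟩ := (Set.finite_range a).bddAbove
    refine Set.Finite.subset (((Set.finite_univ (α := Fin n)).prod (Set.finite_Iic N)).prod
      ((Set.finite_univ (α := Fin n)).prod (Set.finite_Iic N))) ?_
    rintro ⟨⟨i, x⟩, ⟨j, y⟩⟩ ⟨⟨hij, hxy⟩, hc⟩
    obtain rfl : i = j := hij
    have hi : a i ≤ N := hN ⟨i, rfl⟩
    by_cases hx : a i ≤ x ∧ a i ≤ y
    · exfalso
      obtain ⟨k, rfl⟩ := Nat.exists_eq_add_of_le hx.1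
      obtain ⟨l, rfl⟩ := Nat.exists_eq_add_of_le hx.2
      simp only [H] at hc
      refine hc ⟨rfl, ?_⟩
      simp only at hxy ⊢
      omega
    · simp only [Set.mem_prod, Set.mem_univ, Set.mem_Iic, true_and]
      simp only at hxy
      omega
  · refine fun i => ⟨a i, b i, ?_⟩
    ext ⟨j, y⟩
    constructor
    · rintro ⟨⟨i', x⟩, ⟨hi', hx⟩, hxy⟩
      obtain rfl : i' = i := hi'
      obtain ⟨k, rfl⟩ := Nat.exists_eq_add_of_le (show a i' ≤ x from hx)
      rw [H] at hxy
      cases hxy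
      exact ⟨rfl, Nat.le_add_right _ _⟩
    · rintro ⟨hj, hy⟩
      obtain rfl : j = i := hj
      obtain ⟨k, rfl⟩ := Nat.exists_eq_add_of_le (show b j ≤ y from hy)
      exact ⟨(j, a j + k), ⟨rfl, Nat.le_add_right _ _⟩, H _ _⟩

/-- The Houghton group `H_n`: the bijections of the vertices of `G_n` that preserve adjacency with
at most finitely many exceptions and preserve ends. -/
def houghtonGroup (n : ℕ) : Subgroup (Equiv.Perm (Fin n × ℕ)) where
  carrier := {h | AlmostPreservesAdj h ∧ PreservesEnds h}
  one_mem' := preserves_of_eventual_translation fun _ => ⟨0, 0, fun _ => rfl⟩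
  mul_mem' := by
    rintro g h ⟨ga, ge⟩ ⟨ha, he⟩
    refine preserves_of_eventual_translation fun i => ?_
    obtain ⟨a, b, H⟩ := eventual_translation ha he i
    obtain ⟨c, d, G⟩ := eventual_translation ga ge i
    refine ⟨a + c, d + b, fun k => ?_⟩
    rw [Equiv.Perm.mul_apply, add_assoc, H, show b + (c + k) = c + (b + k) by omega, G, add_assoc]
  inv_mem' := by
    rintro h ⟨ha, he⟩
    refine preserves_of_eventual_translation fun i => ?_
    obtain ⟨a, b, H⟩ := eventual_translation ha he i
    exact ⟨b, a, fun k => by rw [Equiv.Perm.inv_eq_iff_eq, H]⟩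

/-- The letters `a, r, x_1, …, x_n` of the presentation `P_n`, `n ≥ 2`. -/
inductive HoughtonLetter (n : ℕ) : Type
  | a
  | r
  | x (i : Fin n)

/-- `P_n = ⟨a, r, x_1, …, x_n ∣ r = x_1 ⋯ x_n, x_i = a x_i (1 ≤ i ≤ n)⟩`, for `n ≥ 2`. -/
def houghtonPresentation (n : ℕ) (hn : 2 ≤ n) : SemigroupPresentation (HoughtonLetter n) where
  rels := {([.r], List.ofFn HoughtonLetter.x)} ∪ Set.range fun i => ([.x i], [.a, .x i])
  left_ne_nil := by
    rintro p (rfl | ⟨i, rfl⟩) <;> simp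
  right_ne_nil := by
    rintro p (rfl | ⟨i, rfl⟩)
    · simp only [ne_eq, List.ofFn_eq_nil_iff]
      omega
    · simp

/-- The letters `a, r` of the presentation `P_1`. -/
inductive HoughtonLetterOne : Type
  | a
  | r

/-- `P_1 = ⟨a, r ∣ r = a r⟩`. -/
def houghtonPresentationOne : SemigroupPresentation HoughtonLetterOne where
  rels := {([.r], [.a, .r])}
  left_ne_nil := by
    rintro p rfl
    simp
  right_ne_nil := by
    rintro p rfl
    simp

/-! ## Finite similarity structures -/

/-- A ball of `X`: a set of the form `B_r(x)` with `r > 0`. -/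
structure MetricBall (X : Type) [MetricSpace X] where
  carrier : Set X
  exists_eq_ball : ∃ (x : X) (r : ℝ), 0 < r ∧ carrier = Metric.ball x r

/-- A finite similarity structure for `X`.  (A surjective similarity between balls is a bijection,
so the elements of `sim B₁ B₂` are given as equivalences.  In `restrict`, the hypothesis says that
`B₃ ⊆ B₁`, `B₄ = h(B₃)` and `g = h|B₃`.) -/
structure FiniteSimilarityStructure (X : Type) [MetricSpace X] where
  sim : (B₁ B₂ : MetricBall X) → Set (B₁.carrier ≃ B₂.carrier)
  similarity : ∀ (B₁ B₂ : MetricBall X), ∀ h ∈ sim B₁ B₂,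
    ∃ C : ℝ, 0 < C ∧ ∀ x y : B₁.carrier, dist (h x) (h y) = C * dist x y
  finite : ∀ B₁ B₂ : MetricBall X, (sim B₁ B₂).Finite
  refl_mem : ∀ B : MetricBall X, Equiv.refl B.carrier ∈ sim B B
  symm_mem : ∀ (B₁ B₂ : MetricBall X), ∀ h ∈ sim B₁ B₂, h.symm ∈ sim B₂ B₁
  trans_mem : ∀ (B₁ B₂ B₃ : MetricBall X), ∀ h₁ ∈ sim B₁ B₂, ∀ h₂ ∈ sim B₂ B₃,
    h₁.trans h₂ ∈ sim B₁ B₃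
  restrict_mem : ∀ (B₁ B₂ B₃ B₄ : MetricBall X), ∀ h ∈ sim B₁ B₂,
    ∀ (hB : B₃.carrier ⊆ B₁.carrier) (g : B₃.carrier ≃ B₄.carrier),
      (∀ x : B₃.carrier, (g x : X) = h ⟨x, hB x.2⟩) → g ∈ sim B₃ B₄

namespace FiniteSimilarityStructure

variable {X : Type} [MetricSpace X]

/-- A similarity structure is small if there is at most one similarity for every pair of balls. -/
def IsSmall (S : FiniteSimilarityStructure X) : Prop :=
  ∀ B₁ B₂ : MetricBall X, (S.sim B₁ B₂).Subsingleton

/-- `h` is locally determined by `S`: every point has a ball neighbourhood `B` such that `h(B)` is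
a ball `B'` and `h|B ∈ S.sim B B'`. -/
def LocallyDetermines (S : FiniteSimilarityStructure X) (h : X ≃ₜ X) : Prop :=
  ∀ x : X, ∃ B B' : MetricBall X, x ∈ B.carrier ∧ h '' B.carrier = B'.carrier ∧
    ∃ g ∈ S.sim B B', ∀ y : B.carrier, (g y : X) = h y

/-- The restriction of a member of `S` to a smaller ball is again a member of `S`; in particular
its image is a ball. -/
theorem exists_restrict [IsUltrametricDist X] (S : FiniteSimilarityStructure X)
    {B₁ B₂ B₃ : MetricBall X} {h : B₁.carrier ≃ B₂.carrier} (hh : h ∈ S.sim B₁ B₂)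
    (hB : B₃.carrier ⊆ B₁.carrier) :
    ∃ (B₄ : MetricBall X), ∃ g ∈ S.sim B₃ B₄,
      ∀ x : B₃.carrier, (g x : X) = h ⟨x, hB x.2⟩ := by
  obtain ⟨x, r, hr, h₃⟩ := B₃.exists_eq_ball
  obtain ⟨z, s, hs, h₂⟩ := B₂.exists_eq_ball
  obtain ⟨C, hC, hsim⟩ := S.similarity _ _ _ hh
  have hx : x ∈ B₃.carrier := h₃ ▸ Metric.mem_ball_self hr
  set y : X := ((h ⟨x, hB hx⟩ : B₂.carrier) : X) with hy
  have hyz : y ∈ Metric.ball z s := h₂ ▸ (h ⟨x, hB hx⟩).2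
  have hball : Metric.ball z s = Metric.ball y s := (IsUltrametricDist.ball_eq_of_mem hyz)
  let B₄ : MetricBall X := ⟨Metric.ball y (min s (C * r)), y, _, by positivity, rfl⟩
  have hmem : ∀ w : B₁.carrier, (w : X) ∈ B₃.carrier ↔ (h w : X) ∈ B₄.carrier := by
    intro w
    have hw : (h w : X) ∈ Metric.ball y s := hball ▸ h₂ ▸ (h w).2
    have hd : dist (h w : X) y = C * dist (w : X) x := hsim w ⟨x, hB hx⟩
    rw [h₃, Metric.mem_ball]
    change _ ↔ (h w : X) ∈ Metric.ball y (min s (C * r))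
    rw [Metric.mem_ball, lt_min_iff, hd, mul_lt_mul_iff_right₀ hC, ← hd]
    exact ⟨fun h => ⟨hw, h⟩, fun h => h.2⟩
  have hsub : B₄.carrier ⊆ B₂.carrier := by
    rw [h₂, hball]
    exact Metric.ball_subset_ball (min_le_left _ _)
  let g : B₃.carrier ≃ B₄.carrier :=
    { toFun := fun w => ⟨h ⟨w, hB w.2⟩, (hmem _).1 w.2⟩
      invFun := fun v => ⟨h.symm ⟨v, hsub v.2⟩, (hmem _).2 (by simp)⟩
      left_inv := fun w => by simp
      right_inv := fun v => by simp }
  exact ⟨B₄, g, S.restrict_mem _ _ _ _ h hh hB g fun _ => rfl, fun _ => rfl⟩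

theorem image_eq_of_agree {B B' : MetricBall X} {h : X ≃ₜ X} {g : B.carrier ≃ B'.carrier}
    (hg : ∀ y : B.carrier, (g y : X) = h y) : h '' B.carrier = B'.carrier := by
  ext z
  constructor
  · rintro ⟨y, hy, rfl⟩
    exact hg ⟨y, hy⟩ ▸ (g ⟨y, hy⟩).2
  · intro hz
    exact ⟨g.symm ⟨z, hz⟩, (g.symm ⟨z, hz⟩).2, by rw [← hg]; simp⟩

/-- The group `Γ(S)` of all homeomorphisms of `X` that are locally determined by `S`. -/
def group [IsUltrametricDist X] (S : FiniteSimilarityStructure X) : Subgroup (X ≃ₜ X) where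
  carrier := {h | S.LocallyDetermines h}
  one_mem' := fun x =>
    ⟨⟨Metric.ball x 1, x, 1, one_pos, rfl⟩, ⟨Metric.ball x 1, x, 1, one_pos, rfl⟩,
      Metric.mem_ball_self one_pos, Set.image_id _, _, S.refl_mem _, fun _ => rfl⟩
  mul_mem' := by
    intro h₁ h₂ H₁ H₂ x
    obtain ⟨B, B', hx, -, g, hg, hgh⟩ := H₂ x
    obtain ⟨D, D', hx', -, k, hk, hkh⟩ := H₁ (h₂ x)
    have hxB' : h₂ x ∈ B'.carrier := by
      rw [← hgh ⟨x, hx⟩]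
      exact (g ⟨x, hx⟩).2
    have hnest : D.carrier ⊆ B'.carrier ∨ B'.carrier ⊆ D.carrier := by
      obtain ⟨y, r, hr, hD⟩ := D.exists_eq_ball
      obtain ⟨z, s, hs, hB⟩ := B'.exists_eq_ball
      rw [hD] at hx'
      rw [hB] at hxB'
      rw [hD, hB]
      rcases IsUltrametricDist.ball_subset_trichotomy y z r s with h | h | h
      · exact .inl h
      · exact .inr h
      · exact (Set.disjoint_left.1 h hx' hxB').elim
    rcases hnest with hs | hs
    · obtain ⟨E, l, hl, hlg⟩ := S.exists_restrict (S.symm_mem _ _ _ hg) hs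
      have hE : ∀ e : E.carrier, h₂ e = l.symm e := by
        intro e
        have h1 : (e : X) = g.symm ⟨l.symm e, hs (l.symm e).2⟩ := by
          rw [← hlg]; simp
        rw [h1, ← hgh]
        simp
      refine ⟨E, D', ?_, ?_, l.symm.trans k, S.trans_mem _ _ _ _ (S.symm_mem _ _ _ hl) _ hk, ?_⟩
      · have h1 := hlg ⟨h₂ x, hx'⟩
        have h2 : g.symm ⟨h₂ x, hs hx'⟩ = ⟨x, hx⟩ := by
          rw [Equiv.symm_apply_eq]
          exact Subtype.ext (hgh ⟨x, hx⟩).symm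
        rw [h2] at h1
        exact (congrArg (· ∈ E.carrier) h1).mp (l ⟨h₂ x, hx'⟩).2
      · refine image_eq_of_agree (g := l.symm.trans k) fun e => ?_
        simp only [Equiv.trans_apply, hkh, ← hE]
        rfl
      · intro e
        simp only [Equiv.trans_apply, hkh, ← hE]
        rfl
    · obtain ⟨E, l, hl, hlk⟩ := S.exists_restrict hk hs
      have hE : ∀ y : B.carrier, ((g.trans l) y : X) = (h₁ * h₂) y := by
        intro y
        simp only [Equiv.trans_apply, hlk, hkh, hgh]
        rfl
      exact ⟨B, E, hx, image_eq_of_agree hE, g.trans l, S.trans_mem _ _ _ _ hg _ hl, hE⟩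
  inv_mem' := by
    intro h H x
    obtain ⟨B, B', hx, hB, g, hg, hgh⟩ := H (h⁻¹ x)
    have hE : ∀ y : B'.carrier, (g.symm y : X) = h⁻¹ y := by
      intro y
      apply h.injective
      rw [← hgh, Equiv.apply_symm_apply]
      exact (h.apply_symm_apply _).symm
    refine ⟨B', B, ?_, image_eq_of_agree hE, g.symm, S.symm_mem _ _ _ hg, hE⟩
    rw [← hB]
    exact ⟨_, hx, h.apply_symm_apply x⟩

end FiniteSimilarityStructure

/-! Expanding letters again and again, each letter `ℓ` into the word `E ℓ`, produces a tree below
`r`; for $\mathcal P_n$ it consists of $n$ rays with one leaf, labelled `a`, attached at every ray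
vertex. Its terminal vertices are therefore indexed by `Fin n × ℕ`. A braided diagram acts on them:
a point below the letter of a wire travels down the wire, a transistor only rewrites its address
(`Next`), and a terminal point never gets stuck. The resulting bijection of the leaves (`Run`)
carries whole subtrees far out on a ray to subtrees with the same letter, so it is eventually a
translation on each ray, hence an element of $H_n$ (`exists_perm`). Concatenation becomes
composition (`Run.concat`) and crossing a dipole restores the address (`Run.of_reducesTo`), so
$D_b(\mathcal P_n,r)\to H_n$ is a well defined homomorphism.

Surjectivity: cut the tree at two finite subtrees beyond which a given element is a translation; it
matches their leaves and preserves letters. Expanding along one tree, permuting the leaves and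
contracting along the other is a diagram inducing it (`exists_treeDiagram`, `exists_diagram`).

Injectivity: a diagram that fixes every leaf and has a transistor contains a dipole
(`Run.isDipole_or_isEmpty`). If a contraction sits directly above an expansion, they cancel, since a
letter has only one relation. Otherwise no contraction feeds an expansion, and comparing addresses
shows that a lowest expansion is undone at once by a single contraction. Induction on the number of
transistors finishes the argument.

For (b), add an end to every ray, with a metric in which the part of a ray from its `k`-th vertex on
has diameter $2^{-k}$. The similarities are translations within a ray, restrictions of the identity,
and maps between single vertices. There is at most one between two balls, since a translation
mapping a ball onto itself must preserve the height of its lowest vertices (`Shift.eq_of_equiv`). A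
locally determined homeomorphism fixes the ends and is a translation near each, so it is the
extension of an element of $H_n$, and conversely. -/

/-! ## Addresses in the expansion tree -/

/-- The letter reached from `ℓ` in the expansion tree of `E` along a list of child indices. -/
def subLetter {A : Type} (E : A → List A) : A → List ℕ → Option A
  | ℓ, [] => some ℓ
  | ℓ, m :: s => (E ℓ)[m]?.bind fun b => subLetter E b s

/-- `s` leads from `ℓ` to a letter which cannot be expanded. -/
def IsTerminalPath {A : Type} (E : A → List A) (ℓ : A) (s : List ℕ) : Prop :=
  ∃ b, subLetter E ℓ s = some b ∧ E b = []

/-- The relations of `P` are `ℓ = E ℓ`, for the letters `ℓ` with `E ℓ ≠ []`. -/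
structure SemigroupPresentation.IsExpansion {A : Type} (P : SemigroupPresentation A)
    (E : A → List A) : Prop where
  eq_of_mem : ∀ p ∈ P.rels, ∃ ℓ, E ℓ ≠ [] ∧ p = ([ℓ], E ℓ)
  mem : ∀ ℓ, E ℓ ≠ [] → ([ℓ], E ℓ) ∈ P.rels
  length_ne_one : ∀ ℓ, (E ℓ).length ≠ 1

theorem subLetter_append {A : Type} (E : A → List A) (ℓ : A) (s z : List ℕ) :
    subLetter E ℓ (s ++ z) = (subLetter E ℓ s).bind fun b => subLetter E b z := by
  induction s generalizing ℓ with
  | nil => rfl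
  | cons m s ih =>
    simp only [List.cons_append, subLetter, Option.bind_assoc]
    congr 1
    funext b
    exact ih b

/-- The address of the point `s` below position `j` of the word `u`. -/
def addr {A : Type} (u : List A) (j : ℕ) (s : List ℕ) : List ℕ :=
  if u.length = 1 then s else j :: s

section Addr

variable {A : Type} {E : A → List A} {u v : List A}

theorem addr_append (u : List A) (j : ℕ) (s z : List ℕ) :
    addr u j (s ++ z) = addr u j s ++ z := by
  unfold addr
  split <;> rfl

theorem addr_congr (h : u.length = v.length) (j : ℕ) (s : List ℕ) : addr u j s = addr v j s := by
  simp only [addr, h]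

theorem addr_of_ne (h : u.length ≠ 1) (j : ℕ) (s : List ℕ) : addr u j s = j :: s := if_neg h

theorem addr_inj {i j : Fin u.length} {s s' : List ℕ} (h : addr u i s = addr u j s') :
    i = j ∧ s = s' := by
  unfold addr at h
  split at h
  · next h1 => exact ⟨Fin.ext (by omega), h⟩
  · obtain ⟨h1, h2⟩ := List.cons.inj h
    exact ⟨Fin.ext h1, h2⟩

/-- Since `E ℓ` never has length one, the length of `u` tells whether it is `[ℓ]` or `E ℓ`; so
`addr` always yields the address relative to `ℓ`, on either side of a transistor. -/
theorem subLetter_addr {ℓ : A} (hl : (E ℓ).length ≠ 1) (hu : u = [ℓ] ∨ u = E ℓ)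
    (j : Fin u.length) (s : List ℕ) :
    subLetter E ℓ (addr u j s) = subLetter E (u.get j) s := by
  rcases hu with rfl | rfl
  · have : j = ⟨0, Nat.one_pos⟩ := Subsingleton.elim (α := Fin 1) _ _
    subst this
    rfl
  · rw [addr_of_ne hl]
    simp [subLetter]

/-- Only the vertex `ℓ` itself lies below no letter of `E ℓ`; this is the one way in which a point
can get stuck at a transistor. -/
theorem exists_addr_eq {ℓ : A} (hu : u = [ℓ] ∨ u = E ℓ) (hl : (E ℓ).length ≠ 1) {z : List ℕ} {b : A}
    (hz : subLetter E ℓ z = some b) (hne : z ≠ []) :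
    ∃ (m : Fin u.length) (s : List ℕ), addr u m s = z := by
  by_cases hu1 : u = [ℓ]
  · subst hu1
    exact ⟨⟨0, Nat.one_pos⟩, z, rfl⟩
  · obtain rfl := hu.resolve_left hu1
    rcases z with _ | ⟨m, z⟩
    · simp_all
    · have hm : m < (E ℓ).length := by
        by_contra hm
        simp [subLetter, List.getElem?_eq_none (not_lt.1 hm)] at hz
      exact ⟨⟨m, hm⟩, z, addr_of_ne hl _ _⟩

end Addr

namespace BraidedDiagram

variable {A : Type} {P : SemigroupPresentation A} {w w' w₁ w₂ w₃ : List A} {E : A → List A} {r : A}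

/-! ## Following wires -/

/-- Follow the wire that starts at an upper contact and cross the transistor at which it ends; a
point of the expansion tree below the letter of the wire is carried along. -/
def Next (Δ : BraidedDiagram P w w') (x y : UpperContact w Δ.bot × List ℕ) : Prop :=
  ∃ t j m, Δ.wire x.1 = .inr ⟨t, j⟩ ∧ y.1 = .inr ⟨t, m⟩ ∧
    addr (Δ.top t) j x.2 = addr (Δ.bot t) m y.2

/-- The address relative to the letter of the transistor determines position and remaining address,
so the flow is deterministic in both directions. -/
theorem Next.right_unique {Δ : BraidedDiagram P w w'} {x y z} (h : Δ.Next x y) (h' : Δ.Next x z) :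
    y = z := by
  obtain ⟨t, j, m, h1, h2, h3⟩ := h
  obtain ⟨t', j', m', h1', h2', h3'⟩ := h'
  rw [h1] at h1'
  cases h1'
  rw [h3] at h3'
  obtain ⟨rfl, h5⟩ := addr_inj h3'
  exact Prod.ext (h2.trans h2'.symm) h5

theorem Next.left_unique {Δ : BraidedDiagram P w w'} {x y z} (h : Δ.Next x z) (h' : Δ.Next y z) :
    x = y := by
  obtain ⟨t, j, m, h1, h2, h3⟩ := h
  obtain ⟨t', j', m', h1', h2', h3'⟩ := h'
  rw [h2] at h2'
  cases h2'
  rw [← h3] at h3'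
  obtain ⟨rfl, h5⟩ := addr_inj h3'
  exact Prod.ext (Δ.wire.injective (h1.trans h1'.symm)) h5.symm

theorem Next.append {Δ : BraidedDiagram P w w'} {x y} (h : Δ.Next x y) (z : List ℕ) :
    Δ.Next (x.1, x.2 ++ z) (y.1, y.2 ++ z) := by
  obtain ⟨t, j, m, h1, h2, h3⟩ := h
  exact ⟨t, j, m, h1, h2, by simp only [addr_append, h3]⟩

theorem reach_append {Δ : BraidedDiagram P w w'} {x y} (h : Relation.ReflTransGen Δ.Next x y)
    (z : List ℕ) : Relation.ReflTransGen Δ.Next (x.1, x.2 ++ z) (y.1, y.2 ++ z) :=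
  h.lift (fun x => (x.1, x.2 ++ z)) fun _ _ h => h.append z

theorem label_cases (hP : P.IsExpansion E) (Δ : BraidedDiagram P w w') (t : Δ.Transistor) :
    ∃ ℓ, E ℓ ≠ [] ∧ ((Δ.top t = [ℓ] ∧ Δ.bot t = E ℓ) ∨ (Δ.top t = E ℓ ∧ Δ.bot t = [ℓ])) := by
  rcases Δ.rel t with h | h <;> obtain ⟨ℓ, hl, h⟩ := hP.eq_of_mem _ h <;>
    obtain ⟨h1, h2⟩ := Prod.mk.inj h
  · exact ⟨ℓ, hl, .inl ⟨h1, h2⟩⟩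
  · exact ⟨ℓ, hl, .inr ⟨h2, h1⟩⟩

theorem exists_label (hP : P.IsExpansion E) (Δ : BraidedDiagram P w w') (t : Δ.Transistor) :
    ∃ ℓ, E ℓ ≠ [] ∧ (Δ.top t = [ℓ] ∨ Δ.top t = E ℓ) ∧ (Δ.bot t = [ℓ] ∨ Δ.bot t = E ℓ) := by
  obtain ⟨ℓ, h, h1 | h1⟩ := Δ.label_cases hP t
  · exact ⟨ℓ, h, .inl h1.1, .inr h1.2⟩
  · exact ⟨ℓ, h, .inr h1.1, .inl h1.2⟩

/-- Before and after the crossing the same vertex of the tree below the letter of the transistor is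
read, so the letter of a travelling point is an invariant. -/
theorem Next.subLetter_eq (hP : P.IsExpansion E) {Δ : BraidedDiagram P w w'} {x y}
    (h : Δ.Next x y) : subLetter E (contactLabel w Δ.bot x.1) x.2 =
      subLetter E (contactLabel w Δ.bot y.1) y.2 := by
  obtain ⟨t, j, m, h1, h2, h3⟩ := h
  obtain ⟨ℓ, -, ht, hb⟩ := Δ.exists_label hP t
  rw [← Δ.label_wire, h1, h2]
  change subLetter E ((Δ.top t).get j) _ = subLetter E ((Δ.bot t).get m) _
  rw [← subLetter_addr (hP.length_ne_one ℓ) ht, ← subLetter_addr (hP.length_ne_one ℓ) hb, h3]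

theorem reach_subLetter_eq (hP : P.IsExpansion E) {Δ : BraidedDiagram P w w'} {x y}
    (h : Relation.ReflTransGen Δ.Next x y) :
    subLetter E (contactLabel w Δ.bot x.1) x.2 = subLetter E (contactLabel w Δ.bot y.1) y.2 := by
  induction h with
  | refl => rfl
  | tail _ h ih => exact ih.trans (h.subLetter_eq hP)

theorem prec_wellFounded (Δ : BraidedDiagram P w w') : WellFounded Δ.Prec := by
  have := Δ.finite
  have : IsStrictOrder _ (Relation.TransGen Δ.Prec) := Δ.strictOrder
  have h := Finite.wellFounded_of_trans_of_irrefl (Relation.TransGen Δ.Prec)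
  exact Subrelation.wf (fun h => Relation.TransGen.single h) h

theorem prec_swap_wellFounded (Δ : BraidedDiagram P w w') :
    WellFounded (fun a b => Δ.Prec b a) := by
  have := Δ.finite
  have : IsStrictOrder _ (Relation.TransGen Δ.Prec) := Δ.strictOrder
  have h := Finite.wellFounded_of_trans_of_irrefl (Function.swap (Relation.TransGen Δ.Prec))
  exact Subrelation.wf (fun h => Relation.TransGen.single h) h

theorem prec_asymm (Δ : BraidedDiagram P w w') {t t' : Δ.Transistor} (h : Δ.Prec t t')
    (h' : Δ.Prec t' t) : False :=
  Δ.strictOrder.irrefl _ ((Relation.TransGen.single h).tail h')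

theorem prec_irrefl (Δ : BraidedDiagram P w w') {t : Δ.Transistor} (h : Δ.Prec t t) : False :=
  Δ.strictOrder.irrefl _ (.single h)

/-- Induction along the wires from top to bottom. -/
theorem upper_induction (Δ : BraidedDiagram P w w') {motive : UpperContact w Δ.bot → Prop}
    (H : ∀ c, (∀ t j m, Δ.wire c = .inr ⟨t, j⟩ → motive (.inr ⟨t, m⟩)) → motive c) (c) :
    motive c := by
  have key : ∀ t m, motive (.inr ⟨t, m⟩) := by
    intro t
    induction t using Δ.prec_wellFounded.induction with
    | _ t ih => exact fun m => H _ fun t' j m' h => ih t' ⟨m, j, h⟩ m'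
  exact H c fun t _ m _ => key t m

/-- Induction along the wires from bottom to top. -/
theorem lower_induction (Δ : BraidedDiagram P w w') {motive : UpperContact w Δ.bot → Prop}
    (top : ∀ i, motive (.inl i))
    (H : ∀ t m, (∀ j, motive (Δ.wire.symm (.inr ⟨t, j⟩))) → motive (.inr ⟨t, m⟩)) (c) :
    motive c := by
  have key : ∀ t m, motive (.inr ⟨t, m⟩) := by
    intro t
    induction t using Δ.prec_swap_wellFounded.induction with
    | _ t ih =>
      refine fun m => H t m fun j => ?_
      rcases h : Δ.wire.symm (.inr ⟨t, j⟩) with i | ⟨t', m'⟩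
      · exact top i
      · exact ih t' ⟨m', j, Δ.wire.symm_apply_eq.1 h |>.symm⟩ m'
  rcases c with i | ⟨t, m⟩
  exacts [top i, key t m]

/-- An expandable letter is not terminal, so a terminal point below it has a non-empty address and
can cross the transistor. -/
theorem IsTerminalPath.exists_addr_eq {u : List A} (hP : P.IsExpansion E) {ℓ : A} (hl : E ℓ ≠ [])
    (hu : u = [ℓ] ∨ u = E ℓ) {z : List ℕ} (hz : IsTerminalPath E ℓ z) :
    ∃ (m : Fin u.length) (s : List ℕ), addr u m s = z := by
  obtain ⟨b, hb, hb'⟩ := hz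
  refine _root_.exists_addr_eq hu (hP.length_ne_one ℓ) hb ?_
  rintro rfl
  cases hb
  exact hl hb'

/-! ### Runs of points from the top to the bottom of the frame. -/

/-- The only position of the frame label. -/
abbrev frame (r : A) : Fin [r].length := ⟨0, Nat.one_pos⟩

theorem eq_frame (i : Fin [r].length) : i = frame r := Subsingleton.elim (α := Fin 1) _ _

theorem contactLabel_frame {T : Type} (u : T → List A) : contactLabel [r] u (.inl (frame r)) = r :=
  rfl

/-- The point `s` below the top of the frame is carried to the point `s'` above its bottom. -/
def Run (Δ : BraidedDiagram P [r] [r]) (s s' : List ℕ) : Prop :=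
  Relation.ReflTransGen Δ.Next (.inl (frame r), s) (Δ.wire.symm (.inl (frame r)), s')

theorem exists_next (hP : P.IsExpansion E) (Δ : BraidedDiagram P w w') {c : UpperContact w Δ.bot}
    {s : List ℕ} (hs : IsTerminalPath E (contactLabel w Δ.bot c) s) {t j}
    (h : Δ.wire c = .inr ⟨t, j⟩) : ∃ m s', Δ.Next (c, s) (.inr ⟨t, m⟩, s') := by
  obtain ⟨ℓ, hl, ht, hb⟩ := Δ.exists_label hP t
  have hz : IsTerminalPath E ℓ (addr (Δ.top t) j s) := by
    rw [← Δ.label_wire, h] at hs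
    unfold IsTerminalPath
    rwa [subLetter_addr (hP.length_ne_one ℓ) ht]
  obtain ⟨m, s', h'⟩ := IsTerminalPath.exists_addr_eq hP hl hb hz
  exact ⟨m, s', t, j, m, h, rfl, h'.symm⟩

theorem exists_reach_bottom (hP : P.IsExpansion E) (Δ : BraidedDiagram P w [r])
    (c : UpperContact w Δ.bot) : ∀ s, IsTerminalPath E (contactLabel w Δ.bot c) s →
      ∃ s', Relation.ReflTransGen Δ.Next (c, s) (Δ.wire.symm (.inl (frame r)), s') := by
  induction c using Δ.upper_induction with
  | _ c ih =>
    intro s hs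
    rcases h : Δ.wire c with i | ⟨t, j⟩
    · rw [eq_frame i] at h
      rw [← h, Equiv.symm_apply_apply]
      exact ⟨s, .refl⟩
    · obtain ⟨m, s', hn⟩ := Δ.exists_next hP hs h
      have := hn.subLetter_eq hP
      obtain ⟨s'', hr⟩ := ih t j m h s' (by unfold IsTerminalPath; rwa [← this])
      exact ⟨s'', .head hn hr⟩

theorem exists_reach_top (hP : P.IsExpansion E) (Δ : BraidedDiagram P [r] w')
    (c : UpperContact [r] Δ.bot) : ∀ s, IsTerminalPath E (contactLabel [r] Δ.bot c) s →
      ∃ s', Relation.ReflTransGen Δ.Next (.inl (frame r), s') (c, s) := by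
  induction c using Δ.lower_induction with
  | top i => exact fun s _ => ⟨s, by rw [eq_frame i]⟩
  | H t m ih =>
    intro s hs
    obtain ⟨ℓ, hl, ht, hb⟩ := Δ.exists_label hP t
    have hz : IsTerminalPath E ℓ (addr (Δ.bot t) m s) := by
      unfold IsTerminalPath
      rwa [subLetter_addr (hP.length_ne_one ℓ) hb]
    obtain ⟨j, s₁, h₁⟩ := IsTerminalPath.exists_addr_eq hP hl ht hz
    have hn : Δ.Next (Δ.wire.symm (.inr ⟨t, j⟩), s₁) (.inr ⟨t, m⟩, s) :=
      ⟨t, j, m, Equiv.apply_symm_apply _ _, rfl, h₁⟩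
    have := hn.subLetter_eq hP
    obtain ⟨s', h'⟩ := ih j s₁ (by unfold IsTerminalPath; rwa [this])
    exact ⟨s', h'.tail hn⟩

/-- The flow is deterministic, and it stops on the wire that ends at the bottom of the frame. -/
theorem Run.right_unique {Δ : BraidedDiagram P [r] [r]} {s s₁ s₂ : List ℕ} (h₁ : Δ.Run s s₁)
    (h₂ : Δ.Run s s₂) : s₁ = s₂ := by
  have key : ∀ {s₁ s₂}, Relation.ReflTransGen Δ.Next (Δ.wire.symm (.inl (frame r)), s₁)
      (Δ.wire.symm (.inl (frame r)), s₂) → s₁ = s₂ := by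
    intro s₁ s₂ h
    rcases h.cases_head with h | ⟨y, ⟨t, j, m, h, -⟩, -⟩
    · exact congrArg Prod.snd h
    · simp at h
  rcases Relation.ReflTransGen.total_of_right_unique (fun _ _ _ h h' => h.right_unique h')
    h₁ h₂ with h | h
  exacts [key h, (key h).symm]

theorem Run.left_unique {Δ : BraidedDiagram P [r] [r]} {s s₁ s₂ : List ℕ} (h₁ : Δ.Run s₁ s)
    (h₂ : Δ.Run s₂ s) : s₁ = s₂ := by
  have key : ∀ {s₁ s₂}, Relation.ReflTransGen Δ.Next (.inl (frame r), s₁)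
      (.inl (frame r), s₂) → s₁ = s₂ := by
    intro s₁ s₂ h
    rcases h.cases_tail with h | ⟨y, -, ⟨t, j, m, -, h, -⟩⟩
    · exact (congrArg Prod.snd h).symm
    · cases h
  rcases Relation.ReflTransGen.total_of_right_unique (r := Function.swap Δ.Next)
    (fun _ _ _ h h' => Next.left_unique h h') (Relation.reflTransGen_swap.2 h₁)
    (Relation.reflTransGen_swap.2 h₂) with h | h <;> rw [Relation.reflTransGen_swap] at h
  exacts [(key h).symm, key h]

theorem Run.append {Δ : BraidedDiagram P [r] [r]} {s s' : List ℕ} (h : Δ.Run s s')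
    (z : List ℕ) : Δ.Run (s ++ z) (s' ++ z) := reach_append h z

theorem Run.subLetter_eq (hP : P.IsExpansion E) {Δ : BraidedDiagram P [r] [r]} {s s' : List ℕ}
    (h : Δ.Run s s') : subLetter E r s = subLetter E r s' := by
  have := reach_subLetter_eq hP h
  simp only [← Δ.label_wire (Δ.wire.symm (.inl (frame r))), Equiv.apply_symm_apply] at this
  exact this

theorem exists_run (hP : P.IsExpansion E) (Δ : BraidedDiagram P [r] [r]) {s : List ℕ}
    (hs : IsTerminalPath E r s) : ∃ s', Δ.Run s s' :=
  Δ.exists_reach_bottom hP (.inl (frame r)) s hs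

theorem exists_run_to (hP : P.IsExpansion E) (Δ : BraidedDiagram P [r] [r]) {s' : List ℕ}
    (hs : IsTerminalPath E r s') : ∃ s, Δ.Run s s' := by
  refine Δ.exists_reach_top hP (Δ.wire.symm (.inl (frame r))) s' ?_
  rw [← Δ.label_wire, Equiv.apply_symm_apply]
  exact hs

/-! ## Concatenation and moves -/

theorem Run.concat {Δ₁ Δ₂ : BraidedDiagram P [r] [r]} {s₁ s₂ s₃ : List ℕ} (h₁ : Δ₁.Run s₁ s₂)
    (h₂ : Δ₂.Run s₂ s₃) : (Δ₁.concat Δ₂).Run s₁ s₃ := by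
  -- The frame top of `Δ₂` disappears in the concatenation; its role passes to the upper end of the
  -- wire of `Δ₁` that is glued to it.
  let f₂ : UpperContact [r] Δ₂.bot → UpperContact [r] (Δ₁.concat Δ₂).bot :=
    Sum.elim (fun _ => (Δ₁.wire.symm (.inl (frame r))).map id contactInl)
      fun s => .inr (contactInr s)
  have hf₂ : ∀ c, (Δ₁.concat Δ₂).wire (f₂ c) = (Δ₂.wire c).map id contactInr := by
    rintro (i | s)
    · rw [eq_frame i]
      exact concatWire_inl_inl Δ₁ Δ₂ (Equiv.apply_symm_apply _ _)
    · exact concatWire_inr Δ₁ Δ₂ s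
  have l₁ : Relation.ReflTransGen (Δ₁.concat Δ₂).Next (.inl (frame r), s₁)
      (f₂ (.inl (frame r)), s₂) := by
    refine Relation.ReflTransGen.lift
      (f := fun x : UpperContact [r] Δ₁.bot × List ℕ => (x.1.map id contactInl, x.2)) ?_ _ _ h₁
    rintro x y ⟨t, j, m, h, h', h''⟩
    exact ⟨.inl t, j, m, concatWire_inl_inr Δ₁ Δ₂ h, by simp only [h']; rfl, h''⟩
  have l₂ : Relation.ReflTransGen (Δ₁.concat Δ₂).Next (f₂ (.inl (frame r)), s₂)
      (f₂ (Δ₂.wire.symm (.inl (frame r))), s₃) := by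
    refine Relation.ReflTransGen.lift
      (f := fun x : UpperContact [r] Δ₂.bot × List ℕ => (f₂ x.1, x.2)) ?_ _ _ h₂
    rintro x y ⟨t, j, m, h, h', h''⟩
    exact ⟨.inr t, j, m, by simp only [hf₂, h]; rfl, by simp only [h']; rfl, h''⟩
  have hend : f₂ (Δ₂.wire.symm (.inl (frame r))) = (Δ₁.concat Δ₂).wire.symm (.inl (frame r)) := by
    rw [Equiv.eq_symm_apply, hf₂, Equiv.apply_symm_apply]
    rfl
  exact (congrArg (fun c => Relation.ReflTransGen _ _ (c, s₃)) hend).mp (l₁.trans l₂)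

theorem Run.of_equivalent {Δ Δ' : BraidedDiagram P [r] [r]} (h : Δ.Equivalent Δ')
    {s s' : List ℕ} (hs : Δ.Run s s') : Δ'.Run s s' := by
  obtain ⟨e, ht, hb, hw⟩ := h
  have l : Relation.ReflTransGen Δ'.Next (.inl (frame r), s)
      (contactMap [r] e hb (Δ.wire.symm (.inl (frame r))), s') := by
    refine Relation.ReflTransGen.lift
      (f := fun x : UpperContact [r] Δ.bot × List ℕ => (contactMap [r] e hb x.1, x.2)) ?_ _ _ hs
    rintro x y ⟨t, j, m, h, h', h''⟩
    refine ⟨e t, Fin.cast (congrArg List.length (ht t).symm) j,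
      Fin.cast (congrArg List.length (hb t).symm) m, by simp only [hw, h]; rfl,
      by simp only [h']; rfl, ?_⟩
    simpa only [ht, hb, Fin.val_cast] using h''
  have hend : contactMap [r] e hb (Δ.wire.symm (.inl (frame r))) =
      Δ'.wire.symm (.inl (frame r)) := by
    rw [Equiv.eq_symm_apply, hw, Equiv.apply_symm_apply]
    rfl
  exact (congrArg (fun c => Relation.ReflTransGen _ _ (c, s')) hend).mp l

/-- The labels of `t₁` are those of `t₂` upside down, so the second crossing undoes the change of
address made by the first. -/
theorem IsDipole.reach (hP : P.IsExpansion E) {Δ : BraidedDiagram P w w'} {t₁ t₂}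
    (d : Δ.IsDipole t₁ t₂) {c : UpperContact w Δ.bot} {s : List ℕ}
    (hs : IsTerminalPath E (contactLabel w Δ.bot c) s) {j}
    (h : Δ.wire c = .inr ⟨t₂, j⟩) :
    Relation.ReflTransGen Δ.Next (c, s)
      (.inr ⟨t₁, Fin.cast (congrArg List.length d.label.symm) j⟩, s) := by
  obtain ⟨m, s', hn⟩ := Δ.exists_next hP hs h
  refine .head hn (.single ⟨t₁, _, _, d.wires m, rfl, ?_⟩)
  obtain ⟨t, j', m', h1, h2, h3⟩ := hn
  rw [h] at h1
  cases h1
  cases h2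
  simp only at h3 ⊢
  rw [addr_congr (congrArg List.length d.label), ← addr_congr d.length]
  exact h3.symm

/-- Restricting to terminal points matters: if the upper transistor of the dipole expands, the
letter of a glued wire, taken as a point, passes in `Δ'` but is stuck in `Δ`. -/
theorem Run.of_reducesTo (hP : P.IsExpansion E) {Δ Δ' : BraidedDiagram P [r] [r]}
    (h : Δ.ReducesTo Δ') {s s' : List ℕ} (hv : IsTerminalPath E r s) (hs : Δ'.Run s s') :
    Δ.Run s s' := by
  obtain ⟨t₁, t₂, d, e, ht, hb, -, -, hw⟩ := h
  have hlab : ∀ c, contactLabel [r] Δ.bot (contactMap [r] e hb c) = contactLabel [r] Δ'.bot c := by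
    rintro (i | ⟨t, i⟩)
    · rfl
    · simp [contactMap, contactLabel, Sigma.map, hb]
  have l₁ : ∀ c s, IsTerminalPath E (contactLabel [r] Δ'.bot c) s →
      Relation.ReflTransGen Δ.Next (contactMap [r] e hb c, s)
        (Δ.wire.symm (contactMap [r] e ht (Δ'.wire c)), s) := by
    intro c s hc
    rcases hw c with h | ⟨j, h, h'⟩
    · rw [← h, Equiv.symm_apply_apply]
    · rw [← h', Equiv.symm_apply_apply]
      exact d.reach hP (by rwa [hlab]) h
  have key : ∀ x y, Relation.ReflTransGen Δ'.Next x y →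
      IsTerminalPath E (contactLabel [r] Δ'.bot x.1) x.2 →
      Relation.ReflTransGen Δ.Next (contactMap [r] e hb x.1, x.2)
        (contactMap [r] e hb y.1, y.2) := by
    intro x y h hx
    induction h with
    | refl => exact .refl
    | @tail y z hxy hyz ih =>
      have hy : IsTerminalPath E (contactLabel [r] Δ'.bot y.1) y.2 := by
        unfold IsTerminalPath
        rwa [← reach_subLetter_eq hP hxy]
      refine (ih.trans (l₁ _ _ hy)).tail ?_
      obtain ⟨t, j, m, h, h', h''⟩ := hyz
      refine ⟨e t, Fin.cast (congrArg List.length (ht t).symm) j,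
        Fin.cast (congrArg List.length (hb t).symm) m, ?_, by simp only [h']; rfl, ?_⟩
      · rw [Equiv.apply_symm_apply, h]
        rfl
      · simpa only [ht, hb, Fin.val_cast] using h''
  have h1 := key _ _ hs hv
  have h2 := l₁ (Δ'.wire.symm (.inl (frame r))) s' (by
    rw [← Δ'.label_wire, Equiv.apply_symm_apply]
    obtain ⟨b, hb, hb'⟩ := hv
    exact ⟨b, (hs.subLetter_eq hP).symm.trans hb, hb'⟩)
  rw [Equiv.apply_symm_apply] at h2
  exact h1.trans h2

end BraidedDiagram

/-- Wirings and permutations are found below as relations; this turns them into bijections without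
naming an inverse. -/
theorem exists_equiv_of_rel {α β : Type} (R : α → β → Prop) (left_total : ∀ a, ∃ b, R a b)
    (right_total : ∀ b, ∃ a, R a b) (right_unique : ∀ a b b', R a b → R a b' → b = b')
    (left_unique : ∀ a a' b, R a b → R a' b → a = a') : ∃ e : α ≃ β, ∀ a, R a (e a) := by
  choose f hf using left_total
  choose g hg using right_total
  exact ⟨⟨f, g, fun a => left_unique _ _ _ (hg _) (hf a),
    fun b => right_unique _ _ _ (hf _) (hg b)⟩, hf⟩

namespace BraidedDiagram

variable {A : Type} {P : SemigroupPresentation A} {w w' w₁ w₂ w₃ w₄ : List A} {E : A → List A}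
  {r : A}

/-! ## The monoid of diagrams -/

/-- The diagram without transistors all of whose wires are vertical. -/
def identity (P : SemigroupPresentation A) (w : List A) : BraidedDiagram P w w where
  Transistor := Empty
  finite := inferInstance
  top := Empty.elim
  bot := Empty.elim
  rel t := t.elim
  wire := Equiv.refl _
  label_wire _ := rfl
  strictOrder := { irrefl := fun t => t.elim, trans := fun t => t.elim }

instance : IsEmpty (identity P w).Transistor := inferInstanceAs (IsEmpty Empty)

theorem id_concat (Δ : BraidedDiagram P w w') : ((identity P w).concat Δ).Equivalent Δ := by
  refine ⟨Equiv.emptySum _ _, ?_, ?_, ?_⟩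
  · rintro (t | t); exacts [t.elim, rfl]
  · rintro (t | t); exacts [t.elim, rfl]
  · rintro (i | ⟨t | t, i⟩)
    · have : ((identity P w).concat Δ).wire (.inl i) = (Δ.wire (.inl i)).map id contactInr :=
        concatWire_inl_inl (identity P w) Δ (c := .inl i) rfl
      rw [this]
      rcases h : Δ.wire (.inl i) with k | ⟨t, j⟩ <;> exact h
    · exact t.elim
    · have : ((identity P w).concat Δ).wire (.inr ⟨.inr t, i⟩) =
          (Δ.wire (.inr ⟨t, i⟩)).map id contactInr := concatWire_inr (identity P w) Δ ⟨t, i⟩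
      rw [this]
      rcases h : Δ.wire (.inr ⟨t, i⟩) with k | ⟨t, j⟩ <;> exact h

theorem concat_id (Δ : BraidedDiagram P w w') : (Δ.concat (identity P w')).Equivalent Δ := by
  refine ⟨Equiv.sumEmpty _ _, ?_, ?_, ?_⟩
  · rintro (t | t); exacts [rfl, t.elim]
  · rintro (t | t); exacts [rfl, t.elim]
  · intro c
    rcases upperContact_cases Δ (identity P w') c with ⟨d, rfl⟩ | ⟨⟨t, _⟩, rfl⟩
    · rcases h : Δ.wire d with k | ⟨t, j⟩
      · have : (Δ.concat (identity P w')).wire (d.map id contactInl) = .inl k :=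
          concatWire_inl_inl Δ (identity P w') h
        refine Eq.trans ?_ (congrArg (contactMap w' _ _) this).symm
        rcases d with i | ⟨t, i⟩ <;> exact h
      · have : (Δ.concat (identity P w')).wire (d.map id contactInl) = .inr ⟨.inl t, j⟩ :=
          concatWire_inl_inr Δ (identity P w') h
        refine Eq.trans ?_ (congrArg (contactMap w' _ _) this).symm
        rcases d with i | ⟨t, i⟩ <;> exact h
    · exact t.elim

theorem concat_assoc (Δ₁ : BraidedDiagram P w₁ w₂) (Δ₂ : BraidedDiagram P w₂ w₃)
    (Δ₃ : BraidedDiagram P w₃ w₄) :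
    ((Δ₁.concat Δ₂).concat Δ₃).Equivalent (Δ₁.concat (Δ₂.concat Δ₃)) := by
  -- From `Δ₂` on, both bracketings continue alike. This serves wires entering `Δ₂` from `Δ₁` (`c'`
  -- on the frame) and wires starting at a transistor of `Δ₂`.
  have lower : ∀ d : LowerContact w₃ Δ₂.top, ∀ c,
      concatWire Δ₁ Δ₂ c = d.map id contactInr → ∀ c' : UpperContact w₂ Δ₂.bot,
      Δ₂.wire c' = d →
      contactMap w₄ (Equiv.sumAssoc _ _ _)
        (u := Sum.elim (Sum.elim Δ₁.top Δ₂.top) Δ₃.top)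
        (u' := Sum.elim Δ₁.top (Sum.elim Δ₂.top Δ₃.top)) (by rintro ((t | t) | t) <;> rfl)
        (concatWire (Δ₁.concat Δ₂) Δ₃ (c.map id contactInl)) =
        (concatWire Δ₂ Δ₃ (c'.map id contactInl)).map id contactInr := by
    rintro (k | s) c hc c' hc'
    · rw [concatWire_inl_inl (Δ₁.concat Δ₂) Δ₃ (k := k) hc, concatWire_inl_inl Δ₂ Δ₃ hc']
      rcases Δ₃.wire (.inl k) with m | ⟨t, m⟩ <;> rfl
    · rw [concatWire_inl_inr (Δ₁.concat Δ₂) Δ₃ (s := contactInr s) hc,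
        concatWire_inl_inr Δ₂ Δ₃ hc']
      rfl
  refine ⟨Equiv.sumAssoc _ _ _, by rintro ((t | t) | t) <;> rfl,
    by rintro ((t | t) | t) <;> rfl, fun c => ?_⟩
  change concatWire Δ₁ (Δ₂.concat Δ₃) _ = contactMap w₄ _ _ (concatWire (Δ₁.concat Δ₂) Δ₃ c)
  rcases upperContact_cases (Δ₁.concat Δ₂) Δ₃ c with ⟨c, rfl⟩ | ⟨s, rfl⟩
  · rcases upperContact_cases Δ₁ Δ₂ c with ⟨c, rfl⟩ | ⟨s, rfl⟩
    · have hc : contactMap w₁ (Equiv.sumAssoc Δ₁.Transistor Δ₂.Transistor Δ₃.Transistor)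
          (u := Sum.elim (Sum.elim Δ₁.bot Δ₂.bot) Δ₃.bot)
          (u' := Sum.elim Δ₁.bot (Sum.elim Δ₂.bot Δ₃.bot)) (by rintro ((t | t) | t) <;> rfl)
          ((c.map id contactInl).map id contactInl) =
          c.map id contactInl := by
        rcases c with i | ⟨t, i⟩ <;> rfl
      refine (congrArg (concatWire Δ₁ (Δ₂.concat Δ₃)) hc).trans ?_
      rcases h : Δ₁.wire c with k | s
      · refine (concatWire_inl_inl Δ₁ (Δ₂.concat Δ₃) h).trans ?_
        exact (lower _ _ (concatWire_inl_inl Δ₁ Δ₂ h) (.inl k) rfl).symm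
      · have := concatWire_inl_inr (Δ₁.concat Δ₂) Δ₃ (s := contactInl s)
          (concatWire_inl_inr Δ₁ Δ₂ h)
        refine (concatWire_inl_inr Δ₁ (Δ₂.concat Δ₃) h).trans
          (Eq.trans ?_ (congrArg (contactMap w₄ _ _) this).symm)
        rfl
    · have := concatWire_inr Δ₁ (Δ₂.concat Δ₃) (contactInl s)
      exact this.trans (lower _ _ (concatWire_inr Δ₁ Δ₂ s) (.inr s) rfl).symm
  · have h1 := concatWire_inr Δ₁ (Δ₂.concat Δ₃) (contactInr s)
    have h2 := concatWire_inr (Δ₁.concat Δ₂) Δ₃ s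
    rw [h2]
    refine h1.trans ((congrArg (Sum.map id contactInr) (concatWire_inr Δ₂ Δ₃ s)).trans ?_)
    rcases Δ₃.wire (.inr s) with m | ⟨t, m⟩ <;> rfl

/-! ## Reduction of dipoles -/

theorem contactMap_injective {T T' : Type} (w : List A) {u : T → List A} {u' : T' → List A}
    {e : T → T'} (he : Function.Injective e) (h : ∀ t, u' (e t) = u t) :
    Function.Injective (contactMap w e h) :=
  Function.injective_id.sumMap (he.sigma_map fun _ => Fin.cast_injective _)

theorem contactMap_val_ne {T : Type} {p : T → Prop} (w : List A) (u : T → List A) {t : T}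
    (ht : ¬ p t) (c : Fin w.length ⊕ (Σ t : Subtype p, Fin (u t).length)) (i) :
    contactMap w (u := fun t : Subtype p => u t) Subtype.val (fun _ => rfl) c ≠ .inr ⟨t, i⟩ := by
  rcases c with j | ⟨⟨t', ht'⟩, j⟩ <;> intro h
  · cases h
  · have h : t' = t := congrArg Sigma.fst (Sum.inr.inj h)
    exact ht (h ▸ ht')

/-- A single gluing suffices: every wire into `t₁` starts at `t₂`, and acyclicity keeps the wires
leaving `t₁` away from both. The glued wires thus form a bijection, and each new precedence comes
from a descending chain of old ones. -/
theorem IsDipole.exists_reducesTo {Δ : BraidedDiagram P w w'} {t₁ t₂ : Δ.Transistor}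
    (d : Δ.IsDipole t₁ t₂) :
    ∃ Δ' : BraidedDiagram P w w', Δ.ReducesTo Δ' ∧
      Nat.card Δ'.Transistor < Nat.card Δ.Transistor := by
  let T := {t : Δ.Transistor // t ≠ t₁ ∧ t ≠ t₂}
  let ι : UpperContact w (fun t : T => Δ.bot t) → UpperContact w Δ.bot :=
    contactMap w Subtype.val fun _ => rfl
  let κ : LowerContact w' (fun t : T => Δ.top t) → LowerContact w' Δ.top :=
    contactMap w' Subtype.val fun _ => rfl
  let mid (j : Fin (Δ.top t₂).length) : UpperContact w Δ.bot :=
    .inr ⟨t₁, Fin.cast (congrArg List.length d.label.symm) j⟩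
  have hne : t₁ ≠ t₂ := fun h => Δ.prec_irrefl (h ▸ d.prec)
  have hιi : Function.Injective ι := contactMap_injective w Subtype.val_injective _
  have hκi : Function.Injective κ := contactMap_injective w' Subtype.val_injective _
  have hι₁ : ∀ c i, ι c ≠ .inr ⟨t₁, i⟩ := contactMap_val_ne w _ fun h => h.1 rfl
  have hι₂ : ∀ c i, ι c ≠ .inr ⟨t₂, i⟩ := contactMap_val_ne w _ fun h => h.2 rfl
  have hκ₁ : ∀ c i, κ c ≠ .inr ⟨t₁, i⟩ := contactMap_val_ne w' _ fun h => h.1 rfl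
  have hκ₂ : ∀ c i, κ c ≠ .inr ⟨t₂, i⟩ := contactMap_val_ne w' _ fun h => h.2 rfl
  have hup : ∀ c : UpperContact w Δ.bot,
      (∃ c', c = ι c') ∨ (∃ j, c = mid j) ∨ ∃ i, c = .inr ⟨t₂, i⟩ := by
    rintro (i | ⟨t, i⟩)
    · exact .inl ⟨.inl i, rfl⟩
    · by_cases h₁ : t = t₁
      · subst h₁
        exact .inr (.inl ⟨Fin.cast (congrArg List.length d.label) i, rfl⟩)
      by_cases h₂ : t = t₂
      · subst h₂
        exact .inr (.inr ⟨i, rfl⟩)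
      exact .inl ⟨.inr ⟨⟨t, h₁, h₂⟩, i⟩, rfl⟩
  have hlo : ∀ c : LowerContact w' Δ.top,
      (∃ c', c = κ c') ∨ (∃ j, c = .inr ⟨t₁, j⟩) ∨ ∃ i, c = .inr ⟨t₂, i⟩ := by
    rintro (i | ⟨t, i⟩)
    · exact .inl ⟨.inl i, rfl⟩
    · by_cases h₁ : t = t₁
      · subst h₁
        exact .inr (.inl ⟨i, rfl⟩)
      by_cases h₂ : t = t₂
      · subst h₂
        exact .inr (.inr ⟨i, rfl⟩)
      exact .inl ⟨.inr ⟨⟨t, h₁, h₂⟩, i⟩, rfl⟩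
  have h₁₂ : ∀ c j, Δ.wire c = .inr ⟨t₁, j⟩ → ∃ i, c = .inr ⟨t₂, i⟩ := by
    intro c j h
    exact ⟨Fin.cast d.length.symm j, Δ.wire.injective (h.trans (d.wires (Fin.cast d.length.symm j)).symm)⟩
  let R (c : UpperContact w (fun t : T => Δ.bot t)) (c' : LowerContact w' (fun t : T => Δ.top t)) :=
    Δ.wire (ι c) = κ c' ∨ ∃ j, Δ.wire (ι c) = .inr ⟨t₂, j⟩ ∧ Δ.wire (mid j) = κ c'
  have hmid : ∀ j, ∃ c', Δ.wire (mid j) = κ c' := by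
    intro j
    rcases hlo (Δ.wire (mid j)) with h | ⟨i, h⟩ | ⟨i, h⟩
    · exact h
    · obtain ⟨k, hk⟩ := h₁₂ _ _ h
      cases hk
      exact (hne rfl).elim
    · exact (Δ.prec_asymm d.prec ⟨_, _, h⟩).elim
  obtain ⟨e, he⟩ := exists_equiv_of_rel R
    (by
      intro c
      rcases hlo (Δ.wire (ι c)) with ⟨c', h⟩ | ⟨j, h⟩ | ⟨j, h⟩
      · exact ⟨c', .inl h⟩
      · obtain ⟨i, hi⟩ := h₁₂ _ _ h
        exact (hι₂ _ _ hi).elim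
      · obtain ⟨c', hc'⟩ := hmid j
        exact ⟨c', .inr ⟨j, h, hc'⟩⟩)
    (by
      intro c'
      have hw : ∀ {c}, Δ.wire.symm (κ c') = c → Δ.wire c = κ c' := fun h =>
        (Δ.wire.symm_apply_eq.1 h).symm
      rcases hup (Δ.wire.symm (κ c')) with ⟨c, h⟩ | ⟨j, h⟩ | ⟨i, h⟩
      · exact ⟨c, .inl (hw h)⟩
      · rcases hup (Δ.wire.symm (.inr ⟨t₂, j⟩)) with ⟨c, h'⟩ | ⟨k, h'⟩ | ⟨i, h'⟩
        · exact ⟨c, .inr ⟨j, (Δ.wire.symm_apply_eq.1 h').symm, hw h⟩⟩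
        · exact (Δ.prec_asymm d.prec ⟨_, _, (Δ.wire.symm_apply_eq.1 h').symm⟩).elim
        · exact (Δ.prec_irrefl ⟨_, _, (Δ.wire.symm_apply_eq.1 h').symm⟩).elim
      · have := hw h
        rw [d.wires] at this
        exact (hκ₁ _ _ this.symm).elim)
    (by
      rintro c b b' (h | ⟨j, h, hj⟩) (h' | ⟨j', h', hj'⟩)
      · exact hκi (h.symm.trans h')
      · exact (hκ₂ _ _ (h.symm.trans h')).elim
      · exact (hκ₂ _ _ (h'.symm.trans h)).elim
      · have := h.symm.trans h'
        cases this
        exact hκi (hj.symm.trans hj'))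
    (by
      rintro c c' b (h | ⟨j, h, hj⟩) (h' | ⟨j', h', hj'⟩)
      · exact hιi (Δ.wire.injective (h.trans h'.symm))
      · exact (hι₁ _ _ (Δ.wire.injective (h.trans hj'.symm))).elim
      · exact (hι₁ _ _ (Δ.wire.injective (h'.trans hj.symm))).elim
      · have := Δ.wire.injective (hj.trans hj'.symm)
        simp only [mid, Sum.inr.injEq, Sigma.mk.injEq, heq_eq_eq, true_and] at this
        obtain rfl : j = j' := Fin.ext (by simpa using congrArg Fin.val this)
        exact hιi (Δ.wire.injective (h.trans h'.symm)))
  have hlabι : ∀ c, contactLabel w Δ.bot (ι c) = contactLabel w (fun t : T => Δ.bot t) c := by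
    rintro (i | ⟨t, i⟩) <;> rfl
  have hlabκ : ∀ c, contactLabel w' Δ.top (κ c) = contactLabel w' (fun t : T => Δ.top t) c := by
    rintro (i | ⟨t, i⟩) <;> rfl
  have hlab : ∀ j, contactLabel w Δ.bot (mid j) = (Δ.top t₂).get j := by
    intro j
    change (Δ.bot t₁).get _ = _
    simp [d.label]
  have hprec : ∀ a b : T, (∃ i j, e (.inr ⟨b, i⟩) = .inr ⟨a, j⟩) →
      Relation.TransGen Δ.Prec a.1 b.1 := by
    rintro a b ⟨i, j, hij⟩
    rcases he (.inr ⟨b, i⟩) with h | ⟨k, h, hk⟩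
    · rw [hij] at h
      exact .single ⟨i, j, h⟩
    · rw [hij] at hk
      -- A glued wire replaces the chain `a`, `t₁`, `t₂`, `b`, read upwards.
      exact .head ⟨_, _, hk⟩ (.head d.prec (.single ⟨_, _, h⟩))
  have htrans : ∀ a b : T, Relation.TransGen (fun a b => ∃ i j, e (.inr ⟨b, i⟩) = .inr ⟨a, j⟩) a b →
      Relation.TransGen Δ.Prec a.1 b.1 := by
    intro a b h
    induction h with
    | single h => exact hprec _ _ h
    | tail _ h ih => exact ih.trans (hprec _ _ h)
  have := Δ.finite
  refine ⟨{ Transistor := T, finite := inferInstance, top := fun t => Δ.top t,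
            bot := fun t => Δ.bot t, rel := fun t => Δ.rel t, wire := e, label_wire := fun c => ?_,
            strictOrder := ?_ }, ?_, ?_⟩
  · rw [← hlabκ, ← hlabι, ← Δ.label_wire]
    rcases he c with h | ⟨j, h, hj⟩
    · rw [h]
    · rw [← hj, Δ.label_wire, h, hlab]
      rfl
  · exact { irrefl := fun a h => Δ.strictOrder.irrefl _ (htrans _ _ h)
            trans := fun _ _ _ h h' => h.trans h' }
  · refine ⟨t₁, t₂, d, Subtype.val, fun _ => rfl, fun _ => rfl, Subtype.val_injective, ?_, he⟩
    exact Subtype.range_val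
  · exact Finite.card_subtype_lt (x := t₁) fun h => h.1 rfl

/-! ### Diagrams that fix every terminal point reduce to the identity. -/

/-- The top label of the transistor is a single letter. -/
def IsExpanding (Δ : BraidedDiagram P w w') (t : Δ.Transistor) : Prop := (Δ.top t).length = 1

theorem IsExpanding.exists_label (hP : P.IsExpansion E) {Δ : BraidedDiagram P w w'}
    {t : Δ.Transistor} (h : Δ.IsExpanding t) : ∃ ℓ, E ℓ ≠ [] ∧ Δ.top t = [ℓ] ∧ Δ.bot t = E ℓ := by
  obtain ⟨ℓ, hl, h' | h'⟩ := Δ.label_cases hP t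
  · exact ⟨ℓ, hl, h'⟩
  · unfold IsExpanding at h
    rw [h'.1] at h
    exact (hP.length_ne_one ℓ h).elim

theorem exists_label_of_not_isExpanding (hP : P.IsExpansion E) {Δ : BraidedDiagram P w w'}
    {t : Δ.Transistor} (h : ¬ Δ.IsExpanding t) :
    ∃ ℓ, E ℓ ≠ [] ∧ Δ.top t = E ℓ ∧ Δ.bot t = [ℓ] := by
  obtain ⟨ℓ, hl, h' | h'⟩ := Δ.label_cases hP t
  · exact (h (congrArg List.length h'.1)).elim
  · exact ⟨ℓ, hl, h'⟩

/-- One wire joins a contraction to the expansion below it. Its letter determines both relations,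
because `E` is a function of the letter. -/
theorem isDipole_of_prec (hP : P.IsExpansion E) {Δ : BraidedDiagram P w w'} {t₁ t₂ : Δ.Transistor}
    (h : Δ.Prec t₁ t₂) (h₁ : Δ.IsExpanding t₁) (h₂ : ¬ Δ.IsExpanding t₂) : Δ.IsDipole t₁ t₂ := by
  obtain ⟨ℓ₁, -, ht₁, hb₁⟩ := h₁.exists_label hP
  obtain ⟨ℓ₂, -, ht₂, hb₂⟩ := exists_label_of_not_isExpanding hP h₂
  have hlen : (Δ.bot t₂).length = (Δ.top t₁).length := by rw [hb₂, ht₁]; rfl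
  have hlen' : (Δ.bot t₂).length = 1 := by rw [hb₂]; rfl
  have h' := h
  obtain ⟨i, j, hij⟩ := h'
  have hw := Δ.label_wire (.inr ⟨t₂, i⟩)
  rw [hij] at hw
  have hw : (Δ.top t₁).get j = (Δ.bot t₂).get i := hw
  simp only [ht₁, hb₂, List.get_eq_getElem, List.getElem_singleton] at hw
  subst hw
  refine ⟨h, hb₁.trans ht₂.symm, hlen, fun k => ?_⟩
  obtain rfl : k = i := Fin.ext (by omega)
  rw [hij]
  congr 2
  exact Fin.ext (by rw [Fin.val_cast]; omega)

/-- Under `hd` everything above an expansion is an expansion, so the contact has an address in the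
tree below the frame top: the positions passed on the way down. Non-terminal points are covered too,
since the prefix `p` keeps them from getting stuck. -/
theorem exists_top_address {Δ : BraidedDiagram P [r] w'}
    (hP : P.IsExpansion E)
    (hd : ∀ t₁ t₂, Δ.Prec t₁ t₂ → Δ.IsExpanding t₁ → Δ.IsExpanding t₂)
    (c : UpperContact [r] Δ.bot) : (∀ t m, c = .inr ⟨t, m⟩ → Δ.IsExpanding t) →
      ∃ p, ∀ s, Relation.ReflTransGen Δ.Next (.inl (frame r), p ++ s) (c, s) := by
  induction c using Δ.lower_induction with
  | top i => exact fun _ => ⟨[], fun s => by rw [eq_frame i]; exact .refl⟩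
  | H t m ih =>
    intro h
    have ht := h t m rfl
    obtain ⟨ℓ, -, -, hb⟩ := ht.exists_label hP
    obtain ⟨p, hp⟩ := ih ⟨0, ht ▸ Nat.one_pos⟩ fun t' m' h' =>
      hd _ _ ⟨_, _, (Δ.wire.symm_apply_eq.1 h').symm⟩ ht
    refine ⟨p ++ [m.1], fun s => ?_⟩
    have := hp (m :: s)
    rw [List.append_assoc]
    refine this.tail ⟨t, _, m, Equiv.apply_symm_apply _ _, rfl, ?_⟩
    have hb' : (Δ.bot t).length ≠ 1 := by rw [hb]; exact hP.length_ne_one ℓ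
    rw [addr_of_ne hb']
    exact if_pos ht

/-- The mirror image: below a contraction there are only contractions, each of which prepends one
index to the address. -/
theorem exists_bottom_address {Δ : BraidedDiagram P w [r]}
    (hP : P.IsExpansion E)
    (hd : ∀ t₁ t₂, Δ.Prec t₁ t₂ → Δ.IsExpanding t₁ → Δ.IsExpanding t₂)
    (c : UpperContact w Δ.bot) : (∀ t j, Δ.wire c = .inr ⟨t, j⟩ → ¬ Δ.IsExpanding t) →
      ∃ q, ∀ s, Relation.ReflTransGen Δ.Next (c, s) (Δ.wire.symm (.inl (frame r)), q ++ s) := by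
  induction c using Δ.upper_induction with
  | _ c ih =>
    intro h
    rcases hc : Δ.wire c with i | ⟨t, j⟩
    · rw [eq_frame i] at hc
      rw [← hc, Equiv.symm_apply_apply]
      exact ⟨[], fun s => .refl⟩
    · obtain ⟨ℓ, -, ht, hb⟩ := exists_label_of_not_isExpanding hP (h t j hc)
      obtain ⟨q, hq⟩ := ih t j ⟨0, by rw [hb]; exact Nat.one_pos⟩ hc fun t' j' h' h'' =>
        h t j hc (hd _ _ ⟨_, _, h'⟩ h'')
      refine ⟨q ++ [j.1], fun s => ?_⟩
      have := hq (j :: s)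
      rw [List.append_assoc]
      refine .head ⟨t, j, _, hc, rfl, ?_⟩ this
      have ht' : (Δ.top t).length ≠ 1 := by rw [ht]; exact hP.length_ne_one ℓ
      rw [addr_of_ne ht']
      exact (if_pos (by rw [hb]; rfl)).symm

/-- In the contracting part the length of the address strictly increases at every crossing, so two
points there with addresses of equal length reach each other only if they coincide. -/
theorem length_lt_of_reach {Δ : BraidedDiagram P w w'}
    (hP : P.IsExpansion E)
    (hd : ∀ t₁ t₂, Δ.Prec t₁ t₂ → Δ.IsExpanding t₁ → Δ.IsExpanding t₂) {x y}
    (h : Relation.ReflTransGen Δ.Next x y)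
    (hx : ∀ t j, Δ.wire x.1 = .inr ⟨t, j⟩ → ¬ Δ.IsExpanding t) :
    (x = y ∨ x.2.length < y.2.length) ∧ ∀ t j, Δ.wire y.1 = .inr ⟨t, j⟩ → ¬ Δ.IsExpanding t := by
  induction h with
  | refl => exact ⟨.inl rfl, hx⟩
  | @tail y z _ h ih =>
    obtain ⟨t, j, m, h1, h2, h3⟩ := h
    have ht := ih.2 t j h1
    obtain ⟨ℓ, -, -, hb⟩ := exists_label_of_not_isExpanding hP ht
    have h4 : addr (Δ.bot t) m z.2 = z.2 := if_pos (by rw [hb]; rfl)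
    rw [h4, addr_of_ne ht] at h3
    have hyz : y.2.length < z.2.length := by simp [← h3]
    refine ⟨.inr ?_, fun t' j' h' h'' => ht (hd _ _ ⟨m, j', h2 ▸ h'⟩ h'')⟩
    rcases ih.1 with rfl | h
    exacts [hyz, h.trans hyz]

theorem Run.isDipole_or_isEmpty (hP : P.IsExpansion E) (hE : ∀ ℓ, ∃ s, IsTerminalPath E ℓ s)
    {Δ : BraidedDiagram P [r] [r]} (hΔ : ∀ s, IsTerminalPath E r s → Δ.Run s s) :
    (∃ t₁ t₂, Δ.IsDipole t₁ t₂) ∨ IsEmpty Δ.Transistor := by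
  by_cases hd : ∀ t₁ t₂, Δ.Prec t₁ t₂ → Δ.IsExpanding t₁ → Δ.IsExpanding t₂
  swap
  · push Not at hd
    obtain ⟨t₁, t₂, h, h₁, h₂⟩ := hd
    exact .inl ⟨t₁, t₂, isDipole_of_prec hP h h₁ h₂⟩
  by_cases hex : ∃ t, Δ.IsExpanding t
  swap
  · push Not at hex
    refine .inr ⟨fun t₀ => ?_⟩
    -- Without expansions, a topmost transistor would receive at least two wires from the frame,
    -- whose top has a single contact.
    obtain ⟨t, -, ht⟩ := Δ.prec_swap_wellFounded.has_min Set.univ ⟨t₀, trivial⟩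
    have hlen : 1 < (Δ.top t).length := by
      obtain ⟨ℓ, hl, h, -⟩ := exists_label_of_not_isExpanding hP (hex t)
      have := hP.length_ne_one ℓ
      have := List.length_pos_iff.2 hl
      rw [h]
      omega
    have key : ∀ j, Δ.wire (.inl (frame r)) = .inr ⟨t, j⟩ := by
      intro j
      rcases h : Δ.wire.symm (.inr ⟨t, j⟩) with i | ⟨t', m⟩
      · rw [← eq_frame i, ← h, Equiv.apply_symm_apply]
      · exact (ht t' trivial ⟨m, j, (Δ.wire.symm_apply_eq.1 h).symm⟩).elim
    have := (key ⟨0, by omega⟩).symm.trans (key ⟨1, hlen⟩)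
    simp at this
  left
  -- A lowest expansion `t`, with address `p` from the top. The aim is one contraction with the same
  -- address from the bottom that receives all its wires in order.
  obtain ⟨t, ht, hmin⟩ := Δ.prec_wellFounded.has_min {t | Δ.IsExpanding t} hex
  obtain ⟨ℓ, hl, htop, hbot⟩ := ht.exists_label hP
  have hbot1 : (Δ.bot t).length ≠ 1 := by rw [hbot]; exact hP.length_ne_one ℓ
  obtain ⟨p, hp⟩ := exists_top_address hP hd (Δ.wire.symm (.inr ⟨t, ⟨0, ht ▸ Nat.one_pos⟩⟩))
    fun t' m' h' => hd _ _ ⟨_, _, (Δ.wire.symm_apply_eq.1 h').symm⟩ ht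
  have hp' : ∀ m s, Relation.ReflTransGen Δ.Next (.inl (frame r), p ++ m.1 :: s)
      (.inr ⟨t, m⟩, s) := fun m s =>
    (hp (m :: s)).tail ⟨t, _, m, Equiv.apply_symm_apply _ _, rfl,
      (if_pos ht).trans (addr_of_ne hbot1 _ _).symm⟩
  have hpr : subLetter E r p = some ℓ := by
    have h1 := reach_subLetter_eq hP (hp [])
    rw [List.append_nil, contactLabel_frame] at h1
    rw [h1, ← Δ.label_wire, Equiv.apply_symm_apply]
    change some ((Δ.top t).get _) = _
    simp [htop]
  have key : ∀ m : Fin (Δ.bot t).length, ∃ (t' : Δ.Transistor) (j : Fin (Δ.top t').length)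
      (k : Fin (Δ.bot t').length), Δ.wire (.inr ⟨t, m⟩) = .inr ⟨t', j⟩ ∧ j.1 = m.1 ∧
      ¬ Δ.IsExpanding t' ∧ ∀ z, Relation.ReflTransGen Δ.Next (.inr ⟨t', k⟩, z)
        (Δ.wire.symm (.inl (frame r)), p ++ z) := by
    intro m
    -- A terminal point below position `m` serves as test point; the diagram fixes it.
    obtain ⟨s, hs⟩ := hE (contactLabel [r] Δ.bot (.inr ⟨t, m⟩))
    have hval : IsTerminalPath E r (p ++ m.1 :: s) := by
      have h1 := reach_subLetter_eq hP (hp' m s)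
      unfold IsTerminalPath
      rw [contactLabel_frame] at h1
      rwa [h1]
    rcases h : Δ.wire (.inr ⟨t, m⟩) with i | ⟨t', j⟩
    · have h1 : Δ.Run (p ++ m.1 :: s) s := by
        have h1 := hp' m s
        rwa [Δ.wire.eq_symm_apply.2 h, eq_frame i] at h1
      -- A wire straight to the frame would shorten the fixed address.
      have := congrArg List.length (h1.right_unique (hΔ _ hval))
      simp at this
      omega
    · have ht' : ¬ Δ.IsExpanding t' := fun h' => hmin t' h' ⟨m, j, h⟩
      obtain ⟨ℓ', -, htop', hbot'⟩ := exists_label_of_not_isExpanding hP ht'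
      have hk : 0 < (Δ.bot t').length := by rw [hbot']; exact Nat.one_pos
      obtain ⟨q, hq⟩ := exists_bottom_address hP hd (.inr ⟨t', ⟨0, hk⟩⟩) fun t'' j' h' h'' =>
        ht' (hd _ _ ⟨_, _, h'⟩ h'')
      have h1 : Δ.Run (p ++ m.1 :: s) (q ++ j.1 :: s) := by
        refine ((hp' m s).tail ⟨t', j, ⟨0, hk⟩, h, rfl, ?_⟩).trans (hq (j.1 :: s))
        exact (addr_of_ne ht' _ _).trans (if_pos (by rw [hbot']; rfl)).symm
      have h2 := h1.right_unique (hΔ _ hval)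
      -- The test point is fixed, so the bottom address of `t'` is `p` and the position is kept.
      have h3 : (q ++ [j.1]) ++ s = (p ++ [m.1]) ++ s := by simpa using h2
      have h3 := List.append_cancel_right h3
      obtain ⟨rfl, h4⟩ := List.append_inj' h3 rfl
      exact ⟨t', j, _, rfl, by simpa using h4, ht', hq⟩
  have hlen : 0 < (Δ.bot t).length := by rw [hbot]; exact List.length_pos_iff.2 hl
  obtain ⟨t', j, k, hw, -, ht', hq⟩ := key ⟨0, hlen⟩
  obtain ⟨ℓ', -, htop', hbot'⟩ := exists_label_of_not_isExpanding hP ht'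
  obtain rfl : ℓ = ℓ' := by
    have h1 := reach_subLetter_eq hP (hq [])
    rw [List.append_nil, ← Δ.label_wire (Δ.wire.symm _), Equiv.apply_symm_apply,
      contactLabel_frame, hpr] at h1
    have h2 : some ((Δ.bot t').get k) = some ℓ := h1
    simpa [hbot'] using h2.symm
  have huniq : ∀ t₁ t₂ : Δ.Transistor, ∀ k₁ k₂, ¬ Δ.IsExpanding t₁ →
      Relation.ReflTransGen Δ.Next (.inr ⟨t₁, k₁⟩, []) (.inr ⟨t₂, k₂⟩, []) → t₁ = t₂ := by
    intro t₁ t₂ k₁ k₂ h₁ h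
    rcases (length_lt_of_reach hP hd h fun t'' j' h' h'' => h₁ (hd _ _ ⟨_, _, h'⟩ h'')).1 with h | h
    · simp only [Prod.mk.injEq, Sum.inr.injEq, and_true] at h
      exact congrArg Sigma.fst h
    · simp at h
  refine ⟨t', t, ⟨_, _, hw⟩, hbot'.trans htop.symm, by rw [hbot, htop'], fun m => ?_⟩
  obtain ⟨t₁, j₁, k₁, hw₁, hj₁, ht₁, hq₁⟩ := key m
  -- Both contractions send the empty address to `p` at the bottom. Following the flow backwards,
  -- one lies on the path of the other, and equal address lengths force them to coincide.
  obtain rfl : t₁ = t' := by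
    rcases Relation.ReflTransGen.total_of_right_unique (r := Function.swap Δ.Next)
      (fun _ _ _ h h' => Next.left_unique h h') (Relation.reflTransGen_swap.2 (hq []))
      (Relation.reflTransGen_swap.2 (hq₁ [])) with h | h <;> rw [Relation.reflTransGen_swap] at h
    · exact huniq _ _ _ _ ht₁ h
    · exact (huniq _ _ _ _ ht' h).symm
  rw [hw₁]
  congr 2
  exact Fin.ext hj₁

theorem equivalent_id_of_isEmpty {Δ : BraidedDiagram P [r] [r]} (h : IsEmpty Δ.Transistor) :
    Δ.Equivalent (identity P [r]) := by
  refine ⟨(Equiv.equivEmpty _), fun t => h.elim t, fun t => h.elim t, ?_⟩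
  rintro (i | ⟨t, _⟩)
  · rcases h' : Δ.wire (.inl i) with j | ⟨t, _⟩
    · exact congrArg Sum.inl ((eq_frame i).trans (eq_frame j).symm)
    · exact (h.false t).elim
  · exact (h.false t).elim

/-- A diagram that moves no point can be reduced to the trivial diagram. -/
theorem eqvGen_id_of_run (hP : P.IsExpansion E) (hE : ∀ ℓ, ∃ s, IsTerminalPath E ℓ s)
    (Δ : BraidedDiagram P [r] [r]) (hΔ : ∀ s, IsTerminalPath E r s → Δ.Run s s) :
    Quot.mk Step Δ = Quot.mk Step (identity P [r]) := by
  induction h : Nat.card Δ.Transistor using Nat.strong_induction_on generalizing Δ with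
  | _ N ih =>
    rcases Run.isDipole_or_isEmpty hP hE hΔ with ⟨t₁, t₂, d⟩ | h'
    · obtain ⟨Δ', hred, hcard⟩ := d.exists_reducesTo
      refine (Quot.sound (.inr hred)).trans (ih _ (h ▸ hcard) Δ' (fun s hs => ?_) rfl)
      obtain ⟨s', hs'⟩ := Δ'.exists_run hP hs
      -- The reduced diagram still fixes `s`: its run is also a run of `Δ`.
      obtain rfl := (hs'.of_reducesTo hP hred hs).right_unique (hΔ s hs)
      exact hs'
    · exact Quot.sound (.inl (equivalent_id_of_isEmpty h'))

end BraidedDiagram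

/-! ## Diagrams from pairs of finite trees -/

/-- The letter at a vertex of the expansion tree below `r`. -/
def letterAt {A : Type} (E : A → List A) (r : A) (p : List ℕ) : A := (subLetter E r p).getD r

/-- `F` is the set of interior vertices of a finite subtree of the expansion tree below `r`. -/
structure IsExpansionTree {A : Type} (E : A → List A) (r : A) (F : Set (List ℕ)) : Prop where
  finite : F.Finite
  ne_nil : ∀ p ∈ F, E (letterAt E r p) ≠ []
  closed : ∀ p m, p ++ [m] ∈ F → p ∈ F ∧ m < (E (letterAt E r p)).length

/-- The vertices of the subtree with interior vertices `F`. -/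
def treeNodes {A : Type} (E : A → List A) (r : A) (F : Set (List ℕ)) : Set (List ℕ) :=
  {x | x = [] ∨ ∃ p ∈ F, ∃ m, m < (E (letterAt E r p)).length ∧ x = p ++ [m]}

namespace IsExpansionTree

variable {A : Type} {E : A → List A} {r : A} {F : Set (List ℕ)}

theorem mem_treeNodes (hF : IsExpansionTree E r F) {p : List ℕ} (hp : p ∈ F) :
    p ∈ treeNodes E r F := by
  rcases List.eq_nil_or_concat' p with rfl | ⟨q, m, rfl⟩
  · exact .inl rfl
  · exact .inr ⟨q, (hF.closed q m hp).1, m, (hF.closed q m hp).2, rfl⟩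

/-- On vertices of the subtree, the default letter `r` in `letterAt` never comes into play. -/
theorem subLetter_eq (hF : IsExpansionTree E r F) {p : List ℕ} (hp : p ∈ treeNodes E r F) :
    subLetter E r p = some (letterAt E r p) := by
  induction p using List.reverseRecOn with
  | nil => rfl
  | append_singleton q m ih =>
    rcases hp with h | ⟨q', hq, m', hm, h⟩
    · simp at h
    · obtain ⟨rfl, h⟩ := List.append_inj' h rfl
      obtain rfl : m = m' := by simpa using h
      have h := ih (hF.mem_treeNodes hq)
      have : subLetter E r (q ++ [m]) = some ((E (letterAt E r q))[m]) := by
        rw [subLetter_append, h]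
        simp [subLetter, hm]
      simp only [this, letterAt, Option.getD_some]

theorem letterAt_append (hF : IsExpansionTree E r F) {p : List ℕ} (hp : p ∈ F)
    (m : Fin (E (letterAt E r p)).length) :
    letterAt E r (p ++ [m.1]) = (E (letterAt E r p)).get m := by
  rw [letterAt, subLetter_append, hF.subLetter_eq (hF.mem_treeNodes hp)]
  simp [subLetter]

end IsExpansionTree

namespace BraidedDiagram

variable {A : Type} {P : SemigroupPresentation A} {E : A → List A} {r : A}
  {F₁ F₂ : Set (List ℕ)}

/-- The top labels of the diagram given by the trees `F₁` (expanding) and `F₂` (contracting). -/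
def treeTop (E : A → List A) (r : A) (F₁ F₂ : Set (List ℕ)) : F₁ ⊕ F₂ → List A :=
  Sum.elim (fun p => [letterAt E r p]) fun q => E (letterAt E r q)

/-- The bottom labels of the diagram given by the trees `F₁` (expanding) and `F₂` (contracting). -/
def treeBot (E : A → List A) (r : A) (F₁ F₂ : Set (List ℕ)) : F₁ ⊕ F₂ → List A :=
  Sum.elim (fun p => E (letterAt E r p)) fun q => [letterAt E r q]

/-- The tree (first or second) and the vertex at an upper contact. -/
def upperVertex : UpperContact [r] (treeBot E r F₁ F₂) → List ℕ ⊕ List ℕ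
  | .inl _ => .inl []
  | .inr ⟨.inl p, m⟩ => .inl (p.1 ++ [m.1])
  | .inr ⟨.inr q, _⟩ => .inr q.1

/-- The tree (first or second) and the vertex at a lower contact. -/
def lowerVertex : LowerContact [r] (treeTop E r F₁ F₂) → List ℕ ⊕ List ℕ
  | .inl _ => .inr []
  | .inr ⟨.inl p, _⟩ => .inl p.1
  | .inr ⟨.inr q, j⟩ => .inr (q.1 ++ [j.1])

/-- Contacts are coordinatized by tree vertices, which reduces the wiring to a bijection between
sets of vertices. -/
theorem upperVertex_injective :
    Function.Injective (upperVertex (E := E) (r := r) (F₁ := F₁) (F₂ := F₂)) := by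
  rintro (i | ⟨p | p, i⟩) (j | ⟨q | q, j⟩) h <;> simp only [upperVertex] at h
  · rw [eq_frame i, eq_frame j]
  · simp at h
  · cases h
  · simp at h
  · obtain ⟨h1, h2⟩ := List.append_inj' (Sum.inl.inj h) rfl
    obtain rfl := Subtype.ext h1
    obtain rfl := Fin.ext (List.cons.inj h2).1
    rfl
  · cases h
  · cases h
  · cases h
  · obtain rfl := Subtype.ext (Sum.inr.inj h)
    obtain rfl : i = j := Subsingleton.elim (α := Fin 1) i j
    rfl

theorem lowerVertex_injective :
    Function.Injective (lowerVertex (E := E) (r := r) (F₁ := F₁) (F₂ := F₂)) := by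
  rintro (i | ⟨p | p, i⟩) (j | ⟨q | q, j⟩) h <;> simp only [lowerVertex] at h
  · rw [eq_frame i, eq_frame j]
  · cases h
  · simp at h
  · cases h
  · obtain rfl := Subtype.ext (Sum.inl.inj h)
    obtain rfl : i = j := Subsingleton.elim (α := Fin 1) i j
    rfl
  · cases h
  · simp at h
  · cases h
  · obtain ⟨h1, h2⟩ := List.append_inj' (Sum.inr.inj h) rfl
    obtain rfl := Subtype.ext h1
    obtain rfl := Fin.ext (List.cons.inj h2).1
    rfl

theorem range_upperVertex : Set.range (upperVertex (E := E) (r := r) (F₁ := F₁) (F₂ := F₂)) =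
    Sum.inl '' treeNodes E r F₁ ∪ Sum.inr '' F₂ := by
  ext z
  constructor
  · rintro ⟨i | ⟨p | p, i⟩, rfl⟩
    · exact .inl ⟨[], .inl rfl, rfl⟩
    · exact .inl ⟨_, .inr ⟨p.1, p.2, i.1, i.2, rfl⟩, rfl⟩
    · exact .inr ⟨p.1, p.2, rfl⟩
  · rintro (⟨_, rfl | ⟨p, hp, m, hm, rfl⟩, rfl⟩ | ⟨q, hq, rfl⟩)
    · exact ⟨.inl (frame r), rfl⟩
    · exact ⟨.inr ⟨.inl ⟨p, hp⟩, ⟨m, hm⟩⟩, rfl⟩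
    · exact ⟨.inr ⟨.inr ⟨q, hq⟩, ⟨0, Nat.one_pos⟩⟩, rfl⟩

theorem range_lowerVertex : Set.range (lowerVertex (E := E) (r := r) (F₁ := F₁) (F₂ := F₂)) =
    Sum.inl '' F₁ ∪ Sum.inr '' treeNodes E r F₂ := by
  ext z
  constructor
  · rintro ⟨i | ⟨p | p, i⟩, rfl⟩
    · exact .inr ⟨[], .inl rfl, rfl⟩
    · exact .inl ⟨p.1, p.2, rfl⟩
    · exact .inr ⟨_, .inr ⟨p.1, p.2, i.1, i.2, rfl⟩, rfl⟩
  · rintro (⟨q, hq, rfl⟩ | ⟨_, rfl | ⟨p, hp, m, hm, rfl⟩, rfl⟩)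
    · exact ⟨.inr ⟨.inl ⟨q, hq⟩, ⟨0, Nat.one_pos⟩⟩, rfl⟩
    · exact ⟨.inl (frame r), rfl⟩
    · exact ⟨.inr ⟨.inr ⟨p, hp⟩, ⟨m, hm⟩⟩, rfl⟩

theorem contactLabel_upperVertex (h₁ : IsExpansionTree E r F₁) (c) :
    contactLabel [r] (treeBot E r F₁ F₂) c =
      (upperVertex c).elim (letterAt E r) (letterAt E r) := by
  rcases c with i | ⟨p | p, i⟩
  · rw [eq_frame i]
    rfl
  · exact (h₁.letterAt_append p.2 i).symm
  · obtain rfl : i = ⟨0, Nat.one_pos⟩ := Subsingleton.elim (α := Fin 1) _ _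
    rfl

theorem contactLabel_lowerVertex (h₂ : IsExpansionTree E r F₂) (c) :
    contactLabel [r] (treeTop E r F₁ F₂) c =
      (lowerVertex c).elim (letterAt E r) (letterAt E r) := by
  rcases c with i | ⟨p | p, i⟩
  · rw [eq_frame i]
    rfl
  · obtain rfl : i = ⟨0, Nat.one_pos⟩ := Subsingleton.elim (α := Fin 1) _ _
    rfl
  · exact (h₂.letterAt_append p.2 i).symm

open Classical in
/-- The vertex at the lower end of the wire that starts at a given vertex, if the leaves of the
trees are matched by `π`. -/
noncomputable def crossVertex (F₁ : Set (List ℕ)) (π : List ℕ → List ℕ) :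
    List ℕ ⊕ List ℕ → List ℕ ⊕ List ℕ
  | .inl x => if x ∈ F₁ then .inl x else .inr (π x)
  | .inr q => .inr q

/-- In the second tree the leaves are hit through `π` and the interior vertices by the wires leaving
contractions; these two kinds of targets are disjoint and exhaust the tree. -/
theorem bijOn_crossVertex {N₁ N₂ : Set (List ℕ)} (h₁ : F₁ ⊆ N₁) (h₂ : F₂ ⊆ N₂)
    {π : List ℕ → List ℕ} (hπ : Set.BijOn π (N₁ \ F₁) (N₂ \ F₂)) :
    Set.BijOn (crossVertex F₁ π) (Sum.inl '' N₁ ∪ Sum.inr '' F₂)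
      (Sum.inl '' F₁ ∪ Sum.inr '' N₂) := by
  have hin : ∀ x ∈ F₁, crossVertex F₁ π (.inl x) = .inl x := fun x hx => if_pos hx
  have hout : ∀ x, x ∉ F₁ → crossVertex F₁ π (.inl x) = .inr (π x) := fun x hx => if_neg hx
  have hinr : ∀ x, crossVertex F₁ π (.inr x) = .inr x := fun x => rfl
  refine ⟨?_, ?_, ?_⟩
  · rintro _ (⟨x, hx, rfl⟩ | ⟨x, hx, rfl⟩)
    · by_cases h : x ∈ F₁
      · exact .inl ⟨x, h, (hin x h).symm⟩
      · exact .inr ⟨π x, (hπ.mapsTo ⟨hx, h⟩).1, (hout x h).symm⟩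
    · exact .inr ⟨x, h₂ hx, rfl⟩
  · rintro _ (⟨x, hx, rfl⟩ | ⟨x, hx, rfl⟩) _ (⟨y, hy, rfl⟩ | ⟨y, hy, rfl⟩) h
    · by_cases h1 : x ∈ F₁ <;> by_cases h2 : y ∈ F₁
      · rwa [hin x h1, hin y h2] at h
      · rw [hin x h1, hout y h2] at h
        cases h
      · rw [hout x h1, hin y h2] at h
        cases h
      · rw [hout x h1, hout y h2] at h
        rw [hπ.injOn ⟨hx, h1⟩ ⟨hy, h2⟩ (Sum.inr.inj h)]
    · by_cases h1 : x ∈ F₁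
      · rw [hin x h1] at h
        cases h
      · rw [hout x h1, hinr] at h
        exact ((hπ.mapsTo ⟨hx, h1⟩).2 (Sum.inr.inj h ▸ hy)).elim
    · by_cases h1 : y ∈ F₁
      · rw [hin y h1] at h
        cases h
      · rw [hout y h1, hinr] at h
        exact ((hπ.mapsTo ⟨hy, h1⟩).2 (Sum.inr.inj h ▸ hx)).elim
    · exact h
  · rintro _ (⟨x, hx, rfl⟩ | ⟨x, hx, rfl⟩)
    · exact ⟨.inl x, .inl ⟨x, h₁ hx, rfl⟩, hin x hx⟩
    · by_cases h : x ∈ F₂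
      · exact ⟨.inr x, .inr ⟨x, h, rfl⟩, rfl⟩
      · obtain ⟨y, hy, rfl⟩ := hπ.surjOn ⟨hx, h⟩
        exact ⟨.inl y, .inl ⟨y, hy.1, rfl⟩, hout y hy.2⟩

theorem exists_treeWire (h₁ : IsExpansionTree E r F₁) (h₂ : IsExpansionTree E r F₂)
    {π : List ℕ → List ℕ}
    (hπ : Set.BijOn π (treeNodes E r F₁ \ F₁) (treeNodes E r F₂ \ F₂)) :
    ∃ e : UpperContact [r] (treeBot E r F₁ F₂) ≃ LowerContact [r] (treeTop E r F₁ F₂),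
      ∀ c, lowerVertex (e c) = crossVertex F₁ π (upperVertex c) := by
  have hb := bijOn_crossVertex (fun _ => h₁.mem_treeNodes) (fun _ => h₂.mem_treeNodes) hπ
  rw [← range_upperVertex, ← range_lowerVertex] at hb
  refine exists_equiv_of_rel (fun c d => lowerVertex d = crossVertex F₁ π (upperVertex c))
    (fun c => hb.mapsTo ⟨c, rfl⟩) (fun d => ?_)
    (fun c d d' h h' => lowerVertex_injective (h.trans h'.symm))
    (fun c c' d h h' => upperVertex_injective (hb.injOn ⟨c, rfl⟩ ⟨c', rfl⟩ (h.symm.trans h')))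
  obtain ⟨_, ⟨c, rfl⟩, hc⟩ := hb.surjOn ⟨d, rfl⟩
  exact ⟨c, hc.symm⟩

/-- A rank that decreases along the wires. -/
def treeRank : F₁ ⊕ F₂ → ℕ ×ₗ ℤ :=
  Sum.elim (fun p => toLex (1, -(p.1.length : ℤ))) fun q => toLex (0, (q.1.length : ℤ))

/-- All expansions rank above all contractions; going down, one moves away from the root in the
first tree and towards the root in the second. Hence there are no cycles. -/
theorem treeRank_lt {π : List ℕ → List ℕ}
    {e : UpperContact [r] (treeBot E r F₁ F₂) ≃ LowerContact [r] (treeTop E r F₁ F₂)}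
    (he : ∀ c, lowerVertex (e c) = crossVertex F₁ π (upperVertex c)) {t₁ t₂ : F₁ ⊕ F₂}
    (h : ∃ i j, e (.inr ⟨t₂, i⟩) = .inr ⟨t₁, j⟩) : treeRank t₁ < treeRank t₂ := by
  obtain ⟨i, j, h⟩ := h
  have h' := he (.inr ⟨t₂, i⟩)
  rw [h] at h'
  rcases t₁ with p | p <;> rcases t₂ with q | q <;>
    simp only [lowerVertex, upperVertex, crossVertex] at h'
  · split at h'
    · have := congrArg List.length (Sum.inl.inj h')
      simp only [List.length_append, List.length_singleton] at this
      exact Prod.Lex.toLex_lt_toLex.2 (.inr ⟨rfl, by simp only [this]; push_cast; omega⟩)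
    · cases h'
  · cases h'
  · exact Prod.Lex.toLex_lt_toLex.2 (.inl Nat.one_pos)
  · have := congrArg List.length (Sum.inr.inj h')
    simp only [List.length_append, List.length_singleton] at this
    exact Prod.Lex.toLex_lt_toLex.2 (.inr ⟨rfl, by simp only [← this]; push_cast; omega⟩)

theorem exists_treeDiagram (hP : P.IsExpansion E) (h₁ : IsExpansionTree E r F₁)
    (h₂ : IsExpansionTree E r F₂) {π : List ℕ → List ℕ}
    (hπ : Set.BijOn π (treeNodes E r F₁ \ F₁) (treeNodes E r F₂ \ F₂))
    (hlab : ∀ x ∈ treeNodes E r F₁ \ F₁, letterAt E r (π x) = letterAt E r x) :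
    ∃ Δ : BraidedDiagram P [r] [r],
      ∀ x ∈ treeNodes E r F₁ \ F₁, ∀ s, Δ.Run (x ++ s) (π x ++ s) := by
  obtain ⟨e, he⟩ := exists_treeWire h₁ h₂ hπ
  have := h₁.finite.to_subtype
  have := h₂.finite.to_subtype
  have hrank : ∀ t₁ t₂ : F₁ ⊕ F₂, Relation.TransGen
      (fun t₁ t₂ => ∃ i j, e (.inr ⟨t₂, i⟩) = .inr ⟨t₁, j⟩) t₁ t₂ →
      treeRank t₁ < treeRank t₂ := by
    intro t₁ t₂ h
    induction h with
    | single h => exact treeRank_lt he h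
    | tail _ h ih => exact ih.trans (treeRank_lt he h)
  let Δ : BraidedDiagram P [r] [r] :=
    { Transistor := F₁ ⊕ F₂
      finite := inferInstance
      top := treeTop E r F₁ F₂
      bot := treeBot E r F₁ F₂
      rel := by
        rintro (p | q)
        · exact .inl (hP.mem _ (h₁.ne_nil p.1 p.2))
        · exact .inr (hP.mem _ (h₂.ne_nil q.1 q.2))
      wire := e
      label_wire := by
        intro c
        rw [contactLabel_lowerVertex h₂, contactLabel_upperVertex h₁, he]
        have hc : upperVertex c ∈ Set.range upperVertex := ⟨c, rfl⟩
        rw [range_upperVertex] at hc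
        rcases hc with ⟨x, hx, hc⟩ | ⟨x, hx, hc⟩ <;> rw [← hc]
        · simp only [crossVertex]
          split
          · rfl
          · next h => exact hlab x ⟨hx, h⟩
        · rfl
      strictOrder :=
        { irrefl := fun _ h => lt_irrefl _ (hrank _ _ h)
          trans := fun _ _ _ h h' => h.trans h' } }
  -- The expanding half strips the prefix `x` from the address.
  have down : ∀ x ∈ treeNodes E r F₁, ∃ c, upperVertex c = .inl x ∧
      ∀ s, Relation.ReflTransGen Δ.Next (.inl (frame r), x ++ s) (c, s) := by
    intro x
    induction x using List.reverseRecOn with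
    | nil => exact fun _ => ⟨.inl (frame r), rfl, fun s => .refl⟩
    | append_singleton q m ih =>
      rintro (h | ⟨p, hp, m', hm, h⟩)
      · simp at h
      · obtain ⟨rfl, h⟩ := List.append_inj' h rfl
        obtain rfl : m = m' := by simpa using h
        obtain ⟨c, hc, hs⟩ := ih (h₁.mem_treeNodes hp)
        refine ⟨.inr ⟨.inl ⟨q, hp⟩, ⟨m, hm⟩⟩, rfl, fun s => ?_⟩
        rw [List.append_assoc]
        refine (hs _).tail ⟨.inl ⟨q, hp⟩, ⟨0, Nat.one_pos⟩, ⟨m, hm⟩, ?_, rfl,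
          (addr_of_ne (hP.length_ne_one _) _ _).symm⟩
        refine lowerVertex_injective ((he c).trans ?_)
        rw [hc]
        exact if_pos hp
  -- The contracting half restores the prefix `y`, its last index first.
  have up : ∀ y (d : LowerContact [r] (treeTop E r F₁ F₂)), lowerVertex d = .inr y →
      ∀ s, Relation.ReflTransGen Δ.Next (e.symm d, s) (e.symm (.inl (frame r)), y ++ s) := by
    intro y
    induction y using List.reverseRecOn with
    | nil =>
      intro d hd s
      obtain rfl : d = .inl (frame r) := lowerVertex_injective hd
      exact .refl
    | append_singleton q m ih =>
      intro d hd s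
      have hd' : lowerVertex d ∈ Set.range lowerVertex := ⟨d, rfl⟩
      rw [range_lowerVertex, hd] at hd'
      obtain ⟨_, -, h⟩ | ⟨_, h | ⟨p, hp, m', hm, h⟩, h'⟩ := hd'
      · cases h
      · rw [h] at h'
        simp at h'
      · rw [h] at h'
        obtain ⟨rfl, h⟩ := List.append_inj' (Sum.inr.inj h') rfl
        obtain rfl : m' = m := by simpa using h
        obtain rfl : d = .inr ⟨.inr ⟨p, hp⟩, ⟨m', hm⟩⟩ := lowerVertex_injective hd
        have h3 := ih (e (.inr ⟨.inr ⟨p, hp⟩, ⟨0, Nat.one_pos⟩⟩)) (he _) (m' :: s)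
        rw [Equiv.symm_apply_apply] at h3
        rw [List.append_assoc]
        have hn : Δ.Next (e.symm (.inr ⟨.inr ⟨p, hp⟩, ⟨m', hm⟩⟩), s)
            (.inr ⟨.inr ⟨p, hp⟩, ⟨0, Nat.one_pos⟩⟩, m' :: s) :=
          ⟨.inr ⟨p, hp⟩, ⟨m', hm⟩, ⟨0, Nat.one_pos⟩, e.apply_symm_apply _, rfl,
            addr_of_ne (hP.length_ne_one _) _ _⟩
        exact .head hn h3
  refine ⟨Δ, fun x hx s => ?_⟩
  obtain ⟨c, hc, hs⟩ := down x hx.1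
  have h3 := up (π x) (e c) (by rw [he, hc]; exact if_neg hx.2) s
  rw [Equiv.symm_apply_apply] at h3
  exact (hs s).trans h3

end BraidedDiagram

/-! ## Expansion trees that consist of rays -/

/-- The expansion tree below `r` consists of `n` rays: the `i`-th ray starts at the vertex `ρ i`,
its vertices have the letter `X i`, and at each of them a leaf with the letter `a` branches off. -/
structure IsRayTree {A : Type} (E : A → List A) (r a : A) {n : ℕ} (X : Fin n → A)
    (ρ : Fin n → List ℕ) : Prop where
  pos : 0 < n
  terminal : E a = []
  ray : ∀ i, E (X i) = [a, X i]
  injective : Function.Injective X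
  root : (∀ i, X i = r ∧ ρ i = []) ∨ (E r = List.ofFn X ∧ ∀ i, X i ≠ r ∧ ρ i = [i.1])
  letters : ∀ ℓ, ℓ = a ∨ ℓ = r ∨ ∃ i, ℓ = X i

/-- The `k`-th vertex of the `i`-th ray. -/
def rayPath {n : ℕ} (ρ : Fin n → List ℕ) (i : Fin n) (k : ℕ) : List ℕ := ρ i ++ List.replicate k 1

/-- The leaf that branches off at the `k`-th vertex of the `i`-th ray. -/
def rayLeaf {n : ℕ} (ρ : Fin n → List ℕ) (p : Fin n × ℕ) : List ℕ := rayPath ρ p.1 p.2 ++ [0]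

theorem rayPath_add {n : ℕ} (ρ : Fin n → List ℕ) (i : Fin n) (k l : ℕ) :
    rayPath ρ i (k + l) = rayPath ρ i k ++ List.replicate l 1 := by
  rw [rayPath, List.replicate_add, rayPath, List.append_assoc]

theorem rayPath_zero {n : ℕ} (ρ : Fin n → List ℕ) (i : Fin n) : rayPath ρ i 0 = ρ i :=
  List.append_nil _

theorem rayLeaf_add {n : ℕ} (ρ : Fin n → List ℕ) (i : Fin n) (k l : ℕ) :
    rayLeaf ρ (i, k + l) = rayPath ρ i k ++ (List.replicate l 1 ++ [0]) := by
  rw [rayLeaf, rayPath_add, List.append_assoc]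

namespace IsRayTree

variable {A : Type} {P : SemigroupPresentation A} {E : A → List A} {r a : A} {n : ℕ}
  {X : Fin n → A} {ρ : Fin n → List ℕ}

theorem ne_terminal (h : IsRayTree E r a X ρ) (i : Fin n) : X i ≠ a := by
  intro h'
  have := h.ray i
  rw [h', h.terminal] at this
  cases this

theorem subLetter_root (h : IsRayTree E r a X ρ) (i : Fin n) :
    subLetter E r (ρ i) = some (X i) := by
  rcases h.root with h' | ⟨h', h''⟩
  · rw [(h' i).2, (h' i).1]
    rfl
  · rw [(h'' i).2]
    simp [subLetter, h']

theorem subLetter_replicate (h : IsRayTree E r a X ρ) (i : Fin n) (k : ℕ) :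
    subLetter E (X i) (List.replicate k 1) = some (X i) := by
  induction k with
  | zero => rfl
  | succ k ih => simpa [List.replicate_succ, subLetter, h.ray i] using ih

theorem subLetter_rayPath (h : IsRayTree E r a X ρ) (i : Fin n) (k : ℕ) :
    subLetter E r (rayPath ρ i k) = some (X i) := by
  rw [rayPath, subLetter_append, h.subLetter_root]
  exact h.subLetter_replicate i k

theorem subLetter_rayLeaf (h : IsRayTree E r a X ρ) (p : Fin n × ℕ) :
    subLetter E r (rayLeaf ρ p) = some a := by
  rw [rayLeaf, subLetter_append, h.subLetter_rayPath]
  simp [subLetter, h.ray]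

theorem rayPath_inj (h : IsRayTree E r a X ρ) {i j : Fin n} {k l : ℕ}
    (h' : rayPath ρ i k = rayPath ρ j l) : i = j ∧ k = l := by
  obtain rfl : i = j := by
    have := h.subLetter_rayPath i k
    rw [h', h.subLetter_rayPath] at this
    exact (h.injective (Option.some.inj this)).symm
  have := congrArg List.length h'
  simp only [rayPath, List.length_append, List.length_replicate] at this
  exact ⟨rfl, by omega⟩

theorem rayLeaf_injective (h : IsRayTree E r a X ρ) : Function.Injective (rayLeaf ρ) := by
  intro p q h'
  obtain ⟨h1, h2⟩ := h.rayPath_inj (List.append_cancel_right h')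
  exact Prod.ext h1 h2

theorem rayLeaf_ne_rayPath (h : IsRayTree E r a X ρ) (p : Fin n × ℕ) (i : Fin n) (k : ℕ) :
    rayLeaf ρ p ≠ rayPath ρ i k := by
  intro h'
  have := h.subLetter_rayLeaf p
  rw [h', h.subLetter_rayPath] at this
  exact h.ne_terminal i (Option.some.inj this)

theorem eq_of_subLetter (h : IsRayTree E r a X ρ) (i : Fin n) {s : List ℕ} {b : A}
    (hs : subLetter E (X i) s = some b) :
    (∃ k, s = List.replicate k 1 ∧ b = X i) ∨ ∃ k, s = List.replicate k 1 ++ [0] ∧ b = a := by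
  induction s with
  | nil => exact .inl ⟨0, rfl, (Option.some.inj hs).symm⟩
  | cons m s ih =>
    rcases m with _ | _ | m
    · rcases s with _ | ⟨m, s⟩
      · exact .inr ⟨0, rfl, by simpa [subLetter, h.ray i] using hs.symm⟩
      · simp [subLetter, h.ray i, h.terminal] at hs
    · have hs' : subLetter E (X i) s = some b := by simpa [subLetter, h.ray i] using hs
      rcases ih hs' with ⟨k, rfl, hb⟩ | ⟨k, rfl, hb⟩
      · exact .inl ⟨k + 1, rfl, hb⟩
      · exact .inr ⟨k + 1, rfl, hb⟩
    · simp [subLetter, h.ray i] at hs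

theorem eq_of_subLetter_root (h : IsRayTree E r a X ρ) {s : List ℕ} {b : A}
    (hs : subLetter E r s = some b) :
    (s = [] ∧ b = r ∧ ∀ i, X i ≠ r) ∨ (∃ i k, s = rayPath ρ i k ∧ b = X i) ∨
      ∃ p, s = rayLeaf ρ p ∧ b = a := by
  have key : ∀ i z, s = ρ i ++ z → (∃ i k, s = rayPath ρ i k ∧ b = X i) ∨
      ∃ p, s = rayLeaf ρ p ∧ b = a := by
    rintro i z rfl
    rw [subLetter_append, h.subLetter_root] at hs
    rcases h.eq_of_subLetter i hs with ⟨k, rfl, hb⟩ | ⟨k, rfl, hb⟩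
    · exact .inl ⟨i, k, rfl, hb⟩
    · exact .inr ⟨(i, k), (List.append_assoc _ _ _).symm, hb⟩
  rcases h.root with h' | ⟨h', h''⟩
  · exact .inr (key ⟨0, h.pos⟩ s (by rw [(h' _).2]; rfl))
  · rcases s with _ | ⟨m, s⟩
    · exact .inl ⟨rfl, (Option.some.inj hs).symm, fun i => (h'' i).1⟩
    · have hm : m < n := by
        by_contra hm
        simp [subLetter, h', hm] at hs
      exact .inr (key ⟨m, hm⟩ s (by rw [(h'' _).2]; rfl))

theorem root_ne_nil (h : IsRayTree E r a X ρ) : E r ≠ [] := by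
  rcases h.root with h' | ⟨h', -⟩
  · rw [← (h' ⟨0, h.pos⟩).1, h.ray]
    simp
  · rw [h']
    simpa using h.pos.ne'

theorem isTerminalPath_iff (h : IsRayTree E r a X ρ) {s : List ℕ} :
    IsTerminalPath E r s ↔ ∃ p, s = rayLeaf ρ p := by
  constructor
  · rintro ⟨b, hb, hb'⟩
    rcases h.eq_of_subLetter_root hb with ⟨-, rfl, -⟩ | ⟨i, k, -, rfl⟩ | ⟨p, hp, -⟩
    · exact (h.root_ne_nil hb').elim
    · simp [h.ray] at hb'
    · exact ⟨p, hp⟩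
  · rintro ⟨p, rfl⟩
    exact ⟨a, h.subLetter_rayLeaf p, h.terminal⟩

theorem exists_isTerminalPath (h : IsRayTree E r a X ρ) (ℓ : A) : ∃ s, IsTerminalPath E ℓ s := by
  rcases h.letters ℓ with rfl | rfl | ⟨i, rfl⟩
  · exact ⟨[], ℓ, rfl, h.terminal⟩
  · exact ⟨_, h.isTerminalPath_iff.2 ⟨(⟨0, h.pos⟩, 0), rfl⟩⟩
  · exact ⟨[0], a, by simp [subLetter, h.ray], h.terminal⟩

/-! ### The permutation induced by a diagram -/

open BraidedDiagram

/-- A ray vertex may get stuck at an expansion. Moving one step along its ray before each crossing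
prevents this, and only finitely many crossings occur. -/
theorem exists_reach_ray (hP : P.IsExpansion E) (h : IsRayTree E r a X ρ) (i : Fin n) {w : List A}
    (Δ : BraidedDiagram P w [r]) (c : UpperContact w Δ.bot) : ∀ s,
    subLetter E (contactLabel w Δ.bot c) s = some (X i) → ∃ k s', Relation.ReflTransGen Δ.Next
      (c, s ++ List.replicate k 1) (Δ.wire.symm (.inl (frame r)), s') := by
  induction c using Δ.upper_induction with
  | _ c ih =>
    intro s hs
    rcases hc : Δ.wire c with k | ⟨t, j⟩
    · rw [eq_frame k] at hc
      rw [← hc, Equiv.symm_apply_apply]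
      exact ⟨0, _, .refl⟩
    · obtain ⟨ℓ, -, ht, hb⟩ := Δ.exists_label hP t
      have hz : subLetter E ℓ (addr (Δ.top t) j s ++ [1]) = some (X i) := by
        rw [← Δ.label_wire, hc] at hs
        rw [subLetter_append, subLetter_addr (hP.length_ne_one ℓ) ht]
        change (subLetter E (contactLabel [r] Δ.top (.inr ⟨t, j⟩)) s).bind _ = _
        rw [hs]
        exact h.subLetter_replicate i 1
      obtain ⟨m, s₁, h₁⟩ := exists_addr_eq hb (hP.length_ne_one ℓ) hz (by simp)
      have hn : Δ.Next (c, s ++ [1]) (.inr ⟨t, m⟩, s₁) :=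
        ⟨t, j, m, hc, rfl, by rw [addr_append, h₁]⟩
      obtain ⟨k, s', hr⟩ := ih t j m hc s₁ (by
        rw [← hn.subLetter_eq hP, subLetter_append, hs]
        exact h.subLetter_replicate i 1)
      refine ⟨k + 1, s', ?_⟩
      have := hn.append (List.replicate k 1)
      rw [List.append_assoc] at this
      exact .head this hr

/-- The letter is preserved, and `X i` occurs only on the `i`-th ray; so ends are kept. -/
theorem exists_run_ray (hP : P.IsExpansion E) (h : IsRayTree E r a X ρ) (i : Fin n)
    (Δ : BraidedDiagram P [r] [r]) : ∃ k l, Δ.Run (rayPath ρ i k) (rayPath ρ i l) := by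
  obtain ⟨k, s', hs⟩ := h.exists_reach_ray hP i Δ (.inl (frame r)) (ρ i) (h.subLetter_root i)
  have hs : Δ.Run (rayPath ρ i k) s' := hs
  have hs' := hs.subLetter_eq hP
  rw [h.subLetter_rayPath] at hs'
  rcases h.eq_of_subLetter_root hs'.symm with ⟨-, h1, h2⟩ | ⟨j, l, rfl, h1⟩ | ⟨p, -, h1⟩
  · exact (h2 i h1).elim
  · obtain rfl := h.injective h1
    exact ⟨k, l, hs⟩
  · exact (h.ne_terminal i h1).elim

/-- The permutation reads the diagram from bottom to top. With this choice, stacking diagrams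
corresponds to multiplying permutations in the same order. -/
theorem exists_perm (hP : P.IsExpansion E) (h : IsRayTree E r a X ρ)
    (Δ : BraidedDiagram P [r] [r]) :
    ∃ g : houghtonGroup n, ∀ p, Δ.Run (rayLeaf ρ (g.1 p)) (rayLeaf ρ p) := by
  have hf : ∀ p, ∃ q, Δ.Run (rayLeaf ρ q) (rayLeaf ρ p) := by
    intro p
    obtain ⟨s, hs⟩ := Δ.exists_run_to hP (h.isTerminalPath_iff.2 ⟨p, rfl⟩)
    obtain ⟨q, rfl⟩ : ∃ q, s = rayLeaf ρ q := by
      rw [← h.isTerminalPath_iff]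
      exact ⟨a, (hs.subLetter_eq hP).trans (h.subLetter_rayLeaf p), h.terminal⟩
    exact ⟨q, hs⟩
  have hg : ∀ p, ∃ q, Δ.Run (rayLeaf ρ p) (rayLeaf ρ q) := by
    intro p
    obtain ⟨s, hs⟩ := Δ.exists_run hP (h.isTerminalPath_iff.2 ⟨p, rfl⟩)
    obtain ⟨q, rfl⟩ : ∃ q, s = rayLeaf ρ q := by
      rw [← h.isTerminalPath_iff]
      exact ⟨a, (hs.subLetter_eq hP).symm.trans (h.subLetter_rayLeaf p), h.terminal⟩
    exact ⟨q, hs⟩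
  obtain ⟨e, he⟩ := exists_equiv_of_rel (fun p q => Δ.Run (rayLeaf ρ q) (rayLeaf ρ p)) hf hg
    (fun _ _ _ h1 h2 => h.rayLeaf_injective (h1.left_unique h2))
    (fun _ _ _ h1 h2 => h.rayLeaf_injective (h1.right_unique h2))
  refine ⟨⟨e, preserves_of_eventual_translation fun i => ?_⟩, he⟩
  obtain ⟨k, l, hkl⟩ := h.exists_run_ray hP i Δ
  -- The run of a ray vertex carries everything below it along, which is the translation.
  refine ⟨l, k, fun m => h.rayLeaf_injective ((he _).left_unique ?_)⟩
  rw [rayLeaf_add, rayLeaf_add]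
  exact hkl.append _

/-! ### Every element of the Houghton group comes from a diagram -/

/-- The interior vertices of the subtree cut off at the `K i`-th vertex of the `i`-th ray. -/
def cutTree (ρ : Fin n → List ℕ) (K : Fin n → ℕ) : Set (List ℕ) :=
  {p | (p = [] ∧ ∀ i, ρ i ≠ []) ∨ ∃ i, ∃ k < K i, p = rayPath ρ i k}

theorem letterAt_rayPath (h : IsRayTree E r a X ρ) (i : Fin n) (k : ℕ) :
    letterAt E r (rayPath ρ i k) = X i := by
  rw [letterAt, h.subLetter_rayPath, Option.getD_some]

theorem letterAt_rayLeaf (h : IsRayTree E r a X ρ) (p : Fin n × ℕ) :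
    letterAt E r (rayLeaf ρ p) = a := by
  rw [letterAt, h.subLetter_rayLeaf, Option.getD_some]

theorem isExpansionTree_cutTree (h : IsRayTree E r a X ρ) (K : Fin n → ℕ) :
    IsExpansionTree E r (cutTree ρ K) where
  finite := by
    refine ((Set.finite_singleton []).union (Set.finite_iUnion fun i =>
      (Set.finite_Iio (K i)).image (rayPath ρ i))).subset ?_
    rintro p (⟨rfl, -⟩ | ⟨i, k, hk, rfl⟩)
    · exact .inl rfl
    · exact .inr (Set.mem_iUnion.2 ⟨i, k, hk, rfl⟩)
  ne_nil := by
    rintro p (⟨rfl, -⟩ | ⟨i, k, hk, rfl⟩)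
    · exact h.root_ne_nil
    · rw [h.letterAt_rayPath, h.ray]
      simp
  closed := by
    rintro p m (⟨h', -⟩ | ⟨i, k, hk, h'⟩)
    · simp at h'
    · rcases k with _ | k
      · rw [rayPath_zero] at h'
        rcases h.root with h1 | ⟨h1, h2⟩
        · rw [(h1 i).2] at h'
          simp at h'
        · obtain ⟨rfl, rfl⟩ : p = [] ∧ m = i.1 := by
            rw [(h2 i).2] at h'
            obtain ⟨h3, h4⟩ := List.append_inj' (s₂ := []) h' rfl
            exact ⟨h3, by simpa using h4⟩
          refine ⟨.inl ⟨rfl, fun j => by simp [(h2 j).2]⟩, ?_⟩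
          change i.1 < (E r).length
          simp [h1]
      · rw [rayPath_add] at h'
        obtain ⟨rfl, h4⟩ := List.append_inj' h' rfl
        obtain rfl : m = 1 := by simpa using h4
        refine ⟨.inr ⟨i, k, by omega, rfl⟩, ?_⟩
        rw [h.letterAt_rayPath, h.ray]
        simp

/-- The possible leaves of the cut off tree. -/
def cutLeaf (ρ : Fin n → List ℕ) (K : Fin n → ℕ) : (Fin n × ℕ) ⊕ Fin n → List ℕ :=
  Sum.elim (rayLeaf ρ) fun i => rayPath ρ i (K i)

/-- The index set of the leaves of the cut off tree. -/
def cutIndex (K : Fin n → ℕ) : Set ((Fin n × ℕ) ⊕ Fin n) :=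
  {z | z.elim (fun p => p.2 < K p.1) fun _ => True}

theorem cutLeaf_injective (h : IsRayTree E r a X ρ) (K : Fin n → ℕ) :
    Function.Injective (cutLeaf ρ K) := by
  rintro (p | i) (q | j) h'
  · rw [h.rayLeaf_injective h']
  · exact (h.rayLeaf_ne_rayPath _ _ _ h').elim
  · exact (h.rayLeaf_ne_rayPath _ _ _ h'.symm).elim
  · rw [(h.rayPath_inj h').1]

theorem leaves_cutTree (h : IsRayTree E r a X ρ) (K : Fin n → ℕ) :
    treeNodes E r (cutTree ρ K) \ cutTree ρ K = cutLeaf ρ K '' cutIndex K := by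
  have hroot : ∀ i, ρ i ∈ treeNodes E r (cutTree ρ K) := by
    intro i
    rcases h.root with h1 | ⟨h1, h2⟩
    · exact .inl (h1 i).2
    · refine .inr ⟨[], .inl ⟨rfl, fun j => by simp [(h2 j).2]⟩, i, ?_, (h2 i).2⟩
      change i.1 < (E r).length
      simp [h1]
  have hnext : ∀ i k, k < K i → ∀ m < 2, rayPath ρ i k ++ [m] ∈ treeNodes E r (cutTree ρ K) :=
    fun i k hk m hm => .inr ⟨_, .inr ⟨i, k, hk, rfl⟩, m, by
      rw [h.letterAt_rayPath, h.ray]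
      exact hm, rfl⟩
  have hray : ∀ i k, k ≤ K i → rayPath ρ i k ∉ cutTree ρ K →
      rayPath ρ i k ∈ cutLeaf ρ K '' cutIndex K := by
    intro i k hk h'
    obtain rfl : k = K i := by
      by_contra hne
      exact h' (.inr ⟨i, k, by omega, rfl⟩)
    exact ⟨.inr i, trivial, rfl⟩
  ext x
  constructor
  · rintro ⟨rfl | ⟨p, ⟨rfl, hp⟩ | ⟨i, k, hk, rfl⟩, m, hm, rfl⟩, hx⟩
    · have : ∃ i, ρ i = [] := by
        by_contra hne
        push Not at hne
        exact hx (.inl ⟨rfl, hne⟩)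
      obtain ⟨i, hi⟩ := this
      rw [← hi, ← rayPath_zero ρ i] at hx ⊢
      exact hray i 0 (Nat.zero_le _) hx
    · rcases h.root with h1 | ⟨h1, h2⟩
      · exact (hp ⟨0, h.pos⟩ (h1 _).2).elim
      · have hm : m < n := by
          change m < (E r).length at hm
          simpa [h1] using hm
        have hm' : [] ++ [m] = rayPath ρ ⟨m, hm⟩ 0 := by rw [rayPath_zero, (h2 _).2]; rfl
        rw [hm'] at hx ⊢
        exact hray _ 0 (Nat.zero_le _) hx
    · rw [h.letterAt_rayPath, h.ray] at hm
      rcases m with _ | _ | m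
      · exact ⟨.inl (i, k), hk, rfl⟩
      · have : rayPath ρ i k ++ [0 + 1] = rayPath ρ i (k + 1) := (rayPath_add ρ i k 1).symm
        rw [this] at hx ⊢
        exact hray i (k + 1) hk hx
      · simp at hm
  · rintro ⟨⟨i, k⟩ | i, hz, rfl⟩
    · refine ⟨hnext i k hz 0 Nat.two_pos, ?_⟩
      rintro (⟨h', -⟩ | ⟨j, l, -, h'⟩)
      · simp [cutLeaf, rayLeaf] at h'
      · exact h.rayLeaf_ne_rayPath _ _ _ h'
    · refine ⟨?_, ?_⟩
      · change rayPath ρ i (K i) ∈ _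
        rcases hK : K i with _ | k
        · rw [rayPath_zero]
          exact hroot i
        · rw [rayPath_add]
          exact hnext i k (by omega) 1 Nat.one_lt_two
      · rintro (⟨h', h''⟩ | ⟨j, l, hl, h'⟩)
        · exact h'' i (List.append_eq_nil_iff.1 h').1
        · obtain ⟨rfl, rfl⟩ := h.rayPath_inj h'
          exact lt_irrefl _ hl

/-- Runs go from top to bottom and realize `g⁻¹`, so the expanding tree is cut at `K`, where the
tails of the images start, and the contracting tree at `L`. -/
theorem exists_diagram (hP : P.IsExpansion E) (h : IsRayTree E r a X ρ) (g : houghtonGroup n) :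
    ∃ Δ : BraidedDiagram P [r] [r], ∀ p, Δ.Run (rayLeaf ρ (g.1 p)) (rayLeaf ρ p) := by
  choose L K hg using fun i => eventual_translation g.2.1 g.2.2 i
  have hg' : ∀ i k, g.1⁻¹ (i, K i + k) = (i, L i + k) := fun i k => by
    rw [Equiv.Perm.inv_eq_iff_eq, hg]
  let f : (Fin n × ℕ) ⊕ Fin n → (Fin n × ℕ) ⊕ Fin n := Sum.map (g.1⁻¹ : Equiv.Perm _) id
  -- `g⁻¹` maps the tails beyond `K` onto the tails beyond `L`, hence also their finite complements
  -- onto each other.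
  have hf : Set.BijOn f (cutIndex K) (cutIndex L) := by
    refine ⟨?_, (((Equiv.injective _).sumMap Function.injective_id)).injOn, ?_⟩
    · rintro (p | i) hz
      · change (g.1⁻¹ p).2 < L (g.1⁻¹ p).1
        have hz : p.2 < K p.1 := hz
        by_contra hlt
        obtain ⟨k, hk⟩ := Nat.exists_eq_add_of_le (not_lt.1 hlt)
        have h1 : g.1⁻¹ p = ((g.1⁻¹ p).1, L (g.1⁻¹ p).1 + k) := Prod.ext rfl hk
        rw [← hg'] at h1
        have h2 := (g.1⁻¹).injective h1
        have h3 := congrArg Prod.fst h2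
        have h4 := congrArg Prod.snd h2
        simp only at h3 h4
        rw [h3] at hz
        omega
      · trivial
    · rintro (⟨i, k⟩ | i) hz
      · have hz : k < L i := hz
        refine ⟨.inl (g.1 (i, k)), ?_, by simp [f]⟩
        change (g.1 (i, k)).2 < K (g.1 (i, k)).1
        by_contra hlt
        obtain ⟨l, hl⟩ := Nat.exists_eq_add_of_le (not_lt.1 hlt)
        have h1 : g.1 (i, k) = ((g.1 (i, k)).1, K (g.1 (i, k)).1 + l) := Prod.ext rfl hl
        rw [← hg] at h1
        have h2 := g.1.injective h1
        have h3 := congrArg Prod.fst h2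
        have h4 := congrArg Prod.snd h2
        simp only at h3 h4
        rw [← h3] at h4
        omega
      · exact ⟨.inr i, trivial, rfl⟩
  let π : List ℕ → List ℕ := Function.extend (cutLeaf ρ K) (cutLeaf ρ L ∘ f) id
  have hπ : ∀ z, π (cutLeaf ρ K z) = cutLeaf ρ L (f z) :=
    (h.cutLeaf_injective K).extend_apply _ _
  obtain ⟨Δ, hΔ⟩ := exists_treeDiagram hP (h.isExpansionTree_cutTree K)
    (h.isExpansionTree_cutTree L) (π := π) (by
      rw [h.leaves_cutTree, h.leaves_cutTree]
      refine ⟨?_, ?_, ?_⟩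
      · rintro _ ⟨z, hz, rfl⟩
        exact ⟨f z, hf.mapsTo hz, (hπ z).symm⟩
      · rintro _ ⟨z, hz, rfl⟩ _ ⟨z', hz', rfl⟩ h'
        rw [hπ, hπ] at h'
        rw [hf.injOn hz hz' (h.cutLeaf_injective L h')]
      · rintro _ ⟨z, hz, rfl⟩
        obtain ⟨z, hz', rfl⟩ := hf.surjOn hz
        exact ⟨_, ⟨z, hz', rfl⟩, hπ z⟩) (by
      rw [h.leaves_cutTree]
      rintro _ ⟨p | i, hz, rfl⟩ <;> rw [hπ]
      · exact (h.letterAt_rayLeaf _).trans (h.letterAt_rayLeaf _).symm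
      · exact (h.letterAt_rayPath _ _).trans (h.letterAt_rayPath _ _).symm)
  rw [h.leaves_cutTree] at hΔ
  refine ⟨Δ, fun p => ?_⟩
  obtain ⟨q, rfl⟩ := (g.1⁻¹).surjective p
  have hq : g.1 (g.1⁻¹ q) = q := g.1.apply_symm_apply q
  rw [hq]
  obtain ⟨i, k⟩ := q
  clear hq
  by_cases hk : k < K i
  · have := hΔ _ ⟨.inl (i, k), hk, rfl⟩ []
    rwa [hπ, List.append_nil, List.append_nil] at this
  · obtain ⟨l, rfl⟩ := Nat.exists_eq_add_of_le (not_lt.1 hk)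
    -- A leaf beyond the cut lies below the truncated end of its ray and is carried along with it.
    have := hΔ _ ⟨.inr i, trivial, rfl⟩ (List.replicate l 1 ++ [0])
    rw [hπ] at this
    rw [hg', rayLeaf_add, rayLeaf_add]
    exact this

/-! ### The isomorphism -/

theorem nonempty_mulEquiv (hP : P.IsExpansion E) (h : IsRayTree E r a X ρ) :
    Nonempty (houghtonGroup n ≃* BraidedDiagramGroup P [r]) := by
  choose Φ hΦ using h.exists_perm hP
  have huniq : ∀ Δ (g : houghtonGroup n), (∀ p, Δ.Run (rayLeaf ρ (g.1 p)) (rayLeaf ρ p)) →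
      Φ Δ = g := fun Δ g hg => Subtype.ext (Equiv.ext fun p =>
    h.rayLeaf_injective ((hΦ Δ p).left_unique (hg p)))
  have hstep : ∀ Δ Δ' : BraidedDiagram P [r] [r], Δ.Step Δ' → Φ Δ = Φ Δ' := by
    rintro Δ Δ' (h' | h')
    · exact (huniq _ _ fun p => (hΦ Δ p).of_equivalent h').symm
    · exact huniq _ _ fun p => (hΦ Δ' p).of_reducesTo hP h' (h.isTerminalPath_iff.2 ⟨_, rfl⟩)
  let F : BraidedDiagramGroup P [r] →ₙ* houghtonGroup n :=
    { toFun := Quot.lift Φ hstep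
      map_mul' := by
        rintro ⟨Δ₁⟩ ⟨Δ₂⟩
        exact huniq (Δ₁.concat Δ₂) _ fun p => (hΦ Δ₁ _).concat (hΦ Δ₂ p) }
  have hsurj : Function.Surjective F := by
    intro g
    obtain ⟨Δ, hΔ⟩ := h.exists_diagram hP g
    exact ⟨Quot.mk _ Δ, huniq Δ g hΔ⟩
  let e : BraidedDiagramGroup P [r] := Quot.mk _ (BraidedDiagram.identity P [r])
  have hker : ∀ x, F x = 1 → x = e := by
    rintro ⟨Δ⟩ hx
    refine eqvGen_id_of_run hP h.exists_isTerminalPath Δ fun s hs => ?_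
    obtain ⟨p, rfl⟩ := h.isTerminalPath_iff.1 hs
    have hx : Φ Δ = 1 := hx
    have := hΦ Δ p
    rwa [hx] at this
  have hassoc : ∀ x y z : BraidedDiagramGroup P [r], x * y * z = x * (y * z) := by
    rintro ⟨x⟩ ⟨y⟩ ⟨z⟩
    exact Quot.sound (.inl (concat_assoc x y z))
  have hone : ∀ x : BraidedDiagramGroup P [r], e * x = x ∧ x * e = x := by
    rintro ⟨x⟩
    exact ⟨Quot.sound (.inl (id_concat x)), Quot.sound (.inl (concat_id x))⟩
  have hinj : Function.Injective F := by
    intro x y hxy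
    -- Inverse diagrams have not been constructed; surjectivity supplies `z`, which the trivial
    -- kernel shows to be inverse to both `x` and `y`.
    obtain ⟨z, hz⟩ := hsurj (F x)⁻¹
    have h1 : x * z = e := hker _ (by rw [map_mul, hz, mul_inv_cancel])
    have h2 : z * y = e := hker _ (by rw [map_mul, hz, hxy, inv_mul_cancel])
    rw [← (hone x).2, ← h2, ← hassoc, h1, (hone y).1]
  exact ⟨(MulEquiv.ofBijective F ⟨hinj, hsurj⟩).symm⟩

end IsRayTree

/-! ## The presentations of the Houghton groups -/

/-- The right sides of the relations of `P_n`. -/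
def HoughtonLetter.expand {n : ℕ} : HoughtonLetter n → List (HoughtonLetter n)
  | .a => []
  | .r => List.ofFn HoughtonLetter.x
  | .x i => [.a, .x i]

/-- The right sides of the relations of `P_1`. -/
def HoughtonLetterOne.expand : HoughtonLetterOne → List HoughtonLetterOne
  | .a => []
  | .r => [.a, .r]

theorem SemigroupPresentation.IsExpansion.isTreeLike {A : Type} {P : SemigroupPresentation A}
    {E : A → List A} (hP : P.IsExpansion E) : P.IsTreeLike := by
  constructor
  · intro p hp
    obtain ⟨ℓ, hl, rfl⟩ := hP.eq_of_mem p hp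
    have := hP.length_ne_one ℓ
    have := List.length_pos_iff.2 hl
    exact ⟨rfl, by simp only; omega⟩
  · intro a w₁ w₂ h₁ h₂
    obtain ⟨ℓ₁, -, h₁⟩ := hP.eq_of_mem _ h₁
    obtain ⟨ℓ₂, -, h₂⟩ := hP.eq_of_mem _ h₂
    simp only [Prod.mk.injEq, List.cons.injEq, and_true] at h₁ h₂
    rw [h₁.2, h₂.2, ← h₁.1, ← h₂.1]

theorem isExpansion_houghtonPresentation (n : ℕ) (hn : 2 ≤ n) :
    (houghtonPresentation n hn).IsExpansion HoughtonLetter.expand where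
  eq_of_mem := by
    rintro p (rfl | ⟨i, rfl⟩)
    · exact ⟨.r, by simp only [HoughtonLetter.expand, ne_eq, List.ofFn_eq_nil_iff]; omega, rfl⟩
    · exact ⟨.x i, by simp [HoughtonLetter.expand], rfl⟩
  mem := by
    rintro (_ | _ | i) h
    · exact (h rfl).elim
    · exact .inl rfl
    · exact .inr ⟨i, rfl⟩
  length_ne_one := by
    rintro (_ | _ | i) <;> simp [HoughtonLetter.expand]
    omega

theorem isRayTree_houghtonLetter (n : ℕ) (hn : 2 ≤ n) :
    IsRayTree (n := n) HoughtonLetter.expand .r .a .x fun i => [i.1] where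
  pos := by omega
  terminal := rfl
  ray _ := rfl
  injective _ _ h := HoughtonLetter.x.inj h
  root := .inr ⟨rfl, fun _ => ⟨by simp, rfl⟩⟩
  letters := by
    rintro (_ | _ | i)
    exacts [.inl rfl, .inr (.inl rfl), .inr (.inr ⟨i, rfl⟩)]

theorem isExpansion_houghtonPresentationOne :
    houghtonPresentationOne.IsExpansion HoughtonLetterOne.expand where
  eq_of_mem := by
    rintro p rfl
    exact ⟨.r, by simp [HoughtonLetterOne.expand], rfl⟩
  mem := by
    rintro (_ | _) h
    · exact (h rfl).elim
    · rfl
  length_ne_one := by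
    rintro (_ | _) <;> simp [HoughtonLetterOne.expand]

/-- Here `r` itself is the ray letter, and the only ray starts at the root. -/
theorem isRayTree_houghtonLetterOne :
    IsRayTree (n := 1) HoughtonLetterOne.expand .r .a (fun _ => .r) fun _ => [] where
  pos := Nat.one_pos
  terminal := rfl
  ray _ := rfl
  injective _ _ _ := Subsingleton.elim _ _
  root := .inl fun _ => ⟨rfl, rfl⟩
  letters := by
    rintro (_ | _)
    exacts [.inl rfl, .inr (.inl rfl)]

/-! ## The Houghton groups as groups of local similarities -/

/-- The end compactification of the disjoint union of `n` rays. -/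
inductive RayPoint (n : ℕ) : Type
  | pt (p : Fin n × ℕ)
  | limit (i : Fin n)

namespace RayPoint

variable {n : ℕ}

/-- The ray on which a point lies. -/
def ray : RayPoint n → Fin n
  | pt p => p.1
  | limit i => i

/-- The diameter of the part of the ray beyond a point. -/
noncomputable def size : RayPoint n → ℝ
  | pt p => (1 / 2) ^ p.2
  | limit _ => 0

theorem size_nonneg (x : RayPoint n) : 0 ≤ x.size := by
  cases x <;> simp [size]

theorem size_le_one (x : RayPoint n) : x.size ≤ 1 := by
  cases x
  · exact pow_le_one₀ (by norm_num) (by norm_num)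
  · exact zero_le_one

theorem eq_of_size_eq_zero {x y : RayPoint n} (h : x.ray = y.ray) (hx : x.size ≤ 0)
    (hy : y.size ≤ 0) : x = y := by
  rcases x with p | i <;> rcases y with q | j
  · exact absurd hx (by simp [size])
  · exact absurd hx (by simp [size])
  · exact absurd hy (by simp [size])
  · exact congrArg limit h

/-! ### The compact ultrametric space of rays with their ends. -/

open Classical in
noncomputable instance : Dist (RayPoint n) where
  dist x y := if x = y then 0 else if x.ray = y.ray then max x.size y.size else 2

theorem dist_self' (x : RayPoint n) : dist x x = 0 := if_pos rfl

theorem dist_of_ray_eq {x y : RayPoint n} (h : x ≠ y) (h' : x.ray = y.ray) :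
    dist x y = max x.size y.size := (if_neg h).trans (if_pos h')

theorem dist_of_ray_ne {x y : RayPoint n} (h : x.ray ≠ y.ray) : dist x y = 2 :=
  (if_neg fun h' => h (congrArg ray h')).trans (if_neg h)

theorem dist_comm' (x y : RayPoint n) : dist x y = dist y x := by
  by_cases h : x = y
  · rw [h]
  by_cases h' : x.ray = y.ray
  · rw [dist_of_ray_eq h h', dist_of_ray_eq (Ne.symm h) h'.symm, max_comm]
  · rw [dist_of_ray_ne h', dist_of_ray_ne (Ne.symm h')]

theorem dist_nonneg' (x y : RayPoint n) : 0 ≤ dist x y := by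
  by_cases h : x = y
  · rw [h, dist_self']
  by_cases h' : x.ray = y.ray
  · rw [dist_of_ray_eq h h']
    exact le_max_of_le_left x.size_nonneg
  · rw [dist_of_ray_ne h']
    exact zero_le_two

theorem dist_le_two (x y : RayPoint n) : dist x y ≤ 2 := by
  by_cases h : x = y
  · rw [h, dist_self']
    exact zero_le_two
  by_cases h' : x.ray = y.ray
  · rw [dist_of_ray_eq h h']
    have := x.size_le_one
    have := y.size_le_one
    exact max_le (by linarith) (by linarith)
  · rw [dist_of_ray_ne h']

theorem dist_triangle_max' (x y z : RayPoint n) : dist x z ≤ max (dist x y) (dist y z) := by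
  by_cases hxy : x.ray = y.ray
  swap
  · rw [dist_of_ray_ne hxy]
    exact le_max_of_le_left (dist_le_two x z)
  by_cases hyz : y.ray = z.ray
  swap
  · rw [dist_of_ray_ne hyz]
    exact le_max_of_le_right (dist_le_two x z)
  by_cases h : x = y
  · rw [h]
    exact le_max_right _ _
  by_cases h' : y = z
  · rw [h']
    exact le_max_left _ _
  by_cases h'' : x = z
  · rw [h'', dist_self']
    exact le_max_of_le_left (dist_nonneg' _ _)
  rw [dist_of_ray_eq h hxy, dist_of_ray_eq h' hyz, dist_of_ray_eq h'' (hxy.trans hyz)]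
  exact max_le (le_max_of_le_left (le_max_left _ _)) (le_max_of_le_right (le_max_right _ _))

noncomputable instance : MetricSpace (RayPoint n) where
  dist_self := dist_self'
  dist_comm := dist_comm'
  dist_triangle x y z := (dist_triangle_max' x y z).trans
    (max_le_add_of_nonneg (dist_nonneg' _ _) (dist_nonneg' _ _))
  eq_of_dist_eq_zero := by
    intro x y h
    by_contra hne
    by_cases h' : x.ray = y.ray
    · rw [dist_of_ray_eq hne h'] at h
      exact hne (eq_of_size_eq_zero h' (h ▸ le_max_left _ _) (h ▸ le_max_right _ _))
    · rw [dist_of_ray_ne h'] at h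
      norm_num at h

instance : IsUltrametricDist (RayPoint n) := ⟨dist_triangle_max'⟩

theorem dist_pt_limit (i : Fin n) (k : ℕ) : dist (pt (i, k)) (limit i) = (1 / 2) ^ k := by
  rw [dist_of_ray_eq (x := pt (i, k)) (y := limit i) (by simp) rfl]
  exact max_eq_left (by simp [size])

theorem tendsto_pt (i : Fin n) :
    Filter.Tendsto (fun k => pt (i, k)) Filter.atTop (nhds (limit i)) := by
  rw [tendsto_iff_dist_tendsto_zero]
  simp only [dist_pt_limit]
  exact tendsto_pow_atTop_nhds_zero_of_lt_one (by norm_num) (by norm_num)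

/-- A ray with its end is a convergent sequence together with its limit. -/
instance : CompactSpace (RayPoint n) := by
  constructor
  have h : IsCompact (⋃ i : Fin n, insert (limit i) (Set.range fun k => pt (i, k))) :=
    isCompact_iUnion fun i => (tendsto_pt i).isCompact_insert_range
  convert h using 1
  refine (Set.eq_univ_of_forall fun x => Set.mem_iUnion.2 ⟨x.ray, ?_⟩).symm
  rcases x with ⟨i, k⟩ | i
  · exact .inr ⟨k, rfl⟩
  · exact .inl rfl

/-- Any other point is at distance at least the size of `pt p`, so vertices are isolated. -/
theorem ball_pt (p : Fin n × ℕ) : Metric.ball (pt p) (pt p).size = {pt p} := by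
  ext x
  rw [Metric.mem_ball, Set.mem_singleton_iff]
  constructor
  · intro h
    by_contra hne
    by_cases h' : x.ray = (pt p).ray
    · rw [dist_of_ray_eq hne h'] at h
      exact absurd h (not_lt.2 (le_max_right _ _))
    · rw [dist_of_ray_ne h'] at h
      have := (pt p).size_le_one
      linarith
  · rintro rfl
    rw [dist_self]
    simp [size]

/-- The inequality `a < k` is strict, since the `a`-th vertex lies at distance exactly `(1 / 2) ^ a`
from the end. -/
theorem mem_ball_limit {i : Fin n} {a : ℕ} {x : RayPoint n} :
    x ∈ Metric.ball (limit i) ((1 / 2) ^ a) ↔ x = limit i ∨ ∃ k, a < k ∧ x = pt (i, k) := by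
  rw [Metric.mem_ball]
  constructor
  · intro h
    have h' : x.ray = i := by
      by_contra hne
      rw [dist_of_ray_ne (y := limit i) hne] at h
      have : ((1 : ℝ) / 2) ^ a ≤ 1 := pow_le_one₀ (by norm_num) (by norm_num)
      linarith
    rcases x with ⟨j, k⟩ | j
    · obtain rfl : j = i := h'
      rw [dist_pt_limit, pow_lt_pow_iff_right_of_lt_one₀ (by norm_num) (by norm_num)] at h
      exact .inr ⟨k, h, rfl⟩
    · exact .inl (congrArg limit h')
  · rintro (rfl | ⟨k, hk, rfl⟩)
    · rw [dist_self]
      positivity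
    · rwa [dist_pt_limit, pow_lt_pow_iff_right_of_lt_one₀ (by norm_num) (by norm_num)]

/-! ### Translations and the similarity structure. -/

/-- `y` is the image of `x` under the translation of the rays by `b - a`. -/
def Shift (a b : ℕ) : RayPoint n → RayPoint n → Prop
  | pt p, pt q => p.1 = q.1 ∧ q.2 + a = p.2 + b
  | limit i, limit j => i = j
  | _, _ => False

namespace Shift

variable {a b a' b' : ℕ} {x y z : RayPoint n}

theorem refl (x : RayPoint n) : Shift 0 0 x x := by
  cases x
  exacts [⟨rfl, rfl⟩, rfl]

theorem symm (h : Shift a b x y) : Shift b a y x := by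
  rcases x with p | i <;> rcases y with q | j
  exacts [⟨h.1.symm, h.2.symm⟩, h, h, Eq.symm h]

theorem trans (h : Shift a b x y) (h' : Shift a' b' y z) : Shift (a + a') (b + b') x z := by
  rcases x with p | i <;> rcases y with q | j <;> rcases z with s | k <;>
    simp only [Shift] at h h' ⊢
  · exact ⟨h.1.trans h'.1, by omega⟩
  · exact h.trans h'

theorem ray_eq (h : Shift a b x y) : x.ray = y.ray := by
  rcases x with p | i <;> rcases y with q | j <;> simp only [Shift] at h
  exacts [h.1, h]

theorem right_unique (h : Shift a b x y) (h' : Shift a b x z) : y = z := by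
  rcases x with p | i <;> rcases y with q | j <;> rcases z with s | k <;>
    simp only [Shift] at h h'
  · exact congrArg pt (Prod.ext (h.1.symm.trans h'.1) (by omega))
  · exact congrArg limit (h.symm.trans h')

theorem eq_of_eq (h : Shift a a x y) : x = y := by
  rcases x with p | i <;> rcases y with q | j <;> simp only [Shift] at h
  · exact congrArg pt (Prod.ext h.1 (by omega))
  · exact congrArg limit h

theorem size_mul (h : Shift a b x y) : y.size = (1 / 2) ^ b / (1 / 2) ^ a * x.size := by
  rcases x with p | i <;> rcases y with q | j <;> simp only [Shift] at h
  · rw [div_mul_eq_mul_div, eq_div_iff (by positivity)]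
    simp only [size]
    rw [← pow_add, ← pow_add, h.2, add_comm]
  · simp [size]

/-- A translation that maps a set bijectively to itself and moves a vertex is trivial. -/
theorem eq_of_equiv {B : Set (RayPoint n)} (σ : B ≃ B) (hσ : ∀ x : B, Shift a b x.1 (σ x).1)
    {p : Fin n × ℕ} (hp : pt p ∈ B) : a = b := by
  classical
  have hex : ∃ k, ∃ i, pt (i, k) ∈ B := ⟨p.2, p.1, hp⟩
  obtain ⟨i, hi⟩ := Nat.find_spec hex
  have hmin : ∀ x : B, ∀ q, x.1 = pt q → Nat.find hex ≤ q.2 := fun x q hx =>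
    Nat.find_min' hex ⟨q.1, hx ▸ x.2⟩
  -- The image of a lowest vertex is not lower, so `a ≤ b`; nor is its preimage, so `b ≤ a`.
  have h1 := hσ ⟨_, hi⟩
  have h2 := hσ (σ.symm ⟨_, hi⟩)
  rw [Equiv.apply_symm_apply] at h2
  rcases h : (σ ⟨_, hi⟩).1 with q | j <;> rw [h] at h1 <;> simp only [Shift] at h1
  rcases h' : (σ.symm ⟨_, hi⟩).1 with q' | j <;> rw [h'] at h2 <;> simp only [Shift] at h2
  have h3 := hmin _ _ h
  have h4 := hmin _ _ h'
  omega

end Shift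

/-- The similarities between balls: translations along a ray, restrictions of the identity, and
the maps between single vertices. -/
def IsRaySimilarity {B₁ B₂ : Set (RayPoint n)} (g : B₁ ≃ B₂) : Prop :=
  (∃ p q, B₁ = {pt p} ∧ B₂ = {pt q}) ∨
    ∃ a b, (∀ x : B₁, Shift a b x.1 (g x).1) ∧ (a = b ∨ ∃ i, ∀ x ∈ B₁, x.ray = i)

theorem IsRaySimilarity.exists_dist_eq {B₁ B₂ : Set (RayPoint n)} {g : B₁ ≃ B₂}
    (h : IsRaySimilarity g) :
    ∃ C : ℝ, 0 < C ∧ ∀ x y : B₁, dist (g x) (g y) = C * dist x y := by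
  rcases h with ⟨p, q, rfl, rfl⟩ | ⟨a, b, hg, rfl | ⟨i, hi⟩⟩
  · refine ⟨1, one_pos, fun x y => ?_⟩
    rw [Subsingleton.elim x y, dist_self, dist_self, mul_zero]
  · refine ⟨1, one_pos, fun x y => ?_⟩
    rw [one_mul, Subtype.dist_eq, ← (hg x).eq_of_eq, ← (hg y).eq_of_eq, Subtype.dist_eq]
  -- A translation by `b - a` scales all sizes by this factor. It is a similarity because the ball
  -- lies on one ray; the distance 2 between rays would not scale.
  · refine ⟨(1 / 2) ^ b / (1 / 2) ^ a, by positivity, fun x y => ?_⟩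
    by_cases hxy : x = y
    · rw [hxy, dist_self, dist_self, mul_zero]
    have h1 : (x : RayPoint n).ray = (y : RayPoint n).ray := (hi x x.2).trans (hi y y.2).symm
    have h2 : (g x).1 ≠ (g y).1 := fun h => hxy (g.injective (Subtype.ext h))
    rw [Subtype.dist_eq, Subtype.dist_eq, dist_of_ray_eq (fun h => hxy (Subtype.ext h)) h1,
      dist_of_ray_eq h2 ((hg x).ray_eq.symm.trans (h1.trans (hg y).ray_eq)),
      (hg x).size_mul, (hg y).size_mul, mul_max_of_nonneg _ _ (by positivity)]

/-- Two translations between the same balls differ by a translation of the source onto itself, which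
is trivial if there is a vertex to move. Ends are fixed by every translation. -/
theorem IsRaySimilarity.eq {B₁ B₂ : Set (RayPoint n)} {g g' : B₁ ≃ B₂}
    (h : IsRaySimilarity g) (h' : IsRaySimilarity g') : g = g' := by
  rcases h with ⟨p, q, rfl, rfl⟩ | ⟨a, b, hg, -⟩
  · exact Equiv.ext fun x => Subsingleton.elim _ _
  rcases h' with ⟨p, q, rfl, rfl⟩ | ⟨a', b', hg', -⟩
  · exact Equiv.ext fun x => Subsingleton.elim _ _
  ext x
  rcases hx : x.1 with p | i
  · have hσ : ∀ y : B₁, Shift (a + b') (b + a') y.1 ((g.trans g'.symm) y).1 := by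
      intro y
      have h2 := hg' (g'.symm (g y))
      rw [Equiv.apply_symm_apply] at h2
      exact (hg y).trans h2.symm
    have h3 := Shift.eq_of_equiv _ hσ (p := p) (hx ▸ x.2)
    have h4 := hσ x
    rw [h3] at h4
    have h5 : x = g'.symm (g x) := Subtype.ext h4.eq_of_eq
    rw [Equiv.eq_symm_apply] at h5
    exact congrArg Subtype.val h5.symm
  · have h1 := hg x
    have h2 := hg' x
    rw [hx] at h1 h2
    rcases h₀ : (g x).1 with q | j <;> rw [h₀] at h1 <;> simp only [Shift] at h1
    rcases h : (g' x).1 with q | j <;> rw [h] at h2 <;> simp only [Shift] at h2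
    rw [← h1, ← h2]

/-- The finite similarity structure on the end compactification of the rays. -/
def similarityStructure (n : ℕ) : FiniteSimilarityStructure (RayPoint n) where
  sim _ _ := {g | IsRaySimilarity g}
  similarity _ _ _ h := h.exists_dist_eq
  finite _ _ := Set.Subsingleton.finite fun _ h _ h' => h.eq h'
  refl_mem _ := .inr ⟨0, 0, fun x => Shift.refl x.1, .inl rfl⟩
  symm_mem := by
    rintro B₁ B₂ g (⟨p, q, h₁, h₂⟩ | ⟨a, b, hg, h⟩)
    · exact .inl ⟨q, p, h₂, h₁⟩
    · have hg' : ∀ x : B₂.carrier, Shift b a x.1 (g.symm x).1 := fun x => by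
        simpa using (hg (g.symm x)).symm
      refine .inr ⟨b, a, hg', h.imp Eq.symm ?_⟩
      rintro ⟨i, hi⟩
      exact ⟨i, fun x hx => (hg' ⟨x, hx⟩).ray_eq.trans (hi _ (g.symm ⟨x, hx⟩).2)⟩
  trans_mem := by
    -- A translation maps a single-vertex ball to a single-vertex ball, so mixed composites are
    -- again maps between single vertices.
    have key : ∀ {B₁ B₂ : Set (RayPoint n)} {p} (g : B₁ ≃ B₂) {a b},
        (∀ x : B₁, Shift a b x.1 (g x).1) → (B₁ = {pt p} → ∃ q, B₂ = {pt q}) := by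
      rintro B₁ B₂ p g a b hg rfl
      have h := hg ⟨_, rfl⟩
      rcases h' : (g ⟨_, rfl⟩).1 with q | j <;> rw [h'] at h <;> simp only [Shift] at h
      refine ⟨q, Set.eq_singleton_iff_unique_mem.2 ⟨h' ▸ (g ⟨_, rfl⟩).2, fun y hy => ?_⟩⟩
      rw [← h', show (⟨pt p, rfl⟩ : ({pt p} : Set (RayPoint n))) = g.symm ⟨y, hy⟩ from
        Subsingleton.elim _ _, Equiv.apply_symm_apply]
    rintro B₁ B₂ B₃ g (⟨p, q, h₁, h₂⟩ | ⟨a, b, hg, h⟩) g' (⟨p', q', h₂', h₃⟩ | ⟨a', b', hg', h'⟩)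
    · exact .inl ⟨p, q', h₁, h₃⟩
    · obtain ⟨q', hq'⟩ := key g' hg' h₂
      exact .inl ⟨p, q', h₁, hq'⟩
    · obtain ⟨p, hp⟩ := key g.symm (a := b) (b := a)
        (fun x => by simpa using (hg (g.symm x)).symm) h₂'
      exact .inl ⟨p, q', hp, h₃⟩
    · refine .inr ⟨a + a', b + b', fun x => (hg x).trans (hg' (g x)), ?_⟩
      rcases h with rfl | h
      · rcases h' with rfl | ⟨i, hi⟩
        · exact .inl rfl
        · exact .inr ⟨i, fun x hx => (hg ⟨x, hx⟩).ray_eq.trans (hi _ (g ⟨x, hx⟩).2)⟩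
      · exact .inr h
  restrict_mem := by
    rintro B₁ B₂ B₃ B₄ h (⟨p, q, h₁, h₂⟩ | ⟨a, b, hh, h'⟩) hB g hg
    · have hne : B₃.carrier.Nonempty := by
        obtain ⟨x, r, hr, hx⟩ := B₃.exists_eq_ball
        exact ⟨x, hx ▸ Metric.mem_ball_self hr⟩
      have h₃ : B₃.carrier = {pt p} := hne.subset_singleton_iff.1 (h₁ ▸ hB)
      refine .inl ⟨p, q, h₃, Set.Nonempty.subset_singleton_iff ?_ |>.1 ?_⟩
      · obtain ⟨x, hx⟩ := hne
        exact ⟨_, (g ⟨x, hx⟩).2⟩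
      · intro y hy
        have h1 := hg (g.symm ⟨y, hy⟩)
        rw [Equiv.apply_symm_apply] at h1
        have h2 : y ∈ B₂.carrier := by
          change y = _ at h1
          rw [h1]
          exact (h _).2
        rwa [h₂] at h2
    · refine .inr ⟨a, b, fun x => ?_, h'.imp id ?_⟩
      · rw [hg]
        exact hh ⟨x, hB x.2⟩
      · rintro ⟨i, hi⟩
        exact ⟨i, fun x hx => hi x (hB hx)⟩

/-! ### Elements of the Houghton group as locally determined homeomorphisms. -/

/-- The extension of a permutation of the vertices that fixes the ends. -/
def extend (g : Equiv.Perm (Fin n × ℕ)) : Equiv.Perm (RayPoint n) where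
  toFun
    | pt p => pt (g p)
    | limit i => limit i
  invFun
    | pt p => pt (g.symm p)
    | limit i => limit i
  left_inv := by rintro (p | i) <;> simp
  right_inv := by rintro (p | i) <;> simp

/-- The ball that consists of a single vertex. -/
noncomputable def vertexBall (p : Fin n × ℕ) : MetricBall (RayPoint n) :=
  ⟨{pt p}, pt p, (pt p).size, by simp [size], (ball_pt p).symm⟩

/-- The ball around an end that consists of the points beyond the `a`-th vertex. -/
noncomputable def tailBall (i : Fin n) (a : ℕ) : MetricBall (RayPoint n) :=
  ⟨Metric.ball (limit i) ((1 / 2) ^ a), _, _, by positivity, rfl⟩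

theorem mem_tailBall_iff {g : Equiv.Perm (Fin n × ℕ)} {i : Fin n} {a b : ℕ}
    (hg : ∀ k, g (i, a + k) = (i, b + k)) (x : RayPoint n) :
    x ∈ (tailBall i a).carrier ↔ extend g x ∈ (tailBall i b).carrier := by
  refine mem_ball_limit.trans (Iff.trans ?_ mem_ball_limit.symm)
  constructor
  · rintro (rfl | ⟨k, hk, rfl⟩)
    · exact .inl rfl
    · obtain ⟨m, rfl⟩ := Nat.exists_eq_add_of_lt hk
      exact .inr ⟨b + (m + 1), by omega, congrArg pt (hg (m + 1))⟩
  · rcases x with p | j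
    · rintro (h | ⟨k, hk, h⟩)
      · cases h
      · obtain ⟨m, rfl⟩ := Nat.exists_eq_add_of_lt hk
        have h1 : g p = (i, b + m + 1) := by injection h
        have h2 : g (i, a + (m + 1)) = (i, b + m + 1) := hg (m + 1)
        rw [g.injective (h1.trans h2.symm)]
        exact .inr ⟨a + (m + 1), by omega, rfl⟩
    · rintro (h | ⟨k, hk, h⟩)
      · exact .inl h
      · cases h

theorem shift_extend {g : Equiv.Perm (Fin n × ℕ)} {i : Fin n} {a b : ℕ}
    (hg : ∀ k, g (i, a + k) = (i, b + k)) {x : RayPoint n} (hx : x ∈ (tailBall i a).carrier) :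
    Shift a b x (extend g x) := by
  rcases mem_ball_limit.1 hx with rfl | ⟨k, hk, rfl⟩
  · exact rfl
  · obtain ⟨m, rfl⟩ := Nat.exists_eq_add_of_le hk.le
    change Shift a b (pt _) (pt (g _))
    rw [hg]
    exact ⟨rfl, by simp only; omega⟩

theorem ray_of_mem_tailBall {i : Fin n} {a : ℕ} {x : RayPoint n}
    (hx : x ∈ (tailBall i a).carrier) : x.ray = i := by
  rcases mem_ball_limit.1 hx with rfl | ⟨k, -, rfl⟩ <;> rfl

theorem continuous_extend {g : Equiv.Perm (Fin n × ℕ)}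
    (hg : ∀ i, ∃ a b : ℕ, ∀ k, g (i, a + k) = (i, b + k)) : Continuous (extend g) := by
  rw [continuous_iff_continuousAt]
  rintro (p | i)
  · refine ContinuousAt.congr (f := fun _ => extend g (pt p)) continuousAt_const ?_
    filter_upwards [Metric.ball_mem_nhds (pt p) (ε := (pt p).size) (by simp [size])] with x hx
    rw [ball_pt] at hx
    rw [hx]
  · obtain ⟨a, b, h⟩ := hg i
    rw [Metric.continuousAt_iff]
    intro ε hε
    obtain ⟨N, hN⟩ := exists_pow_lt_of_lt_one hε (show (1 / 2 : ℝ) < 1 by norm_num)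
    -- Starting the translation `N` vertices later makes the radius of the image ball smaller than
    -- `ε`.
    have h' : ∀ k, g (i, (a + N) + k) = (i, (b + N) + k) := fun k => by
      rw [add_assoc, h, add_assoc]
    refine ⟨(1 / 2) ^ (a + N), by positivity, fun {x} hx => ?_⟩
    have h1 : dist (extend g x) (limit i) < (1 / 2) ^ (b + N) :=
      Metric.mem_ball.1 ((mem_tailBall_iff h' x).1 (Metric.mem_ball.2 hx))
    refine h1.trans_le (le_trans ?_ hN.le)
    exact pow_le_pow_of_le_one (by norm_num) (by norm_num) (by omega)

/-- The homeomorphism induced by an element of the Houghton group. -/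
def extendHomeomorph (g : houghtonGroup n) : RayPoint n ≃ₜ RayPoint n where
  toEquiv := extend g.1
  continuous_toFun := continuous_extend (eventual_translation g.2.1 g.2.2)
  continuous_invFun := continuous_extend (g := (g⁻¹).1)
    (eventual_translation (g⁻¹).2.1 (g⁻¹).2.2)

theorem extendHomeomorph_mem (g : houghtonGroup n) :
    extendHomeomorph g ∈ (similarityStructure n).group := by
  rintro (p | i)
  · let e : (vertexBall p).carrier ≃ (vertexBall (g.1 p)).carrier :=
      Equiv.ofUnique ({pt p} : Set (RayPoint n)) ({pt (g.1 p)} : Set (RayPoint n))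
    have he : ∀ y : (vertexBall p).carrier, (e y : RayPoint n) = extendHomeomorph g y := by
      rintro ⟨y, rfl⟩
      exact (e ⟨pt p, rfl⟩).2
    exact ⟨vertexBall p, vertexBall (g.1 p), rfl,
      FiniteSimilarityStructure.image_eq_of_agree he, e, .inl ⟨p, g.1 p, rfl, rfl⟩, he⟩
  · obtain ⟨a, b, h⟩ := eventual_translation g.2.1 g.2.2 i
    let e : (tailBall i a).carrier ≃ (tailBall i b).carrier :=
      (extend g.1).subtypeEquiv (mem_tailBall_iff h)
    have he : ∀ y : (tailBall i a).carrier, (e y : RayPoint n) = extendHomeomorph g y :=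
      fun _ => rfl
    exact ⟨tailBall i a, tailBall i b, mem_ball_limit.2 (.inl rfl),
      FiniteSimilarityStructure.image_eq_of_agree he, e,
      .inr ⟨a, b, fun x => shift_extend h x.2, .inr ⟨i, fun _ => ray_of_mem_tailBall⟩⟩, he⟩

/-- Every similarity sends vertices to vertices. A ball around an end is not a single vertex, so
near an end the map is a translation; it fixes the end and shifts a tail of the ray. -/
theorem exists_extendHomeomorph_eq {h : RayPoint n ≃ₜ RayPoint n}
    (hh : h ∈ (similarityStructure n).group) : ∃ g, extendHomeomorph g = h := by
  have hpt : ∀ p, ∃ q, h (pt p) = pt q := by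
    intro p
    obtain ⟨B, B', hx, -, g, ⟨p', q', -, h₂⟩ | ⟨a, b, hg, -⟩, hgh⟩ := hh (pt p)
    · have h1 := (g ⟨_, hx⟩).2
      rw [hgh, h₂] at h1
      exact ⟨q', h1⟩
    · have h1 := hg ⟨_, hx⟩
      rw [hgh] at h1
      rcases h2 : h (pt p) with q | j
      · exact ⟨q, rfl⟩
      · simp [h2, Shift] at h1
  have hlim : ∀ i, h (limit i) = limit i ∧ ∃ a b, ∀ k, h (pt (i, a + k)) = pt (i, b + k) := by
    intro i
    obtain ⟨B, B', hx, -, g, ⟨p', q', h₁, -⟩ | ⟨a, b, hg, -⟩, hgh⟩ := hh (limit i)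
    · rw [h₁] at hx
      cases hx
    · have hs : ∀ y ∈ B.carrier, Shift a b y (h y) := fun y hy => hgh ⟨y, hy⟩ ▸ hg ⟨y, hy⟩
      constructor
      · have h1 := hs _ hx
        rcases h2 : h (limit i) with q | j <;> rw [h2] at h1 <;> simp only [Shift] at h1
        rw [h1]
      · have hopen : IsOpen B.carrier := by
          obtain ⟨x, r, -, hB⟩ := B.exists_eq_ball
          rw [hB]
          exact Metric.isOpen_ball
        obtain ⟨N, hN⟩ := Filter.eventually_atTop.1
          ((tendsto_pt i).eventually (hopen.mem_nhds hx))
        -- The summand `a` lets the image index `N + b + k` be written without subtraction.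
        refine ⟨N + a, N + b, fun k => ?_⟩
        have h1 := hs _ (hN (N + a + k) (by omega))
        rcases h2 : h (pt (i, N + a + k)) with ⟨j, l⟩ | j <;> rw [h2] at h1 <;>
          simp only [Shift] at h1
        exact congrArg pt (Prod.ext h1.1.symm (by simp only; omega))
  obtain ⟨e, he⟩ := exists_equiv_of_rel (fun p q => h (pt p) = pt q) hpt
    (fun q => by
      obtain ⟨x, hx⟩ := h.surjective (pt q)
      rcases x with p | i
      · exact ⟨p, hx⟩
      · rw [(hlim i).1] at hx
        cases hx)
    (fun _ _ _ h1 h2 => by injection h1.symm.trans h2)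
    (fun _ _ _ h1 h2 => by injection h.injective (h1.trans h2.symm))
  refine ⟨⟨e, preserves_of_eventual_translation fun i => ?_⟩, ?_⟩
  · obtain ⟨-, a, b, hab⟩ := hlim i
    exact ⟨a, b, fun k => by injection (he _).symm.trans (hab k)⟩
  · ext x
    rcases x with p | i
    exacts [(he p).symm, (hlim i).1.symm]

theorem nonempty_mulEquiv (n : ℕ) :
    Nonempty (houghtonGroup n ≃* (similarityStructure n).group) := by
  let F : houghtonGroup n →ₙ* (similarityStructure n).group :=
    { toFun := fun g => ⟨extendHomeomorph g, extendHomeomorph_mem g⟩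
      map_mul' := fun g g' => Subtype.ext (Homeomorph.ext (by rintro (p | i) <;> rfl)) }
  refine ⟨MulEquiv.ofBijective F ⟨fun g g' h => Subtype.ext (Equiv.ext fun p => ?_), fun h => ?_⟩⟩
  · have h1 := congrArg (fun f : (similarityStructure n).group => f.1 (pt p)) h
    injection h1
  · obtain ⟨g, hg⟩ := exists_extendHomeomorph_eq h.2
    exact ⟨g, Subtype.ext hg⟩

end RayPoint

theorem mainTheorem2 :
    (∀ (n : ℕ) (hn : 2 ≤ n), (houghtonPresentation n hn).IsTreeLike ∧
      Nonempty (houghtonGroup n ≃* BraidedDiagramGroup (houghtonPresentation n hn) [.r])) ∧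
    (houghtonPresentationOne.IsTreeLike ∧
      Nonempty (houghtonGroup 1 ≃* BraidedDiagramGroup houghtonPresentationOne [.r])) ∧
    (∀ n : ℕ, 1 ≤ n →
      ∃ (X : Type) (_ : MetricSpace X) (_ : IsUltrametricDist X) (_ : CompactSpace X)
        (S : FiniteSimilarityStructure X), S.IsSmall ∧ Nonempty (houghtonGroup n ≃* S.group)) := by
  refine ⟨fun n hn => ?_, ?_, fun n _ => ?_⟩
  · have hP := isExpansion_houghtonPresentation n hn
    exact ⟨hP.isTreeLike, (isRayTree_houghtonLetter n hn).nonempty_mulEquiv hP⟩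
  · have hP := isExpansion_houghtonPresentationOne
    exact ⟨hP.isTreeLike, isRayTree_houghtonLetterOne.nonempty_mulEquiv hP⟩
  · exact ⟨RayPoint n, inferInstance, inferInstance, inferInstance, RayPoint.similarityStructure n,
      fun _ _ _ h _ h' => RayPoint.IsRaySimilarity.eq h h', RayPoint.nonempty_mulEquiv n⟩
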